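/- Let $(\Omega,\mathcal F,P)$ be a probability space, $(\mathcal F_t)_{0\le t\le T}$ a filtration such that $\mathcal F_0$ contains all $P$-null sets of $\mathcal F$, and $(S_t)_{0\le t\le T}$ an adapted $\mathbb R^d$-valued process; put $\Delta S_t=S_t-S_{t-1}$. Let $\Xi_t$ be the set of $\mathcal F_t$-measurable $\mathbb R^d$-valued random variables. A strategy is a family $\phi=(\phi_t)_{1\le t\le T}$ with $\phi_t\in\Xi_{t-1}$, and for $c\in\mathbb R$ we write $V_T^{c,\phi}=c+\sum_{t=1}^T\langle\phi_t,\Delta S_t\rangle$. Expectations and conditional expectations of extended real variables are understood in the generalized sense (difference of those of the positive and the negative part, well defined if the two are not both infinite). Let $U:\mathbb R\to\mathbb R$ be concave, strictly increasing and continuously differentiable with $U(0)=0$, and suppose that at least one of the following holds: (a) there are $\tilde x>0$ and $0<\gamma<1$ with $U(\lambda x)\le\lambda^{\gamma}U(x)$ for all $x\ge\tilde x$ and $\lambda\ge1$; (b) there are $\tilde x\le0$ and $\alpha>0$ with $U(\lambda x)\le\lambda^{1+\alpha}U(x)$ for all $x\le\tilde x$ and $\lambda\ge1$. Suppose further that -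 $S$ is bounded, that is, there is a constant $M$ with $|S_t|\le M$ a.s. for all $t$; - (NA) holds: for every strategy $\phi$, if $V_T^{0,\phi}\ge0$ a.s. then $V_T^{0,\phi}=0$ a.s.; - the random functions defined backwards by $U_T(x)=U(x)$ and $$U_t(x)=\operatorname*{ess\,sup}_{\xi\in\Xi_t}E\bigl(U_{t+1}(x+\langle\xi,\Delta S_{t+1}\rangle)\,\big|\,\mathcal F_t\bigr),\qquad 0\le t<T,\ x\in\mathbb R,$$ are well defined (where $U_{t+1}$ is evaluated at a random argument through its version that is right-continuous in $x$, obtained from the rational points), with $U_t(x)<\infty$ a.s. for all $0\le t<T$ and $x\in\mathbb R$, and $EU_0(x)<\infty$ for all $x\in\mathbb R$. Let $c\in\mathbb R$. Call a strategy $\phi^*$ optimal for initial capital $c$ if $EU(V_T^{c,\phi^*})$ is well defined, is less than $\infty$, and equals the supremum of $EU(V_T^{c,\phi})$ over all strategies $\phi$ for which this expectation is well defined. Then an optimal strategy exists, and for every optimal strategy $\phi^*$ one has $0<EU'(V_T^{c,\phi^*})<\infty$, and $$\frac{dQ}{dP}=\frac{U'(V_T^{c,\phi^*})}{EU'(V_T^{c,\phi^*})}$$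 defines a probability measure $Q$ that is equivalent to $P$ and under which $(S_t)_{0\le t\le T}$ is an $(\mathcal F_t)$-martingale. -/

import Mathlib

open MeasureTheory ProbabilityTheory Filter Set

noncomputable section

namespace UtilityMax

/-! ### Extended expectations and conditional expectations -/

section Expectation

variable {Ω : Type*} {mΩ : MeasurableSpace Ω}

/-- The expectation of an extended real random variable is well defined: the positive part or the
negative part has finite expectation. -/
def ExpWellDefined (P : Measure Ω) (X : Ω → EReal) : Prop :=
  (∫⁻ ω, (X ω).toENNReal ∂P) < ⊤ ∨ (∫⁻ ω, (-X ω).toENNReal ∂P) < ⊤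

/-- The extended expectation `E X⁺ - E X⁻`, meaningful under `ExpWellDefined`. Here
`EReal.toENNReal` is the positive part. -/
def extExp (P : Measure Ω) (X : Ω → EReal) : EReal :=
  ((∫⁻ ω, (X ω).toENNReal ∂P : ENNReal) : EReal) -
    ((∫⁻ ω, (-X ω).toENNReal ∂P : ENNReal) : EReal)

/-- The generalized conditional expectation `E(X | m)` is well defined: almost surely
`E(X⁺ | m) < ∞` or `E(X⁻ | m) < ∞`. -/
def CondExpWellDefined (P : Measure Ω) (m : MeasurableSpace Ω) (X : Ω → EReal) : Prop :=
  ∀ᵐ ω ∂P, condLExp m P (fun ω' => (X ω').toENNReal) ω < ⊤ ∨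
    condLExp m P (fun ω' => (-X ω').toENNReal) ω < ⊤

/-- The generalized conditional expectation `E(X | m) = E(X⁺ | m) - E(X⁻ | m)`, meaningful under
`CondExpWellDefined`. -/
def genCondExp (P : Measure Ω) (m : MeasurableSpace Ω) (X : Ω → EReal) : Ω → EReal := fun ω =>
  ((condLExp m P (fun ω' => (X ω').toENNReal) ω : ENNReal) : EReal) -
    ((condLExp m P (fun ω' => (-X ω').toENNReal) ω : ENNReal) : EReal)

/-- `u` is a version (measurable with respect to `m`) of the essential supremum of the family `G`:
an almost sure upper bound of `G` which is almost surely below every other one. -/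
def IsEssSup (P : Measure Ω) (m : MeasurableSpace Ω) (G : Set (Ω → EReal)) (u : Ω → EReal) :
    Prop :=
  Measurable[m] u ∧ (∀ g ∈ G, g ≤ᵐ[P] u) ∧
    ∀ v : Ω → EReal, Measurable[mΩ] v → (∀ g ∈ G, g ≤ᵐ[P] v) → u ≤ᵐ[P] v

/-- The value `W(X(ω), ω)` of a random function at a random point. A random function that is
only given up to a null set for each `x` (as an essential supremum is) is evaluated through its
right-continuous version `x ↦ inf {W(q, ω) : q rational, q > x}`; for the finite-valued
nondecreasing concave random functions met below this is their continuous version. Changing each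
`W x` on a null set changes `randomEval W X` only on a null set. -/
def randomEval (W : ℝ → Ω → EReal) (X : Ω → ℝ) : Ω → EReal := fun ω =>
  ⨅ q : {q : ℚ // X ω < (q : ℝ)}, W ((q : ℚ) : ℝ) ω

end Expectation

/-! ### The utility function -/

/-- Concave nondecreasing utility, `U 0 = 0`, with the growth condition at `+∞`. -/
def ElasticityAtTop (U : ℝ → ℝ) : Prop :=
  ConcaveOn ℝ univ U ∧ Monotone U ∧ U 0 = 0 ∧
    ∃ x₀ γ : ℝ, 0 < x₀ ∧ 0 < γ ∧ γ < 1 ∧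
      ∀ x l : ℝ, x₀ ≤ x → 1 ≤ l → U (l * x) ≤ l ^ γ * U x

/-- Concave nondecreasing utility, `U 0 = 0`, with the growth condition at `-∞`. -/
def ElasticityAtBot (U : ℝ → ℝ) : Prop :=
  ConcaveOn ℝ univ U ∧ Monotone U ∧ U 0 = 0 ∧
    ∃ x₀ α : ℝ, x₀ ≤ 0 ∧ 0 < α ∧
      ∀ x l : ℝ, x ≤ x₀ → 1 ≤ l → U (l * x) ≤ l ^ (1 + α) * U x

/-! ### The market: times `0, …, T`, with `d` assets -/

section Market

variable {Ω : Type*} {mΩ : MeasurableSpace Ω} {T d : ℕ}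

/-- `ΔS`: for `i : Fin T` the increment of the price over the `i`-th trading period, from time
`i.castSucc` to time `i.succ`. -/
def increment (S : Fin (T + 1) → Ω → EuclideanSpace ℝ (Fin d)) (i : Fin T) (ω : Ω) :
    EuclideanSpace ℝ (Fin d) :=
  S i.succ ω - S i.castSucc ω

/-- A trading strategy: the portfolio `φ i` held over the `i`-th period is measurable with respect
to the information at the beginning of that period. -/
def IsStrategy (ℱ : Filtration (Fin (T + 1)) mΩ)
    (φ : Fin T → Ω → EuclideanSpace ℝ (Fin d)) : Prop :=
  ∀ i : Fin T, Measurable[ℱ i.castSucc] (φ i)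

/-- Terminal wealth `V_T^{c, φ} = c + ∑ ⟨φ_i, ΔS_i⟩`. -/
def terminalWealth (S : Fin (T + 1) → Ω → EuclideanSpace ℝ (Fin d)) (c : ℝ)
    (φ : Fin T → Ω → EuclideanSpace ℝ (Fin d)) (ω : Ω) : ℝ :=
  c + ∑ i : Fin T, inner ℝ (φ i ω) (increment S i ω)

/-- Absence of arbitrage. -/
def NoArbitrage (P : Measure Ω) (ℱ : Filtration (Fin (T + 1)) mΩ)
    (S : Fin (T + 1) → Ω → EuclideanSpace ℝ (Fin d)) : Prop :=
  ∀ φ : Fin T → Ω → EuclideanSpace ℝ (Fin d), IsStrategy ℱ φ →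
    (∀ᵐ ω ∂P, 0 ≤ terminalWealth S 0 φ ω) → ∀ᵐ ω ∂P, terminalWealth S 0 φ ω = 0

/-- The one-period objective `U_{t+1}(x + ⟨ξ, ΔS_{t+1}⟩)`, with `W` in the role of `U_{t+1}`. -/
def oneStepUtility (S : Fin (T + 1) → Ω → EuclideanSpace ℝ (Fin d)) (W : ℝ → Ω → EReal)
    (t : Fin T) (x : ℝ) (ξ : Ω → EuclideanSpace ℝ (Fin d)) : Ω → EReal :=
  randomEval W (fun ω => x + inner ℝ (ξ ω) (increment S t ω))

/-- `W t x` is a version of `U_t(x)`, where `U_T(x) = U(x)` and, for `t < T`,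
`U_t(x) = ess sup { E(U_{t+1}(x + ⟨ξ, ΔS_{t+1}⟩) | ℱ_t) : ξ is ℱ_t-measurable }`, all these
conditional expectations being well defined. -/
def IsValueFamily (P : Measure Ω) (ℱ : Filtration (Fin (T + 1)) mΩ)
    (S : Fin (T + 1) → Ω → EuclideanSpace ℝ (Fin d)) (U : ℝ → ℝ)
    (W : Fin (T + 1) → ℝ → Ω → EReal) : Prop :=
  (∀ x ω, W (Fin.last T) x ω = (U x : EReal)) ∧
  ∀ (t : Fin T) (x : ℝ),
    (∀ ξ : Ω → EuclideanSpace ℝ (Fin d), Measurable[ℱ t.castSucc] ξ →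
      CondExpWellDefined P (ℱ t.castSucc) (oneStepUtility S (W t.succ) t x ξ)) ∧
    IsEssSup P (ℱ t.castSucc)
      {Z | ∃ ξ : Ω → EuclideanSpace ℝ (Fin d), Measurable[ℱ t.castSucc] ξ ∧
        Z = genCondExp P (ℱ t.castSucc) (oneStepUtility S (W t.succ) t x ξ)}
      (W t.castSucc x)

/-- The functions `U_t` are well defined, `U_t(x) < ∞` almost surely for `t < T`, and
`E U_0(x) < ∞`, for all `x`. -/
def FiniteValue (P : Measure Ω) (ℱ : Filtration (Fin (T + 1)) mΩ)
    (S : Fin (T + 1) → Ω → EuclideanSpace ℝ (Fin d)) (U : ℝ → ℝ) : Prop :=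
  ∃ W : Fin (T + 1) → ℝ → Ω → EReal, IsValueFamily P ℱ S U W ∧
    (∀ (t : Fin T) (x : ℝ), ∀ᵐ ω ∂P, W t.castSucc x ω < ⊤) ∧
    ∀ x : ℝ, ExpWellDefined P (W 0 x) ∧ extExp P (W 0 x) < ⊤

/-- The utility of terminal wealth, as an extended real random variable. -/
def terminalUtility (S : Fin (T + 1) → Ω → EuclideanSpace ℝ (Fin d)) (U : ℝ → ℝ) (c : ℝ)
    (φ : Fin T → Ω → EuclideanSpace ℝ (Fin d)) (ω : Ω) : EReal :=
  (U (terminalWealth S c φ ω) : EReal)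

/-- `φ` is an optimal strategy for initial capital `c`: among all strategies whose expected utility
`E U(V_T^{c, ·})` is well defined it attains the supremum of the expected utilities, and that
supremum is finite from above. -/
def IsOptimal (P : Measure Ω) (ℱ : Filtration (Fin (T + 1)) mΩ)
    (S : Fin (T + 1) → Ω → EuclideanSpace ℝ (Fin d)) (U : ℝ → ℝ) (c : ℝ)
    (φ : Fin T → Ω → EuclideanSpace ℝ (Fin d)) : Prop :=
  IsStrategy ℱ φ ∧ ExpWellDefined P (terminalUtility S U c φ) ∧
    extExp P (terminalUtility S U c φ) < ⊤ ∧
    ∀ ψ : Fin T → Ω → EuclideanSpace ℝ (Fin d), IsStrategy ℱ ψ →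
      ExpWellDefined P (terminalUtility S U c ψ) →
      extExp P (terminalUtility S U c ψ) ≤ extExp P (terminalUtility S U c φ)

/-- A probability measure `Q`, equivalent to `P`, under which `S` is a martingale. -/
def IsEquivMartingaleMeasure (P Q : Measure Ω) (ℱ : Filtration (Fin (T + 1)) mΩ)
    (S : Fin (T + 1) → Ω → EuclideanSpace ℝ (Fin d)) : Prop :=
  IsProbabilityMeasure Q ∧ Q ≪ P ∧ P ≪ Q ∧ Martingale S ℱ Q

/-- The measure `Q` with `dQ/dP = U'(V_T^{c, φ}) / E U'(V_T^{c, φ})`. -/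
def marginalUtilityMeasure (P : Measure Ω) (S : Fin (T + 1) → Ω → EuclideanSpace ℝ (Fin d))
    (U : ℝ → ℝ) (c : ℝ) (φ : Fin T → Ω → EuclideanSpace ℝ (Fin d)) : Measure Ω :=
  P.withDensity fun ω => ENNReal.ofReal
    (deriv U (terminalWealth S c φ ω) / ∫ ω', deriv U (terminalWealth S c φ ω') ∂P)

end Market

end UtilityMax

end

/-!
*Existence.* By (NA), minimising a smooth loss `E ℓ⟨ξ, ΔS⟩` over the portfolios of each period
yields an equivalent measure `Q` with bounded density under which all increments of `S` are
conditionally centred. Along nearly optimal strategies the elasticity condition bounds the negative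
parts of the utility, hence those of the terminal wealth; as the gains are centred under `Q`, they
are bounded in `L¹(Q)`. The lemma of Komlós then produces convex combinations of the strategies
whose gains converge almost surely. Once the components along the conditionally null directions of
the increments are projected away, the portfolios themselves converge along a subsequence. The
limit is optimal: Fatou's lemma controls the negative parts of the utility, and domination by the
value functions `U_t` on events with bounded wealth controls the positive parts.

*Martingale measure.* Perturb an optimal `φ` by a multiple of a bounded strategy. As `U` is
concave, Fatou's lemma applies to the difference quotients, and the first-order condition says that
`U'(V_T)` is integrable and orthogonal to the gains of all bounded strategies.
-/

noncomputable section

namespace UtilityMax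

/-! ### Conditional expectations in integrated form -/

section Generalized

variable {Ω : Type*} {m mΩ : MeasurableSpace Ω} {P : Measure Ω}

lemma randomEval_mono (W : ℝ → Ω → EReal) {X Y : Ω → ℝ} {ω : Ω} (hXY : X ω ≤ Y ω) :
    randomEval W X ω ≤ randomEval W Y ω :=
  le_iInf fun q => iInf_le_of_le ⟨q.1, hXY.trans_lt q.2⟩ le_rfl

lemma randomEval_le (W : ℝ → Ω → EReal) {X : Ω → ℝ} {ω : Ω} {q : ℚ} (hq : X ω < q) :
    randomEval W X ω ≤ W q ω :=
  iInf_le_of_le (⟨q, hq⟩ : {q : ℚ // X ω < (q : ℝ)}) le_rfl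

lemma randomEval_coe {U : ℝ → ℝ} (hmono : Monotone U) (hcont : Continuous U) (X : Ω → ℝ) (ω : Ω) :
    randomEval (fun x _ => (U x : EReal)) X ω = U (X ω) := by
  refine le_antisymm (EReal.le_of_forall_lt_iff_le.1 fun z hz => ?_)
    (le_iInf fun q => EReal.coe_le_coe_iff.2 (hmono q.2.le))
  have hlt : ∀ᶠ y in nhdsWithin (X ω) (Ioi (X ω)), U y < z :=
    (hcont.tendsto _).mono_left nhdsWithin_le_nhds |>.eventually
      (gt_mem_nhds (EReal.coe_lt_coe_iff.1 hz))
  obtain ⟨y, hXy, hy⟩ := mem_nhdsGT_iff_exists_Ioo_subset.1 hlt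
  obtain ⟨q, hXq, hqy⟩ := exists_rat_btwn (show X ω < y from hXy)
  exact (randomEval_le _ hXq).trans (EReal.coe_le_coe_iff.2 (hy ⟨hXq, hqy⟩).le)

lemma ae_condLExp_le_of_le_on (hm : m ≤ mΩ) [SigmaFinite (P.trim hm)] {f g : Ω → ENNReal}
    {B : Set Ω} (hB : MeasurableSet[m] B) (hfg : ∀ ω ∈ B, f ω ≤ g ω) :
    ∀ᵐ ω ∂P, ω ∈ B → condLExp m P f ω ≤ condLExp m P g ω := by
  have hind : B.indicator (condLExp m P f) ≤ᵐ[P] condLExp m P g := by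
    have hmeas := (measurable_condLExp m P f).indicator hB
    refine ae_le_of_ae_le_trim (hm := hm)
      (ae_le_of_forall_setLIntegral_le_of_sigmaFinite (μ := P.trim hm) hmeas fun s hs _ => ?_)
    rw [setLIntegral_trim hm hmeas hs, setLIntegral_condLExp_trim hm _ _ hs,
      setLIntegral_indicator (hm B hB), setLIntegral_condLExp hm P f (hB.inter hs)]
    exact (setLIntegral_mono' (hm _ (hB.inter hs)) fun ω hω => hfg ω hω.1).trans
      (lintegral_mono_set inter_subset_right)
  filter_upwards [hind] with ω hω hωB
  simpa [hωB] using hω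

lemma genCondExp_randomEval_le (hm : m ≤ mΩ) [SigmaFinite (P.trim hm)] {W W' : ℝ → Ω → EReal}
    {X G : Ω → ℝ} (hX : Measurable[m] X)
    (hW : ∀ x : ℝ, genCondExp P m (randomEval W' fun ω => x + G ω) ≤ᵐ[P] W x) :
    genCondExp P m (randomEval W' fun ω => X ω + G ω) ≤ᵐ[P] randomEval W X := by
  -- On the event `{X < q}` the random position `X` is compared with the constant position `q`.
  have hset (q : ℚ) : MeasurableSet[m] {ω | X ω < q} := measurableSet_lt hX measurable_const
  have hle (q : ℚ) : ∀ ω ∈ {ω | X ω < q}, randomEval W' (fun ω => X ω + G ω) ω ≤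
      randomEval W' (fun ω => (q : ℝ) + G ω) ω := fun ω hω =>
    randomEval_mono W' (add_le_add_left (le_of_lt hω) _)
  have hpos := ae_all_iff.2 fun q : ℚ => ae_condLExp_le_of_le_on (P := P) hm (hset q) fun ω hω =>
    EReal.toENNReal_le_toENNReal (hle q ω hω)
  have hneg := ae_all_iff.2 fun q : ℚ => ae_condLExp_le_of_le_on (P := P) hm (hset q) fun ω hω =>
    EReal.toENNReal_le_toENNReal (EReal.neg_le_neg_iff.2 (hle q ω hω))
  filter_upwards [hpos, hneg, ae_all_iff.2 fun q : ℚ => hW q] with ω hpos hneg hWq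
  refine le_iInf fun q => le_trans ?_ (hWq q.1)
  exact EReal.sub_le_sub (EReal.coe_ennreal_le_coe_ennreal_iff.2 (hpos _ q.2))
    (EReal.coe_ennreal_le_coe_ennreal_iff.2 (hneg _ q.2))

lemma add_toENNReal_neg_le_of_sub_le {a b : ENNReal} {y : EReal} (hb : b ≠ ⊤)
    (hy : (a : EReal) - b ≤ y) : a + (-y).toENNReal ≤ y.toENNReal + b := by
  have hb_bot : (b : EReal) ≠ ⊥ := EReal.coe_ennreal_ne_bot b
  have hb_top : (b : EReal) ≠ ⊤ := by simpa using hb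
  have hay : (a : EReal) ≤ y + b := (EReal.sub_le_iff_le_add (.inl hb_bot) (.inl hb_top)).1 hy
  rw [← EReal.coe_ennreal_le_coe_ennreal_iff, EReal.coe_ennreal_add, EReal.coe_ennreal_add]
  rcases le_total 0 y with hy0 | hy0
  · rwa [EReal.coe_toENNReal hy0, EReal.toENNReal_of_nonpos (EReal.neg_le_zero.2 hy0),
      EReal.coe_ennreal_zero, add_zero]
  · rw [EReal.coe_toENNReal (EReal.neg_nonneg.2 hy0), EReal.toENNReal_of_nonpos hy0,
      EReal.coe_ennreal_zero, zero_add, ← sub_eq_add_neg,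
      EReal.sub_le_iff_le_add (.inr hb_top) (.inr hb_bot), add_comm]
    exact hay

lemma toENNReal_neg_le_of_sub_le {a b : ENNReal} {y : EReal}
    (hy : (a : EReal) - b ≤ y) : (-y).toENNReal ≤ b := by
  have hb : -y ≤ b := by
    have hneg : -(b : EReal) ≤ y := by
      refine le_trans ?_ hy
      rw [sub_eq_add_neg]
      exact le_add_of_nonneg_left (EReal.coe_ennreal_nonneg a)
    exact EReal.neg_le_of_neg_le hneg
  simpa using EReal.toENNReal_le_toENNReal hb

/-- The inequality `E(Z | m) ≤ Y` in integrated form, for extended real random variables with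
`E Z⁻ < ∞`. Positive and negative parts are kept on opposite sides, so that no difference of
infinite terms occurs. -/
structure CondMeanLE (P : Measure Ω) (m : MeasurableSpace Ω) (Z Y : Ω → EReal) : Prop where
  lintegral_neg_lt_top : ∫⁻ ω, (-Z ω).toENNReal ∂P < ⊤
  lintegral_neg_le : ∫⁻ ω, (-Y ω).toENNReal ∂P ≤ ∫⁻ ω, (-Z ω).toENNReal ∂P
  setLIntegral_le : ∀ A, MeasurableSet[m] A →
    ∫⁻ ω in A, (Z ω).toENNReal ∂P + ∫⁻ ω in A, (-Y ω).toENNReal ∂P ≤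
      ∫⁻ ω in A, (Y ω).toENNReal ∂P + ∫⁻ ω in A, (-Z ω).toENNReal ∂P

lemma condMeanLE_of_genCondExp_le (hm : m ≤ mΩ) [SigmaFinite (P.trim hm)] {Z Y : Ω → EReal}
    (hZ : ∫⁻ ω, (-Z ω).toENNReal ∂P < ⊤) (hZY : genCondExp P m Z ≤ᵐ[P] Y) :
    CondMeanLE P m Z Y := by
  refine ⟨hZ, ?_, fun A hA => ?_⟩
  · rw [← lintegral_condLExp hm P fun ω => (-Z ω).toENNReal]
    exact lintegral_mono_ae (hZY.mono fun ω => toENNReal_neg_le_of_sub_le)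
  · rw [← setLIntegral_condLExp hm P (fun ω => (Z ω).toENNReal) hA,
      ← setLIntegral_condLExp hm P (fun ω => (-Z ω).toENNReal) hA,
      ← lintegral_add_left (measurable_condLExp' m P _),
      ← lintegral_add_right _ (measurable_condLExp' m P _)]
    refine lintegral_mono_ae (ae_restrict_of_ae ?_)
    filter_upwards [condLExp_lt_top (mΩ := m) hZ.ne, hZY] with ω hfin hle
    exact add_toENNReal_neg_le_of_sub_le hfin.ne hle

lemma CondMeanLE.refl {Z : Ω → EReal} (hZ : ∫⁻ ω, (-Z ω).toENNReal ∂P < ⊤) :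
    CondMeanLE P m Z Z :=
  ⟨hZ, le_rfl, fun _ _ => le_rfl⟩

lemma CondMeanLE.trans {m' : MeasurableSpace Ω} (hm : m' ≤ m) {X Y Z : Ω → EReal}
    (hXY : CondMeanLE P m X Y) (hYZ : CondMeanLE P m' Y Z) : CondMeanLE P m' X Z := by
  refine ⟨hXY.lintegral_neg_lt_top, hYZ.lintegral_neg_le.trans hXY.lintegral_neg_le,
    fun A hA => ?_⟩
  by_cases hZ : ∫⁻ ω in A, (Z ω).toENNReal ∂P = ⊤
  · simp [hZ]
  have hXY_A := hXY.setLIntegral_le A (hm A hA)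
  have hYZ_A := hYZ.setLIntegral_le A hA
  have hYneg : ∫⁻ ω in A, (-Y ω).toENNReal ∂P ≠ ⊤ :=
    ((setLIntegral_le_lintegral A _).trans_lt hYZ.lintegral_neg_lt_top).ne
  have hYpos : ∫⁻ ω in A, (Y ω).toENNReal ∂P ≠ ⊤ :=
    ((le_self_add.trans hYZ_A).trans_lt (ENNReal.add_ne_top.2 ⟨hZ, hYneg⟩).lt_top).ne
  refine (ENNReal.add_le_add_iff_right (ENNReal.add_ne_top.2 ⟨hYneg, hYpos⟩)).1 ?_
  calc _ = _ := by ring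
    _ ≤ _ := add_le_add hXY_A hYZ_A
    _ = _ := by ring

end Generalized

/-! ### Strategies and wealth -/

section Wealth

variable {Ω : Type*} {mΩ : MeasurableSpace Ω} {T d : ℕ} {ℱ : Filtration (Fin (T + 1)) mΩ}
  {S : Fin (T + 1) → Ω → EuclideanSpace ℝ (Fin d)} {c : ℝ}
  {φ ψ : Fin T → Ω → EuclideanSpace ℝ (Fin d)}

lemma isStrategy_zero : IsStrategy ℱ (0 : Fin T → Ω → EuclideanSpace ℝ (Fin d)) :=
  fun _ => measurable_const

lemma isStrategy_single {k : Fin T} {ξ : Ω → EuclideanSpace ℝ (Fin d)}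
    (hξ : Measurable[ℱ k.castSucc] ξ) : IsStrategy ℱ (Pi.single k ξ) := fun i => by
  rcases eq_or_ne i k with rfl | hi
  · rwa [Pi.single_eq_same]
  · rw [Pi.single_eq_of_ne hi]
    exact measurable_const

lemma IsStrategy.combo (hφ : IsStrategy ℱ φ) (hψ : IsStrategy ℱ ψ) (a b : ℝ) :
    IsStrategy ℱ (a • φ + b • ψ) :=
  fun i => ((hφ i).const_smul a).add ((hψ i).const_smul b)

lemma terminalWealth_zero (ω : Ω) : terminalWealth S c 0 ω = c := by
  simp [terminalWealth]

lemma terminalWealth_single (k : Fin T) (ξ : Ω → EuclideanSpace ℝ (Fin d)) (ω : Ω) :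
    terminalWealth S c (Pi.single k ξ) ω = c + inner ℝ (ξ ω) (increment S k ω) := by
  rw [terminalWealth, Finset.sum_eq_single k]
  · rw [Pi.single_eq_same]
  · intro i _ hi
    rw [Pi.single_eq_of_ne hi, Pi.zero_apply, inner_zero_left]
  · exact fun hk => absurd (Finset.mem_univ k) hk

lemma terminalWealth_smul (a : ℝ) (ω : Ω) :
    terminalWealth S c (a • φ) ω = c + a * terminalWealth S 0 φ ω := by
  simp only [terminalWealth, Pi.smul_apply, real_inner_smul_left, ← Finset.mul_sum, zero_add]

lemma terminalWealth_combo (a b c c' : ℝ) (ω : Ω) :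
    terminalWealth S (a * c + b * c') (a • φ + b • ψ) ω =
      a * terminalWealth S c φ ω + b * terminalWealth S c' ψ ω := by
  simp only [terminalWealth, Pi.add_apply, Pi.smul_apply, inner_add_left, real_inner_smul_left,
    Finset.sum_add_distrib, ← Finset.mul_sum]
  ring

lemma tendsto_terminalWealth {y : ℕ → Fin T → Ω → EuclideanSpace ℝ (Fin d)} {ω : Ω}
    (hy : ∀ i, Tendsto (fun n => y n i ω) atTop (nhds (φ i ω))) :
    Tendsto (fun n => terminalWealth S c (y n) ω) atTop (nhds (terminalWealth S c φ ω)) :=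
  tendsto_const_nhds.add (tendsto_finsetSum _ fun i _ => (hy i).inner tendsto_const_nhds)

/-- The wealth `c + ∑_{i ≤ t} ⟨φ_i, ΔS_i⟩` at time `t` of the strategy `φ` started from `c`. -/
def wealthAt (S : Fin (T + 1) → Ω → EuclideanSpace ℝ (Fin d)) (c : ℝ)
    (φ : Fin T → Ω → EuclideanSpace ℝ (Fin d)) (t : Fin (T + 1)) (ω : Ω) : ℝ :=
  c + ∑ i : Fin T with i.castSucc < t, inner ℝ (φ i ω) (increment S i ω)

lemma wealthAt_zero : wealthAt S c φ 0 = fun _ => c := by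
  funext ω
  simp [wealthAt]

lemma wealthAt_zero_strategy (t : Fin (T + 1)) : wealthAt S c 0 t = fun _ => c := by
  funext ω
  simp [wealthAt]

lemma wealthAt_last : wealthAt S c φ (Fin.last T) = terminalWealth S c φ := by
  funext ω
  simp [wealthAt, terminalWealth, Fin.castSucc_lt_last]

lemma wealthAt_succ (i : Fin T) (ω : Ω) : wealthAt S c φ i.succ ω =
    wealthAt S c φ i.castSucc ω + inner ℝ (φ i ω) (increment S i ω) := by
  have hfilter : (Finset.univ.filter fun j : Fin T => j.castSucc < i.succ) =
      insert i (Finset.univ.filter fun j : Fin T => j.castSucc < i.castSucc) := by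
    ext j
    simp only [Finset.mem_filter, Finset.mem_univ, true_and, Finset.mem_insert, Fin.ext_iff,
      Fin.lt_def, Fin.val_castSucc, Fin.val_succ]
    omega
  rw [wealthAt, hfilter, Finset.sum_insert (by simp), wealthAt]
  ring

lemma measurable_increment (hS : ∀ t, Measurable[ℱ t] (S t)) (i : Fin T) :
    Measurable[ℱ i.succ] (increment S i) :=
  (hS i.succ).sub ((hS i.castSucc).mono (ℱ.mono (Fin.castSucc_le_succ i)) le_rfl)

lemma ae_norm_increment_le {P : Measure Ω} {M : ℝ} (hM : ∀ t, ∀ᵐ ω ∂P, ‖S t ω‖ ≤ M) (i : Fin T) :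
    ∀ᵐ ω ∂P, ‖increment S i ω‖ ≤ M + M := by
  filter_upwards [hM i.succ, hM i.castSucc] with ω hsucc hcast
  exact (norm_sub_le _ _).trans (add_le_add hsucc hcast)

lemma measurable_gain (hS : ∀ t, Measurable[ℱ t] (S t)) (i : Fin T)
    {ξ : Ω → EuclideanSpace ℝ (Fin d)} (hξ : Measurable[ℱ i.castSucc] ξ) :
    Measurable[ℱ i.succ] fun ω => (inner ℝ (ξ ω) (increment S i ω) : ℝ) :=
  Measurable.inner (𝕜 := ℝ) (hξ.mono (ℱ.mono (Fin.castSucc_le_succ i)) le_rfl)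
    (measurable_increment hS i)

lemma measurable_wealthAt (hS : ∀ t, Measurable[ℱ t] (S t)) (hφ : IsStrategy ℱ φ)
    (t : Fin (T + 1)) : Measurable[ℱ t] (wealthAt S c φ t) := by
  refine measurable_const.add (Finset.measurable_fun_sum _ fun i hi => ?_)
  refine (measurable_gain hS i (hφ i)).mono (ℱ.mono ?_) le_rfl
  exact Fin.castSucc_lt_iff_succ_le.1 (Finset.mem_filter.1 hi).2

lemma measurable_terminalWealth (hS : ∀ t, Measurable[ℱ t] (S t)) (hφ : IsStrategy ℱ φ) :
    Measurable (terminalWealth S c φ) := by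
  rw [← wealthAt_last]
  exact (measurable_wealthAt hS hφ _).mono (ℱ.le _) le_rfl

end Wealth

/-! ### Domination of expected utility by the value functions -/

section Domination

variable {Ω : Type*} {mΩ : MeasurableSpace Ω} {P : Measure Ω} {T d : ℕ}
  {ℱ : Filtration (Fin (T + 1)) mΩ} {S : Fin (T + 1) → Ω → EuclideanSpace ℝ (Fin d)} {U : ℝ → ℝ}
  {c : ℝ} {φ : Fin T → Ω → EuclideanSpace ℝ (Fin d)}

lemma toENNReal_coe (x : ℝ) : (x : EReal).toENNReal = ENNReal.ofReal x := by
  rw [EReal.toENNReal_of_ne_top (EReal.coe_ne_top _), EReal.toReal_coe]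

lemma toENNReal_neg_coe (x : ℝ) : (-(x : EReal)).toENNReal = ENNReal.ofReal (-x) := by
  rw [← EReal.coe_neg, toENNReal_coe]

lemma lintegral_toENNReal_lt_top {X : Ω → EReal} (hX : ExpWellDefined P X)
    (hlt : extExp P X < ⊤) : ∫⁻ ω, (X ω).toENNReal ∂P < ⊤ := by
  refine hX.elim id fun hneg => lt_top_iff_ne_top.2 fun hpos => hlt.ne ?_
  rw [extExp, hpos, EReal.coe_ennreal_top]
  exact EReal.top_sub (by simpa using hneg.ne)

/-- The value process `U_t(V_t)` along the strategy `φ` started from `c`. -/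
def valueAlong (W : Fin (T + 1) → ℝ → Ω → EReal)
    (S : Fin (T + 1) → Ω → EuclideanSpace ℝ (Fin d)) (c : ℝ)
    (φ : Fin T → Ω → EuclideanSpace ℝ (Fin d)) (t : Fin (T + 1)) : Ω → EReal :=
  randomEval (W t) (wealthAt S c φ t)

variable {W : Fin (T + 1) → ℝ → Ω → EReal}

lemma valueAlong_last (hW : IsValueFamily P ℱ S U W) (hmono : Monotone U) (hcont : Continuous U)
    (ω : Ω) : valueAlong W S c φ (Fin.last T) ω = U (terminalWealth S c φ ω) := by
  have hWlast : W (Fin.last T) = fun x _ => (U x : EReal) := by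
    ext x ω
    exact hW.1 x ω
  rw [valueAlong, hWlast, randomEval_coe hmono hcont, wealthAt_last]

variable [IsFiniteMeasure P]

lemma genCondExp_valueAlong_le (hW : IsValueFamily P ℱ S U W) (hS : ∀ t, Measurable[ℱ t] (S t))
    (hφ : IsStrategy ℱ φ) (i : Fin T) :
    genCondExp P (ℱ i.castSucc) (valueAlong W S c φ i.succ) ≤ᵐ[P]
      valueAlong W S c φ i.castSucc := by
  rw [valueAlong, funext (wealthAt_succ i)]
  exact genCondExp_randomEval_le (ℱ.le _) (measurable_wealthAt hS hφ _) fun x =>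
    (hW.2 i x).2.2.1 _ ⟨φ i, hφ i, rfl⟩

lemma condMeanLE_valueAlong (hW : IsValueFamily P ℱ S U W) (hS : ∀ t, Measurable[ℱ t] (S t))
    (hφ : IsStrategy ℱ φ)
    (hneg : ∫⁻ ω, (-valueAlong W S c φ (Fin.last T) ω).toENNReal ∂P < ⊤) (t : Fin (T + 1)) :
    CondMeanLE P (ℱ t) (valueAlong W S c φ (Fin.last T)) (valueAlong W S c φ t) := by
  induction t using Fin.reverseInduction with
  | last => exact .refl hneg
  | cast i ih =>
    exact ih.trans (ℱ.mono (Fin.castSucc_le_succ i)) <| condMeanLE_of_genCondExp_le (ℱ.le _)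
      (ih.lintegral_neg_le.trans_lt hneg) (genCondExp_valueAlong_le hW hS hφ i)

lemma lintegral_valueAlong_zero_lt_top (hW : IsValueFamily P ℱ S U W)
    (hW0 : ∀ x, ExpWellDefined P (W 0 x) ∧ extExp P (W 0 x) < ⊤) (hmono : Monotone U)
    (hcont : Continuous U) (hS : ∀ t, Measurable[ℱ t] (S t)) (c : ℝ) (t : Fin (T + 1)) :
    ∫⁻ ω, (valueAlong W S c 0 t ω).toENNReal ∂P < ⊤ := by
  have hneg : ∫⁻ ω, (-valueAlong W S c 0 (Fin.last T) ω).toENNReal ∂P < ⊤ := by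
    simp only [valueAlong_last hW hmono hcont, terminalWealth_zero, toENNReal_neg_coe]
    simp [ENNReal.mul_lt_top_iff]
  induction t using Fin.induction with
  | zero =>
    obtain ⟨q, hcq, -⟩ := exists_rat_btwn (lt_add_one c)
    refine (lintegral_mono fun ω => EReal.toENNReal_le_toENNReal ?_).trans_lt
      (lintegral_toENNReal_lt_top (hW0 q).1 (hW0 q).2)
    exact randomEval_le _ (by rwa [wealthAt_zero])
  | succ i ih =>
    have hnegi := (condMeanLE_valueAlong hW hS isStrategy_zero hneg i.succ).lintegral_neg_le
    have hstep := condMeanLE_of_genCondExp_le (ℱ.le _) (hnegi.trans_lt hneg)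
      (genCondExp_valueAlong_le hW hS isStrategy_zero i)
    have hle := hstep.setLIntegral_le univ .univ
    simp only [Measure.restrict_univ] at hle
    exact (le_self_add.trans hle).trans_lt (ENNReal.add_lt_top.2 ⟨ih, hnegi.trans_lt hneg⟩)

/-- On an event known at time `t` on which the wealth at time `t` is at most `q`, the positive part
of the utility of terminal wealth exceeds the negative part in mean by at most the mean of an
integrable function that depends only on `t` and `q`. It is in this form that the finiteness of the
value functions enters the proof. -/
def UtilityDominated (P : Measure Ω) (ℱ : Filtration (Fin (T + 1)) mΩ)
    (S : Fin (T + 1) → Ω → EuclideanSpace ℝ (Fin d)) (U : ℝ → ℝ) : Prop :=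
  ∀ (t : Fin (T + 1)) (q : ℝ), ∃ h : Ω → ENNReal, ∫⁻ ω, h ω ∂P < ⊤ ∧
    ∀ (c : ℝ) (φ : Fin T → Ω → EuclideanSpace ℝ (Fin d)), IsStrategy ℱ φ →
      ∫⁻ ω, ENNReal.ofReal (-U (terminalWealth S c φ ω)) ∂P < ⊤ →
      ∀ A, MeasurableSet[ℱ t] A → (∀ ω ∈ A, wealthAt S c φ t ω ≤ q) →
        ∫⁻ ω in A, ENNReal.ofReal (U (terminalWealth S c φ ω)) ∂P ≤
          ∫⁻ ω in A, h ω ∂P + ∫⁻ ω in A, ENNReal.ofReal (-U (terminalWealth S c φ ω)) ∂P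

theorem FiniteValue.utilityDominated (hfin : FiniteValue P ℱ S U) (hmono : Monotone U)
    (hcont : Continuous U) (hS : ∀ t, Measurable[ℱ t] (S t)) : UtilityDominated P ℱ S U := by
  obtain ⟨W, hW, -, hW0⟩ := hfin
  refine fun t q => ⟨fun ω => (valueAlong W S q 0 t ω).toENNReal,
    lintegral_valueAlong_zero_lt_top hW hW0 hmono hcont hS q t, fun c φ hφ hneg A hA hq => ?_⟩
  have hvalue : CondMeanLE P (ℱ t) (valueAlong W S c φ (Fin.last T)) (valueAlong W S c φ t) :=
    condMeanLE_valueAlong hW hS hφ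
      (by simpa only [valueAlong_last hW hmono hcont, toENNReal_neg_coe] using hneg) t
  have hle := hvalue.setLIntegral_le A hA
  simp only [valueAlong_last hW hmono hcont, toENNReal_neg_coe, toENNReal_coe] at hle
  refine (le_self_add.trans hle).trans (add_le_add_left ?_ _)
  refine setLIntegral_mono' (ℱ.le t A hA) fun ω hω => EReal.toENNReal_le_toENNReal ?_
  exact randomEval_mono _ (by simpa only [wealthAt_zero_strategy] using hq ω hω)

end Domination

/-! ### Admissible strategies -/

section Admissible

variable {Ω : Type*} {mΩ : MeasurableSpace Ω} {P : Measure Ω} {T d : ℕ}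
  {ℱ : Filtration (Fin (T + 1)) mΩ} {S : Fin (T + 1) → Ω → EuclideanSpace ℝ (Fin d)} {U : ℝ → ℝ}
  {c : ℝ} {φ : Fin T → Ω → EuclideanSpace ℝ (Fin d)}

/-- The expected utility of terminal wealth, as a Bochner integral; it is meaningful for the
admissible strategies. -/
def expectedUtility (P : Measure Ω) (S : Fin (T + 1) → Ω → EuclideanSpace ℝ (Fin d)) (U : ℝ → ℝ)
    (c : ℝ) (φ : Fin T → Ω → EuclideanSpace ℝ (Fin d)) : ℝ :=
  ∫ ω, U (terminalWealth S c φ ω) ∂P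

/-- A strategy is admissible for the initial capital `c` if its utility of terminal wealth is
integrable. Strategies that are not admissible have expected utility `-∞` or none at all, so that
optimality can be tested on admissible strategies. -/
structure IsAdmissible (P : Measure Ω) (ℱ : Filtration (Fin (T + 1)) mΩ)
    (S : Fin (T + 1) → Ω → EuclideanSpace ℝ (Fin d)) (U : ℝ → ℝ) (c : ℝ)
    (φ : Fin T → Ω → EuclideanSpace ℝ (Fin d)) : Prop where
  isStrategy : IsStrategy ℱ φ
  integrable : Integrable (fun ω => U (terminalWealth S c φ ω)) P

/-- An admissible strategy of largest expected utility among the admissible strategies. -/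
structure IsMaximizer (P : Measure Ω) (ℱ : Filtration (Fin (T + 1)) mΩ)
    (S : Fin (T + 1) → Ω → EuclideanSpace ℝ (Fin d)) (U : ℝ → ℝ) (c : ℝ)
    (φ : Fin T → Ω → EuclideanSpace ℝ (Fin d)) : Prop extends IsAdmissible P ℱ S U c φ where
  expectedUtility_le : ∀ ψ, IsAdmissible P ℱ S U c ψ →
    expectedUtility P S U c ψ ≤ expectedUtility P S U c φ

lemma isAdmissible_zero [IsFiniteMeasure P] : IsAdmissible P ℱ S U c 0 where
  isStrategy := isStrategy_zero
  integrable := by simpa only [terminalWealth_zero] using integrable_const (U c)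

lemma expectedUtility_zero [IsProbabilityMeasure P] : expectedUtility P S U c 0 = U c := by
  simp [expectedUtility, terminalWealth_zero]

lemma integrable_of_lintegral_parts_lt_top {f : Ω → ℝ} (hf : AEMeasurable f P)
    (hpos : ∫⁻ ω, ENNReal.ofReal (f ω) ∂P < ⊤) (hneg : ∫⁻ ω, ENNReal.ofReal (-f ω) ∂P < ⊤) :
    Integrable f P := by
  have hsub := (integrable_toReal_of_lintegral_ne_top hf.ennreal_ofReal hpos.ne).sub
    (integrable_toReal_of_lintegral_ne_top hf.neg.ennreal_ofReal hneg.ne)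
  refine hsub.congr (Eventually.of_forall fun ω => ?_)
  simp only [Pi.sub_apply, ENNReal.toReal_ofReal', Pi.neg_apply]
  exact max_zero_sub_eq_self _

lemma UtilityDominated.isAdmissible (hdom : UtilityDominated P ℱ S U) (hU : Measurable U)
    (hS : ∀ t, Measurable[ℱ t] (S t)) (hφ : IsStrategy ℱ φ)
    (hneg : ∫⁻ ω, ENNReal.ofReal (-U (terminalWealth S c φ ω)) ∂P < ⊤) :
    IsAdmissible P ℱ S U c φ := by
  obtain ⟨h, hh, hle⟩ := hdom 0 c
  have hpos := hle c φ hφ hneg univ .univ fun ω _ => (congrFun wealthAt_zero ω).le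
  simp only [Measure.restrict_univ] at hpos
  exact ⟨hφ, integrable_of_lintegral_parts_lt_top
    (hU.comp (measurable_terminalWealth hS hφ)).aemeasurable
    (hpos.trans_lt (ENNReal.add_lt_top.2 ⟨hh, hneg⟩)) hneg⟩

lemma UtilityDominated.exists_setIntegral_le (hdom : UtilityDominated P ℱ S U) (t : Fin (T + 1))
    (q : ℝ) : ∃ h : Ω → ENNReal, ∫⁻ ω, h ω ∂P < ⊤ ∧
      ∀ (c : ℝ) (φ : Fin T → Ω → EuclideanSpace ℝ (Fin d)), IsAdmissible P ℱ S U c φ →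
        ∀ A, MeasurableSet[ℱ t] A → (∀ ω ∈ A, wealthAt S c φ t ω ≤ q) →
          ∫ ω in A, U (terminalWealth S c φ ω) ∂P ≤ (∫⁻ ω in A, h ω ∂P).toReal := by
  obtain ⟨h, hh, hle⟩ := hdom t q
  refine ⟨h, hh, fun c φ hφ A hA hq => ?_⟩
  have hneg := hφ.integrable.neg.lintegral_lt_top
  have hnegA := ((setLIntegral_le_lintegral A _).trans_lt hneg).ne
  have hhA := ((setLIntegral_le_lintegral A _).trans_lt hh).ne
  have hreal := ENNReal.toReal_mono (ENNReal.add_ne_top.2 ⟨hhA, hnegA⟩)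
    (hle c φ hφ.isStrategy hneg A hA hq)
  rw [ENNReal.toReal_add hhA hnegA] at hreal
  rw [integral_eq_lintegral_pos_part_sub_lintegral_neg_part hφ.integrable.integrableOn]
  exact sub_le_iff_le_add.2 hreal

lemma UtilityDominated.exists_expectedUtility_le (hdom : UtilityDominated P ℱ S U) (c : ℝ) :
    ∃ C : ℝ, ∀ φ : Fin T → Ω → EuclideanSpace ℝ (Fin d), IsAdmissible P ℱ S U c φ →
      expectedUtility P S U c φ ≤ C := by
  obtain ⟨h, -, hle⟩ := hdom.exists_setIntegral_le 0 c
  refine ⟨(∫⁻ ω, h ω ∂P).toReal, fun φ hφ => ?_⟩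
  simpa [expectedUtility] using
    hle c φ hφ univ .univ fun ω _ => (congrFun wealthAt_zero ω).le

lemma lintegral_terminalUtility : ∫⁻ ω, (terminalUtility S U c φ ω).toENNReal ∂P =
    ∫⁻ ω, ENNReal.ofReal (U (terminalWealth S c φ ω)) ∂P :=
  lintegral_congr fun _ => toENNReal_coe _

lemma lintegral_neg_terminalUtility : ∫⁻ ω, (-terminalUtility S U c φ ω).toENNReal ∂P =
    ∫⁻ ω, ENNReal.ofReal (-U (terminalWealth S c φ ω)) ∂P :=
  lintegral_congr fun _ => toENNReal_neg_coe _

lemma IsAdmissible.expWellDefined (hφ : IsAdmissible P ℱ S U c φ) :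
    ExpWellDefined P (terminalUtility S U c φ) :=
  .inl (lintegral_terminalUtility.trans_lt hφ.integrable.lintegral_lt_top)

lemma IsAdmissible.extExp_eq (hφ : IsAdmissible P ℱ S U c φ) :
    extExp P (terminalUtility S U c φ) = expectedUtility P S U c φ := by
  have hneg : ∫⁻ ω, ENNReal.ofReal (-U (terminalWealth S c φ ω)) ∂P ≠ ⊤ :=
    hφ.integrable.neg.lintegral_lt_top.ne
  rw [extExp, lintegral_terminalUtility, lintegral_neg_terminalUtility, expectedUtility,
    integral_eq_lintegral_pos_part_sub_lintegral_neg_part hφ.integrable, EReal.coe_sub,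
    EReal.coe_ennreal_toReal hφ.integrable.lintegral_lt_top.ne, EReal.coe_ennreal_toReal hneg]

lemma UtilityDominated.isAdmissible_or_extExp_eq_bot (hdom : UtilityDominated P ℱ S U)
    (hU : Measurable U) (hS : ∀ t, Measurable[ℱ t] (S t)) (hφ : IsStrategy ℱ φ) :
    IsAdmissible P ℱ S U c φ ∨ extExp P (terminalUtility S U c φ) = ⊥ := by
  refine or_iff_not_imp_left.2 fun hnot => ?_
  have hneg : ∫⁻ ω, ENNReal.ofReal (-U (terminalWealth S c φ ω)) ∂P = ⊤ := by
    by_contra hfin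
    exact hnot (hdom.isAdmissible hU hS hφ (lt_top_iff_ne_top.2 hfin))
  rw [extExp, lintegral_neg_terminalUtility, hneg, EReal.coe_ennreal_top, EReal.sub_top]

theorem UtilityDominated.isOptimal_iff_isMaximizer [IsFiniteMeasure P]
    (hdom : UtilityDominated P ℱ S U) (hU : Measurable U) (hS : ∀ t, Measurable[ℱ t] (S t)) :
    IsOptimal P ℱ S U c φ ↔ IsMaximizer P ℱ S U c φ := by
  constructor
  · rintro ⟨hφ, -, -, hmax⟩
    have hadm : IsAdmissible P ℱ S U c φ := by
      refine (hdom.isAdmissible_or_extExp_eq_bot hU hS hφ).resolve_right fun hbot => ?_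
      have hzero := isAdmissible_zero (P := P) (ℱ := ℱ) (S := S) (U := U) (c := c)
      have hle := hmax 0 hzero.isStrategy hzero.expWellDefined
      rw [hbot, hzero.extExp_eq, le_bot_iff] at hle
      exact EReal.coe_ne_bot _ hle
    refine ⟨hadm, fun ψ hψ => ?_⟩
    have hle := hmax ψ hψ.isStrategy hψ.expWellDefined
    rwa [hadm.extExp_eq, hψ.extExp_eq, EReal.coe_le_coe_iff] at hle
  · rintro ⟨hφ, hmax⟩
    refine ⟨hφ.isStrategy, hφ.expWellDefined, hφ.extExp_eq ▸ EReal.coe_lt_top _,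
      fun ψ hψ _ => ?_⟩
    rcases hdom.isAdmissible_or_extExp_eq_bot hU hS hψ (c := c) with hadm | hbot
    · rw [hφ.extExp_eq, hadm.extExp_eq, EReal.coe_le_coe_iff]
      exact hmax ψ hadm
    · exact hbot ▸ bot_le

variable {ψ : Fin T → Ω → EuclideanSpace ℝ (Fin d)} {c' a b : ℝ}

lemma IsAdmissible.combo (hφ : IsAdmissible P ℱ S U c φ) (hψ : IsAdmissible P ℱ S U c' ψ)
    (hdom : UtilityDominated P ℱ S U) (hconc : ConcaveOn ℝ univ U)
    (hS : ∀ t, Measurable[ℱ t] (S t)) (ha : 0 ≤ a) (hb : 0 ≤ b) (hab : a + b = 1) :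
    IsAdmissible P ℱ S U (a * c + b * c') (a • φ + b • ψ) := by
  have hUm : Measurable U := (continuousOn_univ.1 (hconc.continuousOn isOpen_univ)).measurable
  refine hdom.isAdmissible hUm hS (hφ.isStrategy.combo hψ.isStrategy a b) ?_
  have hint := (hφ.integrable.const_mul a).add (hψ.integrable.const_mul b)
  refine lt_of_le_of_lt (lintegral_mono fun ω => ENNReal.ofReal_le_ofReal (neg_le_neg ?_))
    hint.neg.lintegral_lt_top
  rw [terminalWealth_combo]
  exact hconc.2 (mem_univ _) (mem_univ _) ha hb hab

lemma IsAdmissible.expectedUtility_combo_le (hφ : IsAdmissible P ℱ S U c φ)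
    (hψ : IsAdmissible P ℱ S U c' ψ) (hdom : UtilityDominated P ℱ S U)
    (hconc : ConcaveOn ℝ univ U) (hS : ∀ t, Measurable[ℱ t] (S t)) (ha : 0 ≤ a) (hb : 0 ≤ b)
    (hab : a + b = 1) :
    a * expectedUtility P S U c φ + b * expectedUtility P S U c' ψ ≤
      expectedUtility P S U (a * c + b * c') (a • φ + b • ψ) := by
  have hcombo := (hφ.combo hψ hdom hconc hS ha hb hab).integrable
  simp only [expectedUtility]
  rw [← integral_const_mul, ← integral_const_mul,
    ← integral_add (hφ.integrable.const_mul a) (hψ.integrable.const_mul b)]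
  refine integral_mono ((hφ.integrable.const_mul a).add (hψ.integrable.const_mul b)) hcombo
    fun ω => ?_
  simp only [terminalWealth_combo]
  exact hconc.2 (mem_univ _) (mem_univ _) ha hb hab

end Admissible

/-! ### The first-order condition -/

section FirstOrder

variable {U : ℝ → ℝ}

lemma tendsto_difference_quotient {x : ℝ} (hU : DifferentiableAt ℝ U x) (h : ℝ) :
    Tendsto (fun r : ℝ => r⁻¹ * (U (x + r * h) - U x)) (nhdsWithin 0 {0}ᶜ)
      (nhds (deriv U x * h)) := by
  have hline : HasDerivAt (fun r : ℝ => x + r * h) h 0 := by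
    simpa using ((hasDerivAt_id (0 : ℝ)).mul_const h).const_add x
  have hcomp : HasDerivAt (fun r : ℝ => U (x + r * h)) (deriv U x * h) 0 :=
    HasDerivAt.comp 0 (by simpa using hU.hasDerivAt) hline
  simpa using hasDerivAt_iff_tendsto_slope_zero.1 hcomp

lemma le_difference_quotient (hU : ConcaveOn ℝ univ U) (x h : ℝ) {r : ℝ} (hr : 0 < r)
    (hr1 : r ≤ 1) : U (x + h) - U x ≤ r⁻¹ * (U (x + r * h) - U x) := by
  have hle := hU.2 (mem_univ x) (mem_univ (x + h)) (sub_nonneg.2 hr1) hr.le (sub_add_cancel 1 r)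
  have hpoint : (1 - r) • x + r • (x + h) = x + r * h := by
    simp only [smul_eq_mul]
    ring
  rw [hpoint, smul_eq_mul, smul_eq_mul] at hle
  rw [inv_mul_eq_div, le_div_iff₀ hr]
  linarith

lemma deriv_pos_of_concaveOn_of_strictMono (hU : ConcaveOn ℝ univ U) (hmono : StrictMono U) {x : ℝ}
    (hd : DifferentiableAt ℝ U x) : 0 < deriv U x := by
  have hslope := hU.slope_le_deriv (mem_univ x) (mem_univ (x + 1)) (lt_add_one x) hd
  rw [slope_def_field] at hslope
  exact (div_pos (sub_pos.2 (hmono (lt_add_one x))) (by simp)).trans_le hslope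

variable {Ω : Type*} {mΩ : MeasurableSpace Ω} {P : Measure Ω}

lemma integrable_of_tendsto_of_nonneg {f : ℕ → Ω → ℝ} {F : Ω → ℝ} {K : ℕ → ℝ} {L : ℝ}
    (hf : ∀ n, Integrable (f n) P) (hf0 : ∀ n ω, 0 ≤ f n ω)
    (hlim : ∀ᵐ ω ∂P, Tendsto (fun n => f n ω) atTop (nhds (F ω)))
    (hK : ∀ n, ∫ ω, f n ω ∂P ≤ K n) (hKL : Tendsto K atTop (nhds L)) :
    Integrable F P ∧ ∫ ω, F ω ∂P ≤ L := by
  have hF0 : 0 ≤ᵐ[P] F := hlim.mono fun ω hω => ge_of_tendsto' hω fun n => hf0 n ω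
  have hF : AEStronglyMeasurable F P :=
    aestronglyMeasurable_of_tendsto_ae atTop (fun n => (hf n).1) hlim
  have hfatou : ∫⁻ ω, ENNReal.ofReal (F ω) ∂P ≤ ENNReal.ofReal L := by
    calc ∫⁻ ω, ENNReal.ofReal (F ω) ∂P
        = ∫⁻ ω, liminf (fun n => ENNReal.ofReal (f n ω)) atTop ∂P :=
          lintegral_congr_ae (hlim.mono fun ω hω => (ENNReal.tendsto_ofReal hω).liminf_eq.symm)
      _ ≤ liminf (fun n => ∫⁻ ω, ENNReal.ofReal (f n ω) ∂P) atTop :=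
          lintegral_liminf_le' fun n => (hf n).1.aemeasurable.ennreal_ofReal
      _ ≤ liminf (fun n => ENNReal.ofReal (K n)) atTop := by
          refine liminf_le_liminf (.of_forall fun n => ?_)
          rw [← ofReal_integral_eq_lintegral_ofReal (hf n) (.of_forall (hf0 n))]
          exact ENNReal.ofReal_le_ofReal (hK n)
      _ = ENNReal.ofReal L := (ENNReal.tendsto_ofReal hKL).liminf_eq
  have hFint : Integrable F P :=
    ⟨hF, (hasFiniteIntegral_iff_ofReal hF0).2 (hfatou.trans_lt ENNReal.ofReal_lt_top)⟩
  rw [← ofReal_integral_eq_lintegral_ofReal hFint hF0, ENNReal.ofReal_le_ofReal_iff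
    (ge_of_tendsto' hKL fun n => (integral_nonneg (hf0 n)).trans (hK n))] at hfatou
  exact ⟨hFint, hfatou⟩

lemma integrable_of_tendsto_of_le {f : ℕ → Ω → ℝ} {F g : Ω → ℝ} {K : ℕ → ℝ} {L : ℝ}
    (hf : ∀ n, Integrable (f n) P) (hg : Integrable g P) (hgf : ∀ n ω, g ω ≤ f n ω)
    (hlim : ∀ᵐ ω ∂P, Tendsto (fun n => f n ω) atTop (nhds (F ω)))
    (hK : ∀ n, ∫ ω, f n ω ∂P ≤ K n) (hKL : Tendsto K atTop (nhds L)) :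
    Integrable F P ∧ ∫ ω, F ω ∂P ≤ L := by
  obtain ⟨hint, hle⟩ := integrable_of_tendsto_of_nonneg (fun n => (hf n).sub hg)
    (fun n ω => sub_nonneg.2 (hgf n ω)) (hlim.mono fun ω hω => hω.sub_const (g ω))
    (K := fun n => K n - ∫ ω, g ω ∂P) (fun n => by
      rw [integral_sub' (hf n) hg]
      exact sub_le_sub_right (hK n) _) (hKL.sub_const _)
  have hF : Integrable F P := (hint.add hg).congr (.of_forall fun ω => sub_add_cancel (F ω) (g ω))
  exact ⟨hF, by rwa [integral_sub hF hg, sub_le_sub_iff_right] at hle⟩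

variable {T d : ℕ} {ℱ : Filtration (Fin (T + 1)) mΩ}
  {S : Fin (T + 1) → Ω → EuclideanSpace ℝ (Fin d)} {c δ : ℝ}
  {φ ψ : Fin T → Ω → EuclideanSpace ℝ (Fin d)}

lemma IsMaximizer.expectedUtility_add_le [IsProbabilityMeasure P] (hφ : IsMaximizer P ℱ S U c φ)
    (hdom : UtilityDominated P ℱ S U) (hconc : ConcaveOn ℝ univ U) (hS : ∀ t, Measurable[ℱ t] (S t))
    (hδ : 0 ≤ δ) (hψ : IsAdmissible P ℱ S U (c + δ) ψ) :
    expectedUtility P S U (c + δ) ψ ≤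
      expectedUtility P S U c φ + δ * (expectedUtility P S U c φ - U (c - 1)) := by
  -- The capital `c` is a mixture of `c + δ` and `c - 1`.
  have ha : 0 ≤ 1 / (1 + δ) := by positivity
  have hb : 0 ≤ δ / (1 + δ) := by positivity
  have hab : 1 / (1 + δ) + δ / (1 + δ) = 1 := by field_simp
  have hc : 1 / (1 + δ) * (c + δ) + δ / (1 + δ) * (c - 1) = c := by
    field_simp
    ring
  have hzero : IsAdmissible P ℱ S U (c - 1) 0 := isAdmissible_zero
  have hmix := hψ.combo hzero hdom hconc hS ha hb hab
  have hle := hψ.expectedUtility_combo_le hzero hdom hconc hS ha hb hab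
  rw [hc] at hmix hle
  have hmax := hle.trans (hφ.expectedUtility_le _ hmix)
  rw [expectedUtility_zero] at hmax
  have hscaled := mul_le_mul_of_nonneg_left hmax (by positivity : 0 ≤ 1 + δ)
  have hexpand : (1 + δ) * (1 / (1 + δ) * expectedUtility P S U (c + δ) ψ +
      δ / (1 + δ) * U (c - 1)) = expectedUtility P S U (c + δ) ψ + δ * U (c - 1) := by
    field_simp
  linarith

lemma IsMaximizer.deriv_mul_sub [IsProbabilityMeasure P] (hφ : IsMaximizer P ℱ S U c φ)
    (hdom : UtilityDominated P ℱ S U) (hconc : ConcaveOn ℝ univ U) (hd : Differentiable ℝ U)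
    (hS : ∀ t, Measurable[ℱ t] (S t)) (hδ : 0 ≤ δ) (hψ : IsAdmissible P ℱ S U (c + δ) ψ) :
    Integrable (fun ω => deriv U (terminalWealth S c φ ω) *
        (terminalWealth S (c + δ) ψ ω - terminalWealth S c φ ω)) P ∧
      ∫ ω, deriv U (terminalWealth S c φ ω) *
        (terminalWealth S (c + δ) ψ ω - terminalWealth S c φ ω) ∂P ≤
        δ * (expectedUtility P S U c φ - U (c - 1)) := by
  set r : ℕ → ℝ := fun n => 1 / ((n : ℝ) + 1)
  have hr (n : ℕ) : 0 < r n := Nat.one_div_pos_of_nat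
  have hr1 (n : ℕ) : r n ≤ 1 := by simpa [r] using Nat.one_div_le_one_div (α := ℝ) n.zero_le
  have hlim : Tendsto r atTop (nhdsWithin 0 {0}ᶜ) := tendsto_nhdsWithin_iff.2
    ⟨tendsto_one_div_add_atTop_nhds_zero_nat, .of_forall fun n => (hr n).ne'⟩
  have hadm (n : ℕ) : IsAdmissible P ℱ S U (c + r n * δ) ((1 - r n) • φ + r n • ψ) := by
    have hmix := hφ.combo hψ hdom hconc hS (sub_nonneg.2 (hr1 n)) (hr n).le (sub_add_cancel 1 _)
    rwa [show (1 - r n) * c + r n * (c + δ) = c + r n * δ by ring] at hmix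
  have hwealth (n : ℕ) (ω : Ω) : terminalWealth S (c + r n * δ) ((1 - r n) • φ + r n • ψ) ω =
      terminalWealth S c φ ω + r n * (terminalWealth S (c + δ) ψ ω - terminalWealth S c φ ω) := by
    rw [show c + r n * δ = (1 - r n) * c + r n * (c + δ) by ring, terminalWealth_combo]
    ring
  have hint (n : ℕ) := (hadm n).integrable
  have hbound (n : ℕ) := hφ.expectedUtility_add_le hdom hconc hS (mul_nonneg (hr n).le hδ) (hadm n)
  simp only [expectedUtility, hwealth] at hint hbound
  refine integrable_of_tendsto_of_le
    (fun n => ((hint n).sub hφ.integrable).const_mul (r n)⁻¹) (hψ.integrable.sub hφ.integrable)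
    (fun n ω => ?_) (.of_forall fun ω => (tendsto_difference_quotient (hd _) _).comp hlim)
    (fun n => ?_) tendsto_const_nhds
  · simpa using le_difference_quotient hconc (terminalWealth S c φ ω)
      (terminalWealth S (c + δ) ψ ω - terminalWealth S c φ ω) (hr n) (hr1 n)
  · simp only [Pi.sub_apply]
    rw [integral_const_mul, integral_sub (hint n) hφ.integrable, inv_mul_le_iff₀ (hr n)]
    simp only [expectedUtility]
    linarith [hbound n]

variable [IsProbabilityMeasure P]

lemma IsMaximizer.integrable_deriv (hφ : IsMaximizer P ℱ S U c φ)
    (hdom : UtilityDominated P ℱ S U) (hconc : ConcaveOn ℝ univ U) (hd : Differentiable ℝ U)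
    (hS : ∀ t, Measurable[ℱ t] (S t)) :
    Integrable (fun ω => deriv U (terminalWealth S c φ ω)) P := by
  have hsame := (hφ.deriv_mul_sub hdom hconc hd hS le_rfl isAdmissible_zero).1
  have hmore := (hφ.deriv_mul_sub hdom hconc hd hS zero_le_one isAdmissible_zero).1
  refine (hmore.sub hsame).congr (.of_forall fun ω => ?_)
  simp only [Pi.sub_apply, terminalWealth_zero]
  ring

lemma UtilityDominated.isAdmissible_smul (hdom : UtilityDominated P ℱ S U) (hmono : Monotone U)
    (hS : ∀ t, Measurable[ℱ t] (S t)) (hψ : IsStrategy ℱ ψ) {B : ℝ}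
    (hB : ∀ᵐ ω ∂P, |terminalWealth S 0 ψ ω| ≤ B) (c k : ℝ) : IsAdmissible P ℱ S U c (k • ψ) := by
  refine hdom.isAdmissible hmono.measurable hS (fun i => (hψ i).const_smul k) ?_
  calc ∫⁻ ω, ENNReal.ofReal (-U (terminalWealth S c (k • ψ) ω)) ∂P
      ≤ ∫⁻ _, ENNReal.ofReal (-U (c - |k| * B)) ∂P := by
        refine lintegral_mono_ae (hB.mono fun ω hω => ENNReal.ofReal_le_ofReal ?_)
        refine neg_le_neg (hmono ?_)
        rw [terminalWealth_smul, sub_eq_add_neg]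
        refine add_le_add_right (neg_le_of_neg_le ((neg_le_abs _).trans ?_)) c
        rw [abs_mul]
        exact mul_le_mul_of_nonneg_left hω (abs_nonneg k)
    _ < ⊤ := by simp

lemma eq_zero_of_forall_mul_le {x K : ℝ} (h : ∀ k : ℝ, k * x ≤ K) : x = 0 := by
  by_contra hx
  have hle := h ((K + 1) / x)
  rw [div_mul_cancel₀ _ hx] at hle
  linarith

lemma IsMaximizer.integral_deriv_mul_gain (hφ : IsMaximizer P ℱ S U c φ)
    (hdom : UtilityDominated P ℱ S U) (hconc : ConcaveOn ℝ univ U) (hmono : Monotone U)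
    (hd : Differentiable ℝ U) (hS : ∀ t, Measurable[ℱ t] (S t)) (hψ : IsStrategy ℱ ψ) {B : ℝ}
    (hB : ∀ᵐ ω ∂P, |terminalWealth S 0 ψ ω| ≤ B) :
    ∫ ω, deriv U (terminalWealth S c φ ω) * terminalWealth S 0 ψ ω ∂P = 0 := by
  have hgain : Integrable (fun ω => deriv U (terminalWealth S c φ ω) * terminalWealth S 0 ψ ω) P :=
    (hφ.integrable_deriv hdom hconc hd hS).mul_bdd (c := B)
      (measurable_terminalWealth hS hψ).aestronglyMeasurable (by simpa [Real.norm_eq_abs] using hB)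
  have hsame := (hφ.deriv_mul_sub hdom hconc hd hS le_rfl isAdmissible_zero).1
  simp only [terminalWealth_zero, add_zero] at hsame
  refine eq_zero_of_forall_mul_le
    (K := -∫ ω, deriv U (terminalWealth S c φ ω) * (c - terminalWealth S c φ ω) ∂P) fun k => ?_
  have hle := (hφ.deriv_mul_sub hdom hconc hd hS le_rfl
    (hdom.isAdmissible_smul hmono hS hψ hB (c + 0) k)).2
  have hsplit (ω : Ω) : deriv U (terminalWealth S c φ ω) *
      (terminalWealth S (c + 0) (k • ψ) ω - terminalWealth S c φ ω) =
      k * (deriv U (terminalWealth S c φ ω) * terminalWealth S 0 ψ ω) +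
        deriv U (terminalWealth S c φ ω) * (c - terminalWealth S c φ ω) := by
    rw [terminalWealth_smul]
    ring
  simp only [hsplit] at hle
  rw [integral_add (hgain.const_mul k) hsame, integral_const_mul, zero_mul] at hle
  linarith

end FirstOrder

/-! ### The marginal utility measure -/

section MartingaleMeasure

variable {Ω : Type*} {mΩ : MeasurableSpace Ω} {T d : ℕ} {ℱ : Filtration (Fin (T + 1)) mΩ}
  {S : Fin (T + 1) → Ω → EuclideanSpace ℝ (Fin d)}

lemma martingale_of_condExp_succ {E : Type*} [NormedAddCommGroup E] [NormedSpace ℝ E]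
    [CompleteSpace E] {Q : Measure Ω} [SigmaFiniteFiltration Q ℱ] {f : Fin (T + 1) → Ω → E}
    (hf : StronglyAdapted ℱ f) (hint : ∀ t, Integrable (f t) Q)
    (hstep : ∀ i : Fin T, Q[f i.succ | ℱ i.castSucc] =ᵐ[Q] f i.castSucc) : Martingale f ℱ Q := by
  refine ⟨hf, fun i j hij => ?_⟩
  induction j using Fin.induction with
  | zero =>
    obtain rfl : i = 0 := nonpos_iff_eq_zero.1 hij
    exact (condExp_of_stronglyMeasurable (ℱ.le 0) (hf 0) (hint 0)).eventuallyEq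
  | succ k ih =>
    rcases hij.eq_or_lt with rfl | hlt
    · exact (condExp_of_stronglyMeasurable (ℱ.le _) (hf _) (hint _)).eventuallyEq
    · have hik : i ≤ k.castSucc := Fin.le_castSucc_iff.2 hlt
      calc Q[f k.succ | ℱ i] =ᵐ[Q] Q[Q[f k.succ | ℱ k.castSucc] | ℱ i] :=
            (condExp_condExp_of_le (ℱ.mono hik) (ℱ.le _)).symm
        _ =ᵐ[Q] Q[f k.castSucc | ℱ i] := condExp_congr_ae (hstep k)
        _ =ᵐ[Q] f i := ih hik

/-- Every bounded position based on the information `m` has mean gain zero under `Q` over a period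
with price increment `s`. -/
def CentersGains {E : Type*} [NormedAddCommGroup E] [InnerProductSpace ℝ E] [MeasurableSpace E]
    (Q : Measure Ω) (m : MeasurableSpace Ω) (s : Ω → E) : Prop :=
  ∀ ξ : Ω → E, Measurable[m] ξ → (∃ B : ℝ, ∀ ω, ‖ξ ω‖ ≤ B) →
    ∫ ω, (inner ℝ (ξ ω) (s ω) : ℝ) ∂Q = 0

/-- All bounded positions of the market have mean gain zero under `Q`. -/
def CentersIncrements (Q : Measure Ω) (ℱ : Filtration (Fin (T + 1)) mΩ)
    (S : Fin (T + 1) → Ω → EuclideanSpace ℝ (Fin d)) : Prop :=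
  ∀ i : Fin T, CentersGains Q (ℱ i.castSucc) (increment S i)

theorem CentersIncrements.martingale {Q : Measure Ω} [SigmaFiniteFiltration Q ℱ]
    (hQ : CentersIncrements Q ℱ S) (hS : ∀ t, Measurable[ℱ t] (S t))
    (hint : ∀ t, Integrable (S t) Q) : Martingale S ℱ Q := by
  refine martingale_of_condExp_succ (fun t => (hS t).stronglyMeasurable) hint fun i => ?_
  refine (ae_eq_condExp_of_forall_setIntegral_eq (ℱ.le _) (hint i.succ)
    (fun A _ _ => (hint _).integrableOn) (fun A hA _ => ?_)
    (hS _).stronglyMeasurable.aestronglyMeasurable).symm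
  rw [eq_comm, ← sub_eq_zero, ← integral_sub (hint _).integrableOn (hint _).integrableOn]
  refine ext_inner_left ℝ fun e => ?_
  have hcenter := hQ i (A.indicator fun _ => e) (measurable_const.indicator hA)
    ⟨‖e‖, fun ω => norm_indicator_le_norm_self (fun _ => e) ω⟩
  have hind (ω : Ω) : (inner ℝ (A.indicator (fun _ => e) ω) (increment S i ω) : ℝ) =
      A.indicator (fun ω => inner ℝ e (increment S i ω)) ω := by
    by_cases hω : ω ∈ A <;> simp [hω]
  simp only [hind] at hcenter
  rw [integral_indicator (ℱ.le _ A hA)] at hcenter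
  rw [inner_zero_right, ← integral_inner (f := fun ω => S i.succ ω - S i.castSucc ω)
    ((hint _).sub (hint _)).integrableOn]
  exact hcenter

variable {P : Measure Ω} {U : ℝ → ℝ} {c M : ℝ}
  {φ : Fin T → Ω → EuclideanSpace ℝ (Fin d)}

lemma marginalUtilityMeasure_eq_tilted (hU : ∀ x, 0 < deriv U x) :
    marginalUtilityMeasure P S U c φ =
      P.tilted fun ω => Real.log (deriv U (terminalWealth S c φ ω)) := by
  simp only [marginalUtilityMeasure, Measure.tilted, Real.exp_log (hU _)]

variable [IsProbabilityMeasure P]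

lemma IsMaximizer.centersIncrements (hφ : IsMaximizer P ℱ S U c φ)
    (hdom : UtilityDominated P ℱ S U) (hconc : ConcaveOn ℝ univ U) (hmono : StrictMono U)
    (hd : Differentiable ℝ U) (hS : ∀ t, Measurable[ℱ t] (S t))
    (hM : ∀ i, ∀ᵐ ω ∂P, ‖increment S i ω‖ ≤ M) :
    CentersIncrements (marginalUtilityMeasure P S U c φ) ℱ S := by
  rintro i ξ hξ ⟨B, hB⟩
  have hbound : ∀ᵐ ω ∂P, |terminalWealth S 0 (Pi.single i ξ) ω| ≤ B * M := by
    filter_upwards [hM i] with ω hω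
    rw [terminalWealth_single, zero_add]
    exact (abs_real_inner_le_norm _ _).trans
      (mul_le_mul (hB ω) hω (norm_nonneg _) ((norm_nonneg _).trans (hB ω)))
  have hzero := hφ.integral_deriv_mul_gain hdom hconc hmono.monotone hd hS
    (isStrategy_single hξ) hbound
  have hpos (x : ℝ) : 0 < deriv U x := deriv_pos_of_concaveOn_of_strictMono hconc hmono (hd x)
  simp only [terminalWealth_single, zero_add] at hzero
  rw [marginalUtilityMeasure_eq_tilted hpos, integral_tilted]
  simp only [Real.exp_log (hpos _), smul_eq_mul, div_mul_eq_mul_div]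
  rw [integral_div, hzero, zero_div]

theorem IsMaximizer.isEquivMartingaleMeasure (hφ : IsMaximizer P ℱ S U c φ)
    (hdom : UtilityDominated P ℱ S U) (hconc : ConcaveOn ℝ univ U) (hmono : StrictMono U)
    (hd : Differentiable ℝ U) (hS : ∀ t, Measurable[ℱ t] (S t))
    (hM : ∀ t, ∀ᵐ ω ∂P, ‖S t ω‖ ≤ M) :
    Integrable (fun ω => deriv U (terminalWealth S c φ ω)) P ∧
      0 < ∫ ω, deriv U (terminalWealth S c φ ω) ∂P ∧
      IsEquivMartingaleMeasure P (marginalUtilityMeasure P S U c φ) ℱ S := by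
  have hpos (x : ℝ) : 0 < deriv U x := deriv_pos_of_concaveOn_of_strictMono hconc hmono (hd x)
  have hderiv := hφ.integrable_deriv hdom hconc hd hS
  have hexp : Integrable (fun ω => Real.exp (Real.log (deriv U (terminalWealth S c φ ω)))) P := by
    simpa only [Real.exp_log (hpos _)] using hderiv
  have hcenter := hφ.centersIncrements hdom hconc hmono hd hS (ae_norm_increment_le hM)
  refine ⟨hderiv, by simpa only [Real.exp_log (hpos _)] using integral_exp_pos hexp, ?_⟩
  rw [marginalUtilityMeasure_eq_tilted hpos] at hcenter ⊢
  have := isProbabilityMeasure_tilted hexp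
  have habs := tilted_absolutelyContinuous P
    fun ω => Real.log (deriv U (terminalWealth S c φ ω))
  exact ⟨this, habs, absolutelyContinuous_tilted hexp, hcenter.martingale hS fun t =>
    .of_bound ((hS t).mono (ℱ.le t) le_rfl).aestronglyMeasurable M (habs (hM t))⟩

end MartingaleMeasure

/-! ### The lemma of Komlós -/

section Komlos

/-- The defect of midpoint convexity of `f` at the pair `x, y`. -/
def midpointDefect {E : Type*} [AddCommGroup E] [Module ℝ E] (f : E → ℝ) (x y : E) : ℝ :=
  f x + f y - 2 * f ((2⁻¹ : ℝ) • (x + y))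

lemma midpointDefect_eq_two_mul {f : ℝ → ℝ} (x y : ℝ) :
    midpointDefect f x y = 2 * (2⁻¹ * f x + 2⁻¹ * f y - f (2⁻¹ * x + 2⁻¹ * y)) := by
  rw [midpointDefect, smul_eq_mul, mul_add]
  ring

lemma midpointDefect_nonneg {f : ℝ → ℝ} (hf : ConvexOn ℝ univ f) (x y : ℝ) :
    0 ≤ midpointDefect f x y := by
  rw [midpointDefect_eq_two_mul]
  have := hf.2 (mem_univ x) (mem_univ y) (by norm_num : (0 : ℝ) ≤ 2⁻¹)
    (by norm_num : (0 : ℝ) ≤ 2⁻¹) (by norm_num)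
  simp only [smul_eq_mul] at this
  linarith

lemma midpointDefect_pos {f : ℝ → ℝ} (hf : StrictConvexOn ℝ univ f) {x y : ℝ} (hxy : x ≠ y) :
    0 < midpointDefect f x y := by
  rw [midpointDefect_eq_two_mul]
  have := hf.2 (mem_univ x) (mem_univ y) hxy (by norm_num : (0 : ℝ) < 2⁻¹)
    (by norm_num : (0 : ℝ) < 2⁻¹) (by norm_num)
  simp only [smul_eq_mul] at this
  linarith

lemma exists_pos_le_midpointDefect {f : ℝ → ℝ} (hf : StrictConvexOn ℝ univ f) (K : ℝ) {ε : ℝ}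
    (hε : 0 < ε) : ∃ δ : ℝ, 0 < δ ∧
      ∀ x y : ℝ, |x| ≤ K → |y| ≤ K → ε ≤ |x - y| → δ ≤ midpointDefect f x y := by
  let A : Set (ℝ × ℝ) := Icc (-K) K ×ˢ Icc (-K) K ∩ {q | ε ≤ |q.1 - q.2|}
  have hA : IsCompact A := (isCompact_Icc.prod isCompact_Icc).inter_right
    (isClosed_le continuous_const (by fun_prop))
  have hmem {x y : ℝ} (hx : |x| ≤ K) (hy : |y| ≤ K) (hxy : ε ≤ |x - y|) : (x, y) ∈ A :=
    ⟨⟨abs_le.1 hx, abs_le.1 hy⟩, hxy⟩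
  rcases A.eq_empty_or_nonempty with hempty | hne
  · exact ⟨1, one_pos, fun x y hx hy hxy => absurd (hmem hx hy hxy) (by simp [hempty])⟩
  · have hcont : Continuous f := continuousOn_univ.1 (hf.convexOn.continuousOn isOpen_univ)
    have hdefect : Continuous fun q : ℝ × ℝ => midpointDefect f q.1 q.2 := by
      unfold midpointDefect
      fun_prop
    obtain ⟨q, hq, hmin⟩ := hA.exists_isMinOn hne hdefect.continuousOn
    have hq' : q.1 ≠ q.2 := fun h => by
      have := hε.trans_le hq.2
      simp [h] at this
    exact ⟨_, midpointDefect_pos hf hq', fun x y hx hy hxy => hmin (hmem hx hy hxy)⟩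

variable {Ω : Type*} {mΩ : MeasurableSpace Ω} {μ : Measure Ω}

/-- A family of random variables that is bounded in measure (bounded in probability). -/
def BoundedInMeasure {ι F : Type*} [NormedAddCommGroup F] (μ : Measure Ω) (X : ι → Ω → F) :
    Prop :=
  ∀ ε : ENNReal, 0 < ε → ∃ a : ℝ, ∀ i, μ {ω | a < ‖X i ω‖} ≤ ε

/-- A sequence of random variables that is Cauchy with respect to convergence in measure. -/
def CauchyInMeasure {F : Type*} [NormedAddCommGroup F] (μ : Measure Ω) (p : ℕ → Ω → F) : Prop :=
  ∀ ε : ℝ, 0 < ε →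
    Tendsto (fun q : ℕ × ℕ => μ {ω | ε ≤ ‖p q.1 ω - p q.2 ω‖}) atTop (nhds 0)

lemma boundedInMeasure_of_lintegral_enorm_le {ι F : Type*} [NormedAddCommGroup F]
    {X : ι → Ω → F} {K : ENNReal} (hK : K ≠ ⊤) (hX : ∀ i, AEStronglyMeasurable (X i) μ)
    (hXK : ∀ i, ∫⁻ ω, ‖X i ω‖ₑ ∂μ ≤ K) : BoundedInMeasure μ X := by
  intro ε hε
  have hlim : Tendsto (fun n : ℕ => K / n) atTop (nhds 0) := by
    simpa using ENNReal.Tendsto.const_div ENNReal.tendsto_nat_nhds_top (.inr hK)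
  obtain ⟨n, hn, hn0⟩ := ((hlim.eventually_le_const hε).and (eventually_gt_atTop 0)).exists
  refine ⟨n, fun i => ?_⟩
  calc μ {ω | (n : ℝ) < ‖X i ω‖} ≤ μ {ω | (n : ENNReal) ≤ ‖X i ω‖ₑ} := by
        refine measure_mono fun ω (hω : (n : ℝ) < ‖X i ω‖) => ?_
        rw [mem_ofPred_eq, ← ofReal_norm, ← ENNReal.ofReal_natCast]
        exact ENNReal.ofReal_le_ofReal hω.le
    _ ≤ (∫⁻ ω, ‖X i ω‖ₑ ∂μ) / n := meas_ge_le_lintegral_div (hX i).enorm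
        (Nat.cast_ne_zero.2 hn0.ne') (ENNReal.natCast_ne_top n)
    _ ≤ K / n := ENNReal.div_le_div_right (hXK i) _
    _ ≤ ε := hn

lemma exists_subseq_tendsto_of_cauchyInMeasure {ι F : Type*} [Finite ι] [NormedAddCommGroup F]
    [CompleteSpace F] {p : ι → ℕ → Ω → F} (hp : ∀ i, CauchyInMeasure μ (p i)) :
    ∃ σ : ℕ → ℕ, StrictMono σ ∧
      ∀ᵐ ω ∂μ, ∀ i, ∃ l, Tendsto (fun n => p i (σ n) ω) atTop (nhds l) := by
  have hsmall (j : ℕ) : ∀ᶠ N in atTop, ∀ n ≥ N, ∀ i,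
      μ {ω | (1 / 2 : ℝ) ^ j ≤ ‖p i N ω - p i n ω‖} ≤ ENNReal.ofReal ((1 / 2 : ℝ) ^ j) := by
    have hpos : (0 : ℝ) < (1 / 2) ^ j := by positivity
    obtain ⟨N, hN⟩ := eventually_atTop.1 <| eventually_all.2 fun i =>
      (hp i _ hpos).eventually_le_const (ENNReal.ofReal_pos.2 hpos)
    exact eventually_atTop.2 ⟨max N.1 N.2, fun M hM n hn i =>
      hN (M, n) ⟨(le_max_left _ _).trans hM, (le_max_right _ _).trans (hM.trans hn)⟩ i⟩
  obtain ⟨σ, hσ, hσsmall⟩ := extraction_forall_of_eventually hsmall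
  refine ⟨σ, hσ, ae_all_iff.2 fun i => ?_⟩
  have hgeo : Summable fun k : ℕ => (1 / 2 : ℝ) ^ k := summable_geometric_two
  have hsum : ∑' j, μ {ω | (1 / 2 : ℝ) ^ j ≤ ‖p i (σ j) ω - p i (σ (j + 1)) ω‖} ≠ ⊤ := by
    refine ((ENNReal.tsum_le_tsum fun j => hσsmall j _ (hσ j.lt_succ_self).le i).trans_lt ?_).ne
    rw [← ENNReal.ofReal_tsum_of_nonneg (fun k => by positivity) hgeo]
    exact ENNReal.ofReal_lt_top
  filter_upwards [ae_eventually_notMem hsum] with ω hω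
  refine cauchySeq_tendsto_of_complete (cauchySeq_of_summable_dist
    (Summable.of_norm_bounded_eventually_nat hgeo ?_))
  filter_upwards [hω] with j hj
  rw [Real.norm_of_nonneg dist_nonneg, dist_eq_norm]
  exact (not_le.1 hj).le

section Integral

variable {f : ℝ → ℝ} {X Y : Ω → ℝ}

lemma integrable_midpointDefect (hX : Integrable (fun ω => f (X ω)) μ)
    (hY : Integrable (fun ω => f (Y ω)) μ)
    (hXY : Integrable (fun ω => f ((2⁻¹ : ℝ) • (X ω + Y ω))) μ) :
    Integrable (fun ω => midpointDefect f (X ω) (Y ω)) μ :=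
  (hX.add hY).sub (hXY.const_mul 2)

lemma integral_midpointDefect (hX : Integrable (fun ω => f (X ω)) μ)
    (hY : Integrable (fun ω => f (Y ω)) μ)
    (hXY : Integrable (fun ω => f ((2⁻¹ : ℝ) • (X ω + Y ω))) μ) :
    ∫ ω, midpointDefect f (X ω) (Y ω) ∂μ =
      ∫ ω, f (X ω) ∂μ + ∫ ω, f (Y ω) ∂μ - 2 * ∫ ω, f ((2⁻¹ : ℝ) • (X ω + Y ω)) ∂μ := by
  rw [← integral_add hX hY, ← integral_const_mul]
  exact integral_sub (hX.add hY) (hXY.const_mul 2)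

end Integral

lemma cauchyInMeasure_of_midpointDefect {f : ℝ → ℝ} (hf : StrictConvexOn ℝ univ f)
    {X : ℕ → Ω → ℝ} (hb : BoundedInMeasure μ X)
    (hint : ∀ n k, Integrable (fun ω => midpointDefect f (X n ω) (X k ω)) μ)
    (hlim : Tendsto (fun q : ℕ × ℕ => ∫ ω, midpointDefect f (X q.1 ω) (X q.2 ω) ∂μ) atTop
      (nhds 0)) : CauchyInMeasure μ X := by
  intro ε hε
  refine ENNReal.tendsto_nhds_zero.2 fun η hη => ?_
  obtain ⟨a, ha⟩ := hb (η / 3) (ENNReal.div_pos hη.ne' (by norm_num))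
  obtain ⟨δ, hδ, hδ'⟩ := exists_pos_le_midpointDefect hf a hε
  have hmarkov (n k : ℕ) : μ {ω | δ ≤ midpointDefect f (X n ω) (X k ω)} ≤
      ENNReal.ofReal (∫ ω, midpointDefect f (X n ω) (X k ω) ∂μ) / ENNReal.ofReal δ := by
    rw [ofReal_integral_eq_lintegral_ofReal (hint n k)
      (.of_forall fun ω => midpointDefect_nonneg hf.convexOn _ _)]
    refine le_trans (measure_mono fun ω hω => ?_) (meas_ge_le_lintegral_div
      (hint n k).aemeasurable.ennreal_ofReal (ENNReal.ofReal_pos.2 hδ).ne' ENNReal.ofReal_ne_top)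
    exact ENNReal.ofReal_le_ofReal hω
  have hdefect : Tendsto (fun q : ℕ × ℕ =>
      ENNReal.ofReal (∫ ω, midpointDefect f (X q.1 ω) (X q.2 ω) ∂μ) / ENNReal.ofReal δ) atTop
      (nhds 0) := by
    simpa using ENNReal.Tendsto.div_const (ENNReal.tendsto_ofReal hlim)
      (.inr (ENNReal.ofReal_pos.2 hδ).ne')
  filter_upwards [hdefect.eventually_le_const (ENNReal.div_pos hη.ne' (by norm_num) : 0 < η / 3)]
    with ⟨n, k⟩ hnk
  have hcover : {ω | ε ≤ ‖X n ω - X k ω‖} ⊆ {ω | a < ‖X n ω‖} ∪ {ω | a < ‖X k ω‖} ∪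
      {ω | δ ≤ midpointDefect f (X n ω) (X k ω)} := fun ω hω => by
    by_contra h
    simp only [mem_union, mem_ofPred_eq, not_or, not_lt] at h
    exact h.2 (hδ' _ _ h.1.1 h.1.2 hω)
  calc μ {ω | ε ≤ ‖X n ω - X k ω‖} ≤ η / 3 + η / 3 + η / 3 :=
        (measure_mono hcover).trans <| (measure_union_le _ _).trans <| add_le_add
          ((measure_union_le _ _).trans (add_le_add (ha n) (ha k))) ((hmarkov n k).trans hnk)
    _ = η := ENNReal.add_thirds η

variable {E : Type*} [AddCommGroup E] [Module ℝ E]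

lemma exists_near_infimum_of_antitone {α : Type*} {A : ℕ → Set α} (hA : Antitone A)
    (hne : ∀ n, (A n).Nonempty) {J : α → ℝ} {a b : ℝ} (hJ : ∀ y ∈ A 0, J y ∈ Icc a b) :
    ∃ (y : ℕ → α) (I : ℕ → ℝ), Monotone I ∧ BddAbove (range I) ∧ (∀ n, ∀ z ∈ A n, I n ≤ J z) ∧
      ∀ n, y n ∈ A n ∧ J (y n) < I n + 1 / ((n : ℝ) + 1) := by
  have hsub (n : ℕ) : A n ⊆ A 0 := hA n.zero_le
  have hne' (n : ℕ) : (J '' A n).Nonempty := (hne n).image J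
  have hbdd (n : ℕ) : BddBelow (J '' A n) :=
    ⟨a, forall_mem_image.2 fun y hy => (hJ y (hsub n hy)).1⟩
  have hle (n : ℕ) : ∀ z ∈ A n, sInf (J '' A n) ≤ J z := fun z hz => csInf_le (hbdd n) ⟨z, hz, rfl⟩
  have hnear (n : ℕ) : ∃ y ∈ A n, J y < sInf (J '' A n) + 1 / ((n : ℝ) + 1) :=
    exists_mem_image.1 (exists_lt_of_csInf_lt (hne' n) (lt_add_of_pos_right _ (by positivity)))
  choose y hy using hnear
  refine ⟨y, fun n => sInf (J '' A n),
    fun n k hnk => csInf_le_csInf (hbdd n) (hne' k) (image_mono (hA hnk)),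
    ⟨b, forall_mem_range.2 fun n => ?_⟩, hle, hy⟩
  obtain ⟨z, hz⟩ := hne n
  exact (hle n z hz).trans (hJ z (hsub n hz)).2

lemma tendsto_add_sub_two_mul_min {u v : ℕ → ℝ} {l : ℝ} (hu : Tendsto u atTop (nhds l))
    (hv : Tendsto v atTop (nhds l)) :
    Tendsto (fun q : ℕ × ℕ => v q.1 + v q.2 - 2 * min (u q.1) (u q.2)) atTop (nhds 0) := by
  rw [← prod_atTop_atTop_eq]
  have := ((hv.comp tendsto_fst).add (hv.comp tendsto_snd)).sub
    (((hu.comp tendsto_fst).min (hu.comp tendsto_snd)).const_mul 2)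
  rwa [min_self, ← two_mul, sub_self] at this

lemma exists_convexHull_tendsto_midpointDefect {C : Set E} (hC : Convex ℝ C) {x : ℕ → E}
    (hx : ∀ n, x n ∈ C) {J : E → ℝ} {a b : ℝ} (hJ : ∀ y ∈ C, J y ∈ Icc a b)
    (hdefect : ∀ y ∈ C, ∀ z ∈ C, 0 ≤ midpointDefect J y z) :
    ∃ y : ℕ → E, (∀ n, y n ∈ convexHull ℝ (x '' Ici n)) ∧
      Tendsto (fun q : ℕ × ℕ => midpointDefect J (y q.1) (y q.2)) atTop (nhds 0) := by
  have hanti : Antitone fun n => convexHull ℝ (x '' Ici n) := fun n k hnk =>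
    convexHull_mono (image_mono (Ici_subset_Ici.2 hnk))
  have hsub (n : ℕ) : convexHull ℝ (x '' Ici n) ⊆ C :=
    convexHull_min (by rintro _ ⟨k, -, rfl⟩; exact hx k) hC
  obtain ⟨y, I, hImono, hIbdd, hIle, hy⟩ := exists_near_infimum_of_antitone hanti
    (fun n => (nonempty_Ici.image x).convexHull) fun y hy => hJ y (hsub 0 hy)
  have hIlim := tendsto_atTop_ciSup hImono hIbdd
  have herr : Tendsto (fun n => I n + 1 / ((n : ℝ) + 1)) atTop (nhds (⨆ n, I n)) := by
    simpa only [add_zero] using hIlim.add (tendsto_one_div_add_atTop_nhds_zero_nat (𝕜 := ℝ))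
  refine ⟨y, fun n => (hy n).1, squeeze_zero
    (fun q => hdefect _ (hsub _ (hy _).1) _ (hsub _ (hy _).1)) (fun q => ?_)
    (tendsto_add_sub_two_mul_min hIlim herr)⟩
  have hmid : (2⁻¹ : ℝ) • (y q.1 + y q.2) ∈ convexHull ℝ (x '' Ici (min q.1 q.2)) := by
    rw [smul_add]
    exact convex_convexHull ℝ _ (hanti (min_le_left _ _) (hy _).1)
      (hanti (min_le_right _ _) (hy _).1) (by norm_num) (by norm_num) (by norm_num)
  have hlow := hIle _ _ hmid
  rw [hImono.map_min] at hlow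
  rw [midpointDefect]
  linarith [(hy q.1).2, (hy q.2).2]

/-- The strictly convex loss function `x ↦ √(1 + x²) - x`, nonnegative and of linear growth. Its
minimiser over the one-period gains yields the density of a centering measure; in the lemma of
Komlós it only serves as a strictly convex function. -/
def smoothLoss (x : ℝ) : ℝ := √(1 + x ^ 2) - x

lemma abs_lt_sqrt_one_add_sq (x : ℝ) : |x| < √(1 + x ^ 2) := by
  rw [← Real.sqrt_sq_eq_abs]
  exact Real.sqrt_lt_sqrt (sq_nonneg _) (by linarith)

lemma smoothLoss_pos (x : ℝ) : 0 < smoothLoss x :=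
  sub_pos.2 ((le_abs_self x).trans_lt (abs_lt_sqrt_one_add_sq x))

lemma hasDerivAt_smoothLoss (x : ℝ) : HasDerivAt smoothLoss (x / √(1 + x ^ 2) - 1) x := by
  have hsq : HasDerivAt (fun x : ℝ => 1 + x ^ 2) (2 * x) x := by
    simpa using (hasDerivAt_pow 2 x).const_add 1
  have := (hsq.sqrt (by positivity)).sub (hasDerivAt_id x)
  rwa [mul_div_mul_left _ _ two_ne_zero] at this

lemma abs_div_sqrt_one_add_sq_lt_one (x : ℝ) : |x / √(1 + x ^ 2)| < 1 := by
  have : 0 < √(1 + x ^ 2) := by positivity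
  rw [abs_div, abs_of_pos this, div_lt_one this]
  exact abs_lt_sqrt_one_add_sq x

@[fun_prop]
lemma continuous_smoothLoss : Continuous smoothLoss := by
  unfold smoothLoss
  fun_prop

lemma smoothLoss_add_le (x h : ℝ) : smoothLoss (x + h) ≤ smoothLoss x + 2 * |h| := by
  have hderiv (y : ℝ) : ‖deriv smoothLoss y‖ ≤ 2 := by
    rw [(hasDerivAt_smoothLoss y).deriv, Real.norm_eq_abs]
    have := abs_lt.1 (abs_div_sqrt_one_add_sq_lt_one y)
    exact abs_le.2 ⟨by linarith, by linarith⟩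
  have := convex_univ.norm_image_sub_le_of_norm_deriv_le
    (fun y _ => (hasDerivAt_smoothLoss y).differentiableAt) (fun y _ => hderiv y)
    (mem_univ x) (mem_univ (x + h))
  rw [add_sub_cancel_left, Real.norm_eq_abs, Real.norm_eq_abs] at this
  linarith [le_abs_self (smoothLoss (x + h) - smoothLoss x)]

lemma strictConvexOn_smoothLoss : StrictConvexOn ℝ univ smoothLoss := by
  refine StrictMonoOn.strictConvexOn_of_deriv convex_univ continuous_smoothLoss.continuousOn
    fun x _ y _ hxy => ?_
  rw [(hasDerivAt_smoothLoss x).deriv, (hasDerivAt_smoothLoss y).deriv, ← Real.sin_arctan,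
    ← Real.sin_arctan]
  exact sub_lt_sub_right (Real.strictMonoOn_sin (Ioo_subset_Icc_self (Real.arctan_mem_Ioo x))
    (Ioo_subset_Icc_self (Real.arctan_mem_Ioo y)) (Real.arctan_strictMono hxy)) 1

lemma smoothLoss_le (x : ℝ) : smoothLoss x ≤ 1 + 2 * |x| := by
  simpa [smoothLoss] using smoothLoss_add_le 0 x

variable [IsFiniteMeasure μ]

lemma integrable_smoothLoss_comp {X : Ω → ℝ} (hX : Integrable X μ) :
    Integrable (fun ω => smoothLoss (X ω)) μ := by
  refine ((integrable_const 1).add (hX.abs.const_mul 2)).mono'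
    (continuous_smoothLoss.comp_aestronglyMeasurable hX.1) (.of_forall fun ω => ?_)
  rw [Real.norm_of_nonneg (smoothLoss_pos _).le]
  exact smoothLoss_le _

lemma integral_smoothLoss_le {X : Ω → ℝ} (hX : Integrable X μ) :
    ∫ ω, smoothLoss (X ω) ∂μ ≤ μ.real univ + 2 * ∫ ω, |X ω| ∂μ := by
  have hbound : Integrable (fun ω => 1 + 2 * |X ω|) μ :=
    (integrable_const 1).add (hX.abs.const_mul 2)
  refine (integral_mono (integrable_smoothLoss_comp hX) hbound fun ω => smoothLoss_le _).trans_eq ?_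
  rw [integral_add (integrable_const 1) (hX.abs.const_mul 2), integral_const_mul, integral_const,
    smul_eq_mul, mul_one]

lemma integrable_smoothLoss_midpoint_comp {X Y : Ω → ℝ} (hX : Integrable X μ)
    (hY : Integrable Y μ) : Integrable (fun ω => smoothLoss ((2⁻¹ : ℝ) • (X ω + Y ω))) μ :=
  integrable_smoothLoss_comp ((hX.add hY).smul (2⁻¹ : ℝ))

lemma cauchyInMeasure_of_midpointDefect_smoothLoss {X : ℕ → Ω → ℝ} {K : ℝ}
    (hX : ∀ n, Integrable (X n) μ) (hK : ∀ n, ∫ ω, |X n ω| ∂μ ≤ K)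
    (hlim : Tendsto (fun q : ℕ × ℕ => ∫ ω, midpointDefect smoothLoss (X q.1 ω) (X q.2 ω) ∂μ) atTop
      (nhds 0)) : CauchyInMeasure μ X := by
  have hbdd : BoundedInMeasure μ X := by
    refine boundedInMeasure_of_lintegral_enorm_le (K := ENNReal.ofReal K) ENNReal.ofReal_ne_top
      (fun n => (hX n).1) fun n => ?_
    rw [← ofReal_integral_norm_eq_lintegral_enorm (hX n)]
    exact ENNReal.ofReal_le_ofReal (hK n)
  exact cauchyInMeasure_of_midpointDefect strictConvexOn_smoothLoss hbdd
    (fun n k => integrable_midpointDefect (integrable_smoothLoss_comp (hX n))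
      (integrable_smoothLoss_comp (hX k)) (integrable_smoothLoss_midpoint_comp (hX n) (hX k))) hlim

theorem exists_convexHull_tendsto_ae {ι : Type*} [Finite ι] (L : E →ₗ[ℝ] (ι → Ω → ℝ))
    {C : Set E} (hC : Convex ℝ C) {x : ℕ → E} (hx : ∀ n, x n ∈ C) {K : ℝ}
    (hint : ∀ y ∈ C, ∀ i, Integrable (L y i) μ) (hK : ∀ y ∈ C, ∀ i, ∫ ω, |L y i ω| ∂μ ≤ K) :
    ∃ y : ℕ → E, (∀ n, y n ∈ convexHull ℝ (x '' Ici n)) ∧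
      ∀ᵐ ω ∂μ, ∀ i, ∃ l : ℝ, Tendsto (fun n => L (y n) i ω) atTop (nhds l) := by
  have := Fintype.ofFinite ι
  let J (y : E) : ℝ := ∑ i, ∫ ω, smoothLoss (L y i ω) ∂μ
  have hmean (y z : E) (i : ι) (ω : Ω) :
      L ((2⁻¹ : ℝ) • (y + z)) i ω = (2⁻¹ : ℝ) • (L y i ω + L z i ω) := by
    simp only [map_smul, map_add, Pi.smul_apply, Pi.add_apply]
  have hnonneg (y z : E) (i : ι) :
      0 ≤ ∫ ω, midpointDefect smoothLoss (L y i ω) (L z i ω) ∂μ :=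
    integral_nonneg fun ω => midpointDefect_nonneg strictConvexOn_smoothLoss.convexOn _ _
  have hsum {y z : E} (hy : y ∈ C) (hz : z ∈ C) :
      ∑ i, ∫ ω, midpointDefect smoothLoss (L y i ω) (L z i ω) ∂μ = midpointDefect J y z := by
    simp only [midpointDefect, J, hmean, Finset.mul_sum, ← Finset.sum_add_distrib,
      ← Finset.sum_sub_distrib]
    exact Finset.sum_congr rfl fun i _ =>
      integral_midpointDefect (integrable_smoothLoss_comp (hint y hy i))
        (integrable_smoothLoss_comp (hint z hz i))
        (integrable_smoothLoss_midpoint_comp (hint y hy i) (hint z hz i))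
  have hJ {y : E} (hy : y ∈ C) : J y ∈ Icc 0 (∑ _i : ι, (μ.real univ + 2 * K)) :=
    ⟨Finset.sum_nonneg fun i _ => integral_nonneg fun ω => (smoothLoss_pos _).le,
      Finset.sum_le_sum fun i _ => (integral_smoothLoss_le (hint y hy i)).trans
        (by linarith [hK y hy i])⟩
  obtain ⟨y, hy, hlim⟩ := exists_convexHull_tendsto_midpointDefect hC hx (fun y hy => hJ hy)
    fun y hy z hz => hsum hy hz ▸ Finset.sum_nonneg fun i _ => hnonneg y z i
  have hyC (n : ℕ) : y n ∈ C :=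
    convexHull_min (by rintro _ ⟨k, -, rfl⟩; exact hx k) hC (hy n)
  have hcauchy (i : ι) : CauchyInMeasure μ fun n => L (y n) i :=
    cauchyInMeasure_of_midpointDefect_smoothLoss (fun n => hint _ (hyC n) i)
      (fun n => hK _ (hyC n) i) <| squeeze_zero (fun q => hnonneg _ _ i)
        (fun q => (Finset.single_le_sum (fun j _ => hnonneg (y q.1) (y q.2) j)
          (Finset.mem_univ i)).trans_eq (hsum (hyC _) (hyC _))) hlim
  obtain ⟨σ, hσ, hσlim⟩ := exists_subseq_tendsto_of_cauchyInMeasure hcauchy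
  exact ⟨y ∘ σ, fun n => convexHull_mono (image_mono (Ici_subset_Ici.2 hσ.le_apply)) (hy _),
    hσlim⟩

end Komlos

/-! ### Canonical representatives of portfolios -/

section Coimage

variable {E : Type*} [NormedAddCommGroup E] [InnerProductSpace ℝ E] [FiniteDimensional ℝ E]

/-- The orthogonal projection onto the orthogonal complement of the kernel of `A`. -/
def coimageProj (A : E →L[ℝ] E) : E →L[ℝ] E := (A.ker)ᗮ.starProjection

lemma coimageProj_mem (A : E →L[ℝ] E) (x : E) : coimageProj A x ∈ (A.ker)ᗮ :=
  Submodule.starProjection_apply_mem _ x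

lemma coimageProj_coimageProj (A : E →L[ℝ] E) (x : E) :
    coimageProj A (coimageProj A x) = coimageProj A x :=
  Submodule.starProjection_eq_self_iff.2 (coimageProj_mem A x)

lemma sub_coimageProj_eq (A : E →L[ℝ] E) (x : E) :
    x - coimageProj A x = (A.ker).starProjection x := by
  rw [coimageProj, Submodule.starProjection_orthogonal_val, sub_sub_cancel]

lemma apply_coimageProj (A : E →L[ℝ] E) (x : E) : A (coimageProj A x) = A x := by
  have hker : A (x - coimageProj A x) = 0 := by
    rw [sub_coimageProj_eq]
    exact Submodule.starProjection_apply_mem A.ker x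
  rw [map_sub, sub_eq_zero] at hker
  exact hker.symm

lemma tendsto_zero_of_mem_ker_orthogonal {A : E →L[ℝ] E} {x : ℕ → E}
    (hx : ∀ n, x n ∈ (A.ker)ᗮ) (h : Tendsto (fun n => A (x n)) atTop (nhds 0)) :
    Tendsto x atTop (nhds 0) := by
  let f : (A.ker)ᗮ →ₗ[ℝ] E := (A : E →ₗ[ℝ] E).comp (A.ker)ᗮ.subtype
  have hf : LinearMap.ker f = ⊥ := LinearMap.ker_eq_bot'.2 fun y hy =>
    Subtype.ext (inner_self_eq_zero.1 (y.2 _ hy : inner ℝ (y : E) (y : E) = 0))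
  obtain ⟨K, -, hK⟩ := f.exists_antilipschitzWith hf
  rw [tendsto_zero_iff_norm_tendsto_zero] at h ⊢
  refine squeeze_zero (fun n => norm_nonneg _) (fun n => ?_) (by simpa using h.const_mul (K : ℝ))
  simpa [f] using hK.le_mul_dist ⟨x n, hx n⟩ 0

/-- A contraction whose fixed points are the kernel of `A` and which depends continuously on `A`.
By the mean ergodic theorem its Cesàro means converge to the projection onto that kernel; this is
what makes `coimageProj A` a measurable function of `A`. -/
def kerContraction (A : E →L[ℝ] E) : E →L[ℝ] E :=
  1 - (1 + ‖A‖ ^ 2)⁻¹ • (ContinuousLinearMap.adjoint A * A)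

lemma continuous_kerContraction : Continuous (kerContraction (E := E)) := by
  have hadj : Continuous fun A : E →L[ℝ] E => ContinuousLinearMap.adjoint A :=
    (ContinuousLinearMap.adjoint (𝕜 := ℝ) (E := E) (F := E)).continuous
  have hinv : Continuous fun A : E →L[ℝ] E => (1 + ‖A‖ ^ 2)⁻¹ :=
    (by fun_prop : Continuous fun A : E →L[ℝ] E => 1 + ‖A‖ ^ 2).inv₀ fun A => by positivity
  exact continuous_const.sub (hinv.smul (hadj.mul continuous_id))

lemma kerContraction_apply (A : E →L[ℝ] E) (x : E) :
    kerContraction A x = x - (1 + ‖A‖ ^ 2)⁻¹ • ContinuousLinearMap.adjoint A (A x) := rfl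

lemma norm_kerContraction_le (A : E →L[ℝ] E) : ‖kerContraction A‖ ≤ 1 := by
  refine ContinuousLinearMap.opNorm_le_bound _ zero_le_one fun x => ?_
  rw [one_mul, ← pow_le_pow_iff_left₀ (norm_nonneg _) (norm_nonneg _) two_ne_zero,
    kerContraction_apply]
  set t := (1 + ‖A‖ ^ 2)⁻¹
  have ht : t * ‖A‖ ^ 2 ≤ 1 := by
    rw [inv_mul_le_iff₀ (by positivity)]
    linarith
  have hadj : ‖ContinuousLinearMap.adjoint A (A x)‖ ^ 2 ≤ ‖A‖ ^ 2 * ‖A x‖ ^ 2 := by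
    rw [← mul_pow, ← LinearIsometryEquiv.norm_map ContinuousLinearMap.adjoint A]
    exact pow_le_pow_left₀ (norm_nonneg _) (ContinuousLinearMap.le_opNorm _ _) 2
  have : 0 ≤ t := by positivity
  calc ‖x - t • ContinuousLinearMap.adjoint A (A x)‖ ^ 2
      = ‖x‖ ^ 2 - 2 * (t * ‖A x‖ ^ 2) + t ^ 2 * ‖ContinuousLinearMap.adjoint A (A x)‖ ^ 2 := by
        rw [norm_sub_sq_real, real_inner_smul_right, ContinuousLinearMap.adjoint_inner_right,
          real_inner_self_eq_norm_sq, norm_smul, mul_pow, Real.norm_eq_abs, sq_abs]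
    _ ≤ ‖x‖ ^ 2 - 2 * (t * ‖A x‖ ^ 2) + t ^ 2 * (‖A‖ ^ 2 * ‖A x‖ ^ 2) := by gcongr
    _ = ‖x‖ ^ 2 - t * ‖A x‖ ^ 2 - (1 - t * ‖A‖ ^ 2) * (t * ‖A x‖ ^ 2) := by ring
    _ ≤ ‖x‖ ^ 2 := by
        have := mul_nonneg (sub_nonneg.2 ht) (by positivity : 0 ≤ t * ‖A x‖ ^ 2)
        linarith [(by positivity : 0 ≤ t * ‖A x‖ ^ 2)]

lemma eqLocus_kerContraction (A : E →L[ℝ] E) :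
    (kerContraction A).eqLocus (1 : E →L[ℝ] E) = A.ker := by
  ext x
  have hfix : x ∈ (kerContraction A).eqLocus (1 : E →L[ℝ] E) ↔ kerContraction A x = x := Iff.rfl
  rw [hfix, kerContraction_apply, sub_eq_self, smul_eq_zero,
    or_iff_right (by positivity : (1 + ‖A‖ ^ 2)⁻¹ ≠ 0), LinearMap.mem_ker]
  refine ⟨fun h => ?_, fun h => ?_⟩
  · have hsq : inner ℝ x (ContinuousLinearMap.adjoint A (A x)) = ‖A x‖ ^ 2 := by
      rw [ContinuousLinearMap.adjoint_inner_right, real_inner_self_eq_norm_sq]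
    rw [h, inner_zero_right] at hsq
    exact norm_eq_zero.1 (pow_eq_zero_iff two_ne_zero |>.1 hsq.symm)
  · rw [show A x = 0 from h, map_zero]

lemma tendsto_birkhoffAverage_kerContraction (A : E →L[ℝ] E) (x : E) :
    Tendsto (fun n => x - birkhoffAverage ℝ (kerContraction A) _root_.id n x) atTop
      (nhds (coimageProj A x)) := by
  have herg := ContinuousLinearMap.tendsto_birkhoffAverage_orthogonalProjection _
    (norm_kerContraction_le A) x
  rw [Submodule.coe_orthogonalProjectionOnto_apply] at herg
  simp_rw [eqLocus_kerContraction A, ← sub_coimageProj_eq] at herg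
  simpa using herg.const_sub x

lemma measurable_coimageProj [MeasurableSpace E] [BorelSpace E] {Ω : Type*}
    {m : MeasurableSpace Ω} {G : Ω → E →L[ℝ] E} (hG : StronglyMeasurable G) {ξ : Ω → E}
    (hξ : Measurable ξ) : Measurable fun ω => coimageProj (G ω) (ξ ω) := by
  have hiterate (k : ℕ) : StronglyMeasurable fun ω => (kerContraction (G ω))^[k] (ξ ω) := by
    induction k with
    | zero => exact hξ.stronglyMeasurable
    | succ k ih =>
      simp only [Function.iterate_succ_apply']
      exact isBoundedBilinearMap_apply.continuous.comp_stronglyMeasurable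
        ((continuous_kerContraction.comp_stronglyMeasurable hG).prodMk ih)
  refine measurable_of_tendsto_metrizable (f := fun n ω => ξ ω -
    birkhoffAverage ℝ (kerContraction (G ω)) _root_.id n (ξ ω)) (fun n => hξ.sub ?_)
    (tendsto_pi_nhds.2 fun ω => tendsto_birkhoffAverage_kerContraction _ _)
  simp only [birkhoffAverage, birkhoffSum, _root_.id]
  exact (Finset.measurable_fun_sum _ fun k _ => (hiterate k).measurable).const_smul _

end Coimage

section Canonical

open InnerProductSpace (rankOne rankOne_apply norm_rankOne)

variable {E : Type*} [NormedAddCommGroup E] [InnerProductSpace ℝ E]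

lemma norm_rankOne_apply (v w : E) : ‖rankOne ℝ v v w‖ = |inner ℝ w v| * ‖v‖ := by
  rw [rankOne_apply, norm_smul, Real.norm_eq_abs, real_inner_comm]

/-- The rescaling of `v` into the closed unit ball that divides by `r` inside the ball of radius `r`
and by the norm outside. -/
def unitRescale (r : ℝ) (v : E) : E := (max r ‖v‖)⁻¹ • v

lemma inner_unitRescale (r : ℝ) (v w : E) :
    inner ℝ (unitRescale r v) w = (max r ‖v‖)⁻¹ * inner ℝ v w := real_inner_smul_left _ _ _

lemma max_neg_inner_unitRescale_le {r : ℝ} (hr : 0 < r) (v w : E) :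
    max (-inner ℝ (unitRescale r v) w) 0 ≤ 1 / r * max (-inner ℝ v w) 0 := by
  have hmax : (max r ‖v‖)⁻¹ ≤ 1 / r := by
    rw [one_div]
    exact inv_anti₀ hr (le_max_left _ _)
  calc max (-inner ℝ (unitRescale r v) w) 0
    _ = (max r ‖v‖)⁻¹ * max (-inner ℝ v w) 0 := by
      rw [inner_unitRescale, ← mul_neg, mul_max_of_nonneg _ _ (by positivity), mul_zero]
    _ ≤ 1 / r * max (-inner ℝ v w) 0 := by gcongr

lemma measurable_unitRescale [MeasurableSpace E] [BorelSpace E] [SecondCountableTopology E]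
    (r : ℝ) : Measurable (unitRescale r : E → E) :=
  (measurable_const.max measurable_norm).inv.smul measurable_id

lemma norm_unitRescale_le {r : ℝ} (hr : 0 < r) (v : E) : ‖unitRescale r v‖ ≤ 1 := by
  have hpos : 0 < max r ‖v‖ := lt_max_of_lt_left hr
  rw [unitRescale, norm_smul, norm_inv, Real.norm_of_nonneg hpos.le, inv_mul_le_iff₀ hpos, mul_one]
  exact le_max_right _ _

lemma norm_lt_of_norm_unitRescale_lt_one {r : ℝ} (hr : 0 < r) {v : E}
    (hv : ‖unitRescale r v‖ < 1) : ‖v‖ < r := by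
  have hpos : 0 < max r ‖v‖ := lt_max_of_lt_left hr
  rwa [unitRescale, norm_smul, norm_inv, Real.norm_of_nonneg hpos.le, inv_mul_lt_iff₀ hpos,
    mul_one, lt_max_iff, or_iff_left (lt_irrefl _)] at hv

lemma unitRescale_one_of_norm_le_one {v : E} (hv : ‖v‖ ≤ 1) : unitRescale 1 v = v := by
  rw [unitRescale, max_eq_left hv, inv_one, one_smul]

variable [FiniteDimensional ℝ E] {Ω : Type*} {m mΩ : MeasurableSpace Ω} {μ : Measure Ω}

/-- The conditional second moment operator of `s` given `m`. Its kernel consists of the directions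
in which `s` conditionally vanishes. -/
def condGram (m : MeasurableSpace Ω) {_ : MeasurableSpace Ω} (μ : Measure Ω) (s : Ω → E) :
    Ω → E →L[ℝ] E :=
  μ[fun ω => rankOne ℝ (s ω) (s ω) | m]

/-- The canonical representative of a portfolio that is held over a period with price increment
`s`: the projection off the directions that are redundant given `m`. -/
def canonicalRep (m : MeasurableSpace Ω) {_ : MeasurableSpace Ω} (μ : Measure Ω) (s : Ω → E)
    (ω : Ω) : E →L[ℝ] E :=
  coimageProj (condGram m μ s ω)

lemma canonicalRep_canonicalRep (s : Ω → E) (ω : Ω) (v : E) :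
    canonicalRep m μ s ω (canonicalRep m μ s ω v) = canonicalRep m μ s ω v :=
  coimageProj_coimageProj _ v

variable [MeasurableSpace E] [BorelSpace E]

lemma measurable_canonicalRep (s : Ω → E) {ξ : Ω → E} (hξ : Measurable[m] ξ) :
    Measurable[m] fun ω => canonicalRep m μ s ω (ξ ω) :=
  measurable_coimageProj stronglyMeasurable_condExp hξ

variable [IsFiniteMeasure μ] {s : Ω → E} {M B : ℝ} {ξ : Ω → E}

lemma integrable_rankOne (hs : Measurable s) (hM : ∀ᵐ ω ∂μ, ‖s ω‖ ≤ M) :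
    Integrable (fun ω => rankOne ℝ (s ω) (s ω)) μ := by
  have hcont : Continuous fun v : E => rankOne ℝ v v :=
    (rankOne ℝ (E := E) (F := E)).continuous₂.comp (continuous_id.prodMk continuous_id)
  refine Integrable.of_bound
    (hcont.comp_stronglyMeasurable hs.stronglyMeasurable).aestronglyMeasurable (M * M) ?_
  filter_upwards [hM] with ω hω
  rw [norm_rankOne]
  exact mul_self_le_mul_self (norm_nonneg _) hω

lemma integrable_inner (hm : m ≤ mΩ) (hs : Measurable s) (hM : ∀ᵐ ω ∂μ, ‖s ω‖ ≤ M)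
    (hξ : Measurable[m] ξ) (hB : ∀ ω, ‖ξ ω‖ ≤ B) :
    Integrable (fun ω => (inner ℝ (ξ ω) (s ω) : ℝ)) μ := by
  refine Integrable.of_bound ((hξ.mono hm le_rfl).inner hs).aestronglyMeasurable (B * M) ?_
  filter_upwards [hM] with ω hω
  exact (norm_inner_le_norm _ _).trans
    (mul_le_mul (hB ω) hω (norm_nonneg _) ((norm_nonneg _).trans (hB ω)))

lemma integrable_rankOne_apply (hm : m ≤ mΩ) (hs : Measurable s) (hM : ∀ᵐ ω ∂μ, ‖s ω‖ ≤ M)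
    (hξ : Measurable[m] ξ) (hB : ∀ ω, ‖ξ ω‖ ≤ B) :
    Integrable (fun ω => rankOne ℝ (s ω) (s ω) (ξ ω)) μ := by
  simp only [rankOne_apply, real_inner_comm (ξ _)]
  exact (integrable_inner hm hs hM hξ hB).smul_bdd M hs.aestronglyMeasurable hM

lemma condGram_apply (hm : m ≤ mΩ) (hs : Measurable s) (hM : ∀ᵐ ω ∂μ, ‖s ω‖ ≤ M)
    (hξ : Measurable[m] ξ) (hB : ∀ ω, ‖ξ ω‖ ≤ B) :
    (fun ω => condGram m μ s ω (ξ ω)) =ᵐ[μ] μ[fun ω => rankOne ℝ (s ω) (s ω) (ξ ω) | m] := by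
  have hpull := condExp_bilin_of_stronglyMeasurable_left
    (ContinuousLinearMap.apply ℝ E : E →L[ℝ] (E →L[ℝ] E) →L[ℝ] E) (m := m) (μ := μ) (f := ξ)
    (g := fun ω => rankOne ℝ (s ω) (s ω)) hξ.stronglyMeasurable
    (by simpa using integrable_rankOne_apply hm hs hM hξ hB) (integrable_rankOne hs hM)
  simp only [ContinuousLinearMap.apply_apply] at hpull
  exact hpull.symm

lemma integral_inner_sq_eq (hm : m ≤ mΩ) (hs : Measurable s) (hM : ∀ᵐ ω ∂μ, ‖s ω‖ ≤ M)
    (hξ : Measurable[m] ξ) (hB : ∀ ω, ‖ξ ω‖ ≤ B) :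
    ∫ ω, (inner ℝ (ξ ω) (s ω) : ℝ) ^ 2 ∂μ = ∫ ω, inner ℝ (ξ ω) (condGram m μ s ω (ξ ω)) ∂μ := by
  have hint := integrable_rankOne_apply hm hs hM hξ hB
  have hinner : Integrable (fun ω => (inner ℝ (ξ ω) (rankOne ℝ (s ω) (s ω) (ξ ω)) : ℝ)) μ := by
    refine (hint.norm.const_mul B).mono'
      ((hξ.mono hm le_rfl).aestronglyMeasurable.inner hint.1) (.of_forall fun ω => ?_)
    exact (norm_inner_le_norm _ _).trans (mul_le_mul_of_nonneg_right (hB ω) (norm_nonneg _))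
  have hpull := condExp_bilin_of_stronglyMeasurable_left (innerSL ℝ (E := E)) (m := m)
    hξ.stronglyMeasurable hinner hint
  calc ∫ ω, (inner ℝ (ξ ω) (s ω) : ℝ) ^ 2 ∂μ
      = ∫ ω, inner ℝ (ξ ω) (rankOne ℝ (s ω) (s ω) (ξ ω)) ∂μ := by
        simp only [rankOne_apply, real_inner_smul_right, real_inner_comm (ξ _) (s _), sq]
    _ = ∫ ω, μ[fun ω => (inner ℝ (ξ ω) (rankOne ℝ (s ω) (s ω) (ξ ω)) : ℝ) | m] ω ∂μ :=
        (integral_condExp hm).symm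
    _ = ∫ ω, inner ℝ (ξ ω) (condGram m μ s ω (ξ ω)) ∂μ := by
        refine integral_congr_ae (hpull.trans ?_)
        filter_upwards [condGram_apply hm hs hM hξ hB] with ω hω
        rw [hω]
        rfl

lemma inner_eq_zero_of_condGram_apply_eq_zero (hm : m ≤ mΩ) (hs : Measurable s)
    (hM : ∀ᵐ ω ∂μ, ‖s ω‖ ≤ M) (hξ : Measurable[m] ξ) (hB : ∀ ω, ‖ξ ω‖ ≤ B)
    (hzero : ∀ ω, condGram m μ s ω (ξ ω) = 0) : ∀ᵐ ω ∂μ, (inner ℝ (ξ ω) (s ω) : ℝ) = 0 := by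
  have hsq := integral_inner_sq_eq hm hs hM hξ hB
  simp only [hzero, inner_zero_right, integral_zero] at hsq
  have hL2 : Integrable (fun ω => (inner ℝ (ξ ω) (s ω) : ℝ) ^ 2) μ := by
    have hinner := integrable_inner hm hs hM hξ hB
    refine Integrable.of_bound (hinner.1.pow 2) ((B * M) ^ 2) ?_
    filter_upwards [hM] with ω hω
    rw [norm_pow]
    exact pow_le_pow_left₀ (norm_nonneg _) ((norm_inner_le_norm _ _).trans
      (mul_le_mul (hB ω) hω (norm_nonneg _) ((norm_nonneg _).trans (hB ω)))) 2
  filter_upwards [(integral_eq_zero_iff_of_nonneg (fun ω => sq_nonneg _) hL2).1 hsq] with ω hω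
  exact pow_eq_zero_iff two_ne_zero |>.1 hω

lemma inner_canonicalRep (hm : m ≤ mΩ) (hs : Measurable s) (hM : ∀ᵐ ω ∂μ, ‖s ω‖ ≤ M) :
    ∀ᵐ ω ∂μ, ∀ v : E, (inner ℝ (canonicalRep m μ s ω v) (s ω) : ℝ) = inner ℝ v (s ω) := by
  have hdense : ∀ᵐ ω ∂μ, ∀ k : ℕ, (inner ℝ (TopologicalSpace.denseSeq E k -
      canonicalRep m μ s ω (TopologicalSpace.denseSeq E k)) (s ω) : ℝ) = 0 := by
    refine ae_all_iff.2 fun k => inner_eq_zero_of_condGram_apply_eq_zero hm hs hM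
      (B := ‖TopologicalSpace.denseSeq E k‖)
      (measurable_const.sub (measurable_canonicalRep s measurable_const)) (fun ω => ?_) fun ω => ?_
    · rw [canonicalRep, sub_coimageProj_eq]
      exact Submodule.norm_starProjection_apply_le _ _
    · rw [canonicalRep, map_sub, apply_coimageProj, sub_self]
  filter_upwards [hdense] with ω hω v
  refine (TopologicalSpace.denseRange_denseSeq E).induction_on v
    (isClosed_eq (by fun_prop) (by fun_prop)) fun k => ?_
  rw [eq_comm, ← sub_eq_zero, ← inner_sub_left, hω k]

lemma integral_norm_condGram_apply_le (hm : m ≤ mΩ) (hs : Measurable s)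
    (hM : ∀ᵐ ω ∂μ, ‖s ω‖ ≤ M) (hξ : Measurable[m] ξ) (hB : ∀ ω, ‖ξ ω‖ ≤ B) :
    ∫ ω, ‖condGram m μ s ω (ξ ω)‖ ∂μ ≤ (∫ ω, |inner ℝ (ξ ω) (s ω)| ∂μ) * M := by
  calc ∫ ω, ‖condGram m μ s ω (ξ ω)‖ ∂μ
      = ∫ ω, ‖μ[fun ω => rankOne ℝ (s ω) (s ω) (ξ ω) | m] ω‖ ∂μ :=
        integral_congr_ae ((condGram_apply hm hs hM hξ hB).fun_comp norm)
    _ ≤ ∫ ω, ‖rankOne ℝ (s ω) (s ω) (ξ ω)‖ ∂μ := integral_norm_condExp_le _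
    _ ≤ ∫ ω, |inner ℝ (ξ ω) (s ω)| * M ∂μ := by
        refine integral_mono_ae (integrable_rankOne_apply hm hs hM hξ hB).norm
          ((integrable_inner hm hs hM hξ hB).abs.mul_const M) ?_
        filter_upwards [hM] with ω hω
        rw [norm_rankOne_apply]
        exact mul_le_mul_of_nonneg_left hω (abs_nonneg _)
    _ = (∫ ω, |inner ℝ (ξ ω) (s ω)| ∂μ) * M := integral_mul_const _ _

lemma exists_subseq_canonicalRep_tendsto_zero_of_bounded (hm : m ≤ mΩ) (hs : Measurable s)
    (hM : ∀ᵐ ω ∂μ, ‖s ω‖ ≤ M) {η : ℕ → Ω → E} (hη : ∀ n, Measurable[m] (η n))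
    (hB : ∀ n ω, ‖η n ω‖ ≤ B)
    (hlim : Tendsto (fun n => ∫ ω, |inner ℝ (η n ω) (s ω)| ∂μ) atTop (nhds 0)) :
    ∃ σ : ℕ → ℕ, StrictMono σ ∧
      ∀ᵐ ω ∂μ, Tendsto (fun n => canonicalRep m μ s ω (η (σ n) ω)) atTop (nhds 0) := by
  have hmean : Tendsto (fun n => ∫ ω, ‖condGram m μ s ω (η n ω)‖ ∂μ) atTop (nhds 0) :=
    squeeze_zero (fun n => integral_nonneg fun ω => norm_nonneg _)
      (fun n => integral_norm_condGram_apply_le hm hs hM (hη n) (hB n))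
      (by simpa using hlim.mul_const M)
  have hint (n : ℕ) : Integrable (fun ω => condGram m μ s ω (η n ω)) μ :=
    integrable_condExp.congr (condGram_apply hm hs hM (hη n) (hB n)).symm
  have hmeasure : TendstoInMeasure μ (fun n ω => condGram m μ s ω (η n ω)) atTop 0 := by
    refine tendstoInMeasure_of_tendsto_eLpNorm one_ne_zero (fun n => (hint n).1)
      aestronglyMeasurable_const ?_
    simp only [sub_zero, eLpNorm_one_eq_lintegral_enorm,
      ← ofReal_integral_norm_eq_lintegral_enorm (hint _)]
    simpa using ENNReal.tendsto_ofReal hmean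
  obtain ⟨σ, hσ, hσlim⟩ := hmeasure.exists_seq_tendsto_ae
  refine ⟨σ, hσ, ?_⟩
  filter_upwards [hσlim] with ω hω
  refine tendsto_zero_of_mem_ker_orthogonal (A := condGram m μ s ω)
    (fun n => coimageProj_mem _ _) ?_
  simpa only [canonicalRep, apply_coimageProj, Pi.zero_apply] using hω

lemma exists_subseq_canonicalRep_tendsto_zero (hm : m ≤ mΩ) (hs : Measurable s)
    (hM : ∀ᵐ ω ∂μ, ‖s ω‖ ≤ M) {ξ : ℕ → Ω → E} (hξ : ∀ n, Measurable[m] (ξ n))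
    (hlim : ∀ᵐ ω ∂μ, Tendsto (fun n => (inner ℝ (ξ n ω) (s ω) : ℝ)) atTop (nhds 0)) :
    ∃ σ : ℕ → ℕ, StrictMono σ ∧
      ∀ᵐ ω ∂μ, Tendsto (fun n => canonicalRep m μ s ω (ξ (σ n) ω)) atTop (nhds 0) := by
  -- Truncating the representatives to the unit ball makes dominated convergence available.
  let η (n : ℕ) (ω : Ω) : E := unitRescale 1 (canonicalRep m μ s ω (ξ n ω))
  have hη (n : ℕ) : Measurable[m] (η n) :=
    (measurable_unitRescale 1).comp (measurable_canonicalRep s (hξ n))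
  have hη_rep (n : ℕ) (ω : Ω) : canonicalRep m μ s ω (η n ω) = η n ω := by
    simp only [η, unitRescale, map_smul, canonicalRep_canonicalRep]
  have hη_inner : ∀ᵐ ω ∂μ, ∀ n, |inner ℝ (η n ω) (s ω)| ≤ |inner ℝ (ξ n ω) (s ω)| := by
    filter_upwards [inner_canonicalRep hm hs hM] with ω hω n
    rw [inner_unitRescale, hω, abs_mul, abs_of_nonneg (by positivity)]
    exact mul_le_of_le_one_left (abs_nonneg _) (inv_le_one_of_one_le₀ (le_max_left _ _))
  have hη_lim : Tendsto (fun n => ∫ ω, |inner ℝ (η n ω) (s ω)| ∂μ) atTop (nhds 0) := by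
    rw [← integral_zero Ω ℝ (μ := μ)]
    refine tendsto_integral_of_dominated_convergence (fun _ => 1 * M)
      (fun n => (integrable_inner hm hs hM (hη n) fun ω => norm_unitRescale_le one_pos _).1.norm)
      (integrable_const _) (fun n => ?_) ?_
    · filter_upwards [hM] with ω hω
      rw [Real.norm_eq_abs, abs_abs]
      exact (abs_real_inner_le_norm _ _).trans
        (mul_le_mul (norm_unitRescale_le one_pos _) hω (norm_nonneg _) zero_le_one)
    · filter_upwards [hlim, hη_inner] with ω hω hωle
      exact squeeze_zero (fun n => abs_nonneg _) hωle (by simpa using hω.abs)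
  obtain ⟨σ, hσ, hσlim⟩ := exists_subseq_canonicalRep_tendsto_zero_of_bounded hm hs hM hη
    (fun n ω => norm_unitRescale_le one_pos _) hη_lim
  refine ⟨σ, hσ, ?_⟩
  filter_upwards [hσlim] with ω hω
  simp only [hη_rep] at hω
  refine hω.congr' ?_
  filter_upwards [hω.norm.eventually_lt_const (by simp : ‖(0 : E)‖ < 1)] with n hn
  exact unitRescale_one_of_norm_le_one (norm_lt_of_norm_unitRescale_lt_one one_pos hn).le

end Canonical

/-! ### One period -/

section OnePeriod

lemma measurable_limUnder_atTop {E Ω : Type*} [TopologicalSpace E] [Nonempty E]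
    [TopologicalSpace.IsCompletelyMetrizableSpace E] [SecondCountableTopology E]
    [MeasurableSpace E] [BorelSpace E] {_ : MeasurableSpace Ω} {p : ℕ → Ω → E}
    (hp : ∀ n, Measurable (p n)) : Measurable fun ω => limUnder atTop fun n => p n ω :=
  (StronglyMeasurable.limUnder fun n => (hp n).stronglyMeasurable).measurable

lemma max_neg_le_smoothLoss (x : ℝ) : max (-x) 0 ≤ smoothLoss x :=
  max_le (by rw [smoothLoss]; linarith [Real.sqrt_nonneg (1 + x ^ 2)]) (smoothLoss_pos x).le

lemma integrable_smoothLoss_midpoint {Ω : Type*} {_ : MeasurableSpace Ω} {μ : Measure Ω}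
    {X Y : Ω → ℝ} (hX : Measurable X) (hY : Measurable Y)
    (hXi : Integrable (fun ω => smoothLoss (X ω)) μ)
    (hYi : Integrable (fun ω => smoothLoss (Y ω)) μ) :
    Integrable (fun ω => smoothLoss ((2⁻¹ : ℝ) • (X ω + Y ω))) μ := by
  refine (hXi.add hYi).mono' (by fun_prop) (.of_forall fun ω => ?_)
  have hdefect := midpointDefect_nonneg strictConvexOn_smoothLoss.convexOn (X ω) (Y ω)
  have hpos := smoothLoss_pos ((2⁻¹ : ℝ) • (X ω + Y ω))
  rw [midpointDefect] at hdefect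
  rw [Real.norm_of_nonneg hpos.le, Pi.add_apply]
  linarith

variable {E : Type*} [NormedAddCommGroup E] [InnerProductSpace ℝ E] [MeasurableSpace E] {Ω : Type*}
  {m mΩ : MeasurableSpace Ω} {μ : Measure Ω} {s : Ω → E} {M : ℝ}

/-- Absence of arbitrage for a single period with price increment `s` and information `m` at its
beginning. -/
def OnePeriodNoArbitrage (μ : Measure Ω) (m : MeasurableSpace Ω) (s : Ω → E) : Prop :=
  ∀ ξ : Ω → E, Measurable[m] ξ → (∀ᵐ ω ∂μ, 0 ≤ (inner ℝ (ξ ω) (s ω) : ℝ)) →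
    ∀ᵐ ω ∂μ, (inner ℝ (ξ ω) (s ω) : ℝ) = 0

lemma OnePeriodNoArbitrage.of_equivalent {ν : Measure Ω} (hNA : OnePeriodNoArbitrage μ m s)
    (hνμ : ν ≪ μ) (hμν : μ ≪ ν) : OnePeriodNoArbitrage ν m s :=
  fun ξ hξ h => hνμ.ae_le (hNA ξ hξ (hμν.ae_le h))

/-- The portfolios of norm at most one whose expected loss is at most `ε` and whose expected gain is
at least `δ`. -/
def unitPortfolios (m : MeasurableSpace Ω) {_ : MeasurableSpace Ω} (μ : Measure Ω) (s : Ω → E)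
    (ε δ : ℝ) : Set (Ω → E) :=
  {η | Measurable[m] η ∧ (∀ ω, ‖η ω‖ ≤ 1) ∧ ∫ ω, max (-inner ℝ (η ω) (s ω)) 0 ∂μ ≤ ε ∧
    δ ≤ ∫ ω, inner ℝ (η ω) (s ω) ∂μ}

lemma unitPortfolios_mono {ε ε' δ : ℝ} (h : ε ≤ ε') :
    unitPortfolios m μ s ε δ ⊆ unitPortfolios m μ s ε' δ :=
  fun _ ⟨hξ, hξ_norm, hξ_loss, hξ_mean⟩ => ⟨hξ, hξ_norm, hξ_loss.trans h, hξ_mean⟩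

lemma ae_abs_inner_le_of_mem_unitPortfolios (hM : ∀ᵐ ω ∂μ, ‖s ω‖ ≤ M) {ε δ : ℝ} {ξ : Ω → E}
    (hξ : ξ ∈ unitPortfolios m μ s ε δ) : ∀ᵐ ω ∂μ, |(inner ℝ (ξ ω) (s ω) : ℝ)| ≤ 1 * M := by
  filter_upwards [hM] with ω hω
  exact (abs_real_inner_le_norm _ _).trans
    (mul_le_mul (hξ.2.1 ω) hω (norm_nonneg _) zero_le_one)

variable [FiniteDimensional ℝ E] [BorelSpace E]

lemma exists_measurable_limit {p : ℕ → Ω → E} (hp : ∀ n, Measurable[m] (p n))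
    (h : ∀ᵐ ω ∂μ, ∃ l, Tendsto (fun n => p n ω) atTop (nhds l)) :
    ∃ ζ : Ω → E, Measurable[m] ζ ∧ ∀ᵐ ω ∂μ, Tendsto (fun n => p n ω) atTop (nhds (ζ ω)) :=
  ⟨fun ω => limUnder atTop fun n => p n ω, measurable_limUnder_atTop hp,
    h.mono fun _ hω => tendsto_nhds_limUnder hω⟩

variable [IsFiniteMeasure μ]

lemma cauchyInMeasure_canonicalRep (hm : m ≤ mΩ) (hs : Measurable s)
    (hM : ∀ᵐ ω ∂μ, ‖s ω‖ ≤ M) {ξ : ℕ → Ω → E} (hξ : ∀ n, Measurable[m] (ξ n))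
    (h : ∀ᵐ ω ∂μ, ∃ l : ℝ, Tendsto (fun n => (inner ℝ (ξ n ω) (s ω) : ℝ)) atTop (nhds l)) :
    CauchyInMeasure μ fun n ω => canonicalRep m μ s ω (ξ n ω) := by
  intro ε hε
  refine ENNReal.tendsto_nhds_zero.2 fun δ hδ => ?_
  by_contra hcon
  rw [← prod_atTop_atTop_eq, (atTop_basis.prod_self).eventually_iff] at hcon
  push Not at hcon
  choose q hq hqδ using fun N => hcon N trivial
  have hgain : ∀ᵐ ω ∂μ,
      Tendsto (fun N => (inner ℝ (ξ (q N).1 ω - ξ (q N).2 ω) (s ω) : ℝ)) atTop (nhds 0) := by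
    filter_upwards [h] with ω ⟨l, hl⟩
    simpa [Function.comp_def, inner_sub_left] using
      (hl.comp (tendsto_atTop_mono (fun N => (hq N).1) tendsto_id)).sub
        (hl.comp (tendsto_atTop_mono (fun N => (hq N).2) tendsto_id))
  obtain ⟨τ, -, hτ⟩ := exists_subseq_canonicalRep_tendsto_zero hm hs hM
    (fun N => (hξ (q N).1).sub (hξ (q N).2)) hgain
  have hmeasure := tendstoInMeasure_of_tendsto_ae (fun n => ((measurable_canonicalRep (μ := μ) s
    ((hξ (q (τ n)).1).sub (hξ (q (τ n)).2))).mono hm le_rfl).aestronglyMeasurable) hτ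
  rw [tendstoInMeasure_iff_norm] at hmeasure
  obtain ⟨n, hn⟩ := ((hmeasure ε hε).eventually_lt_const hδ).exists
  refine hn.not_gt ?_
  simpa only [Pi.sub_apply, sub_zero, map_sub] using hqδ (τ n)

lemma exists_subseq_canonicalRep_tendsto (hm : m ≤ mΩ) (hs : Measurable s)
    (hM : ∀ᵐ ω ∂μ, ‖s ω‖ ≤ M) {ξ : ℕ → Ω → E} (hξ : ∀ n, Measurable[m] (ξ n))
    (h : ∀ᵐ ω ∂μ, ∃ l : ℝ, Tendsto (fun n => (inner ℝ (ξ n ω) (s ω) : ℝ)) atTop (nhds l)) :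
    ∃ σ : ℕ → ℕ, StrictMono σ ∧ ∃ ζ : Ω → E, Measurable[m] ζ ∧
      ∀ᵐ ω ∂μ, Tendsto (fun n => canonicalRep m μ s ω (ξ (σ n) ω)) atTop (nhds (ζ ω)) := by
  obtain ⟨σ, hσ, hlim⟩ := exists_subseq_tendsto_of_cauchyInMeasure fun _ : Unit =>
    cauchyInMeasure_canonicalRep hm hs hM hξ h
  exact ⟨σ, hσ, exists_measurable_limit (fun n => measurable_canonicalRep s (hξ (σ n)))
    (hlim.mono fun ω hω => hω ())⟩

lemma exists_subseq_inner_tendsto (hm : m ≤ mΩ) (hs : Measurable s)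
    (hM : ∀ᵐ ω ∂μ, ‖s ω‖ ≤ M) {ξ : ℕ → Ω → E} (hξ : ∀ n, Measurable[m] (ξ n))
    (h : ∀ᵐ ω ∂μ, ∃ l : ℝ, Tendsto (fun n => (inner ℝ (ξ n ω) (s ω) : ℝ)) atTop (nhds l)) :
    ∃ σ : ℕ → ℕ, StrictMono σ ∧ ∃ ζ : Ω → E, Measurable[m] ζ ∧
      ∀ᵐ ω ∂μ, Tendsto (fun n => (inner ℝ (ξ (σ n) ω) (s ω) : ℝ)) atTop
        (nhds (inner ℝ (ζ ω) (s ω))) := by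
  obtain ⟨σ, hσ, ζ, hζ, hlim⟩ := exists_subseq_canonicalRep_tendsto hm hs hM hξ h
  refine ⟨σ, hσ, ζ, hζ, ?_⟩
  filter_upwards [hlim, inner_canonicalRep hm hs hM] with ω hω hrep
  exact (hω.inner tendsto_const_nhds).congr fun n => hrep _

lemma convex_unitPortfolios (hm : m ≤ mΩ) (hs : Measurable s) (hM : ∀ᵐ ω ∂μ, ‖s ω‖ ≤ M)
    (ε δ : ℝ) : Convex ℝ (unitPortfolios m μ s ε δ) := by
  rintro v ⟨hv, hv_norm, hv_loss, hv_mean⟩ w ⟨hw, hw_norm, hw_loss, hw_mean⟩ a b ha hb hab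
  have hv_int := integrable_inner hm hs hM hv hv_norm
  have hw_int := integrable_inner hm hs hM hw hw_norm
  have hinner (ω : Ω) : (inner ℝ ((a • v + b • w) ω) (s ω) : ℝ) =
      a * inner ℝ (v ω) (s ω) + b * inner ℝ (w ω) (s ω) := by
    simp only [Pi.add_apply, Pi.smul_apply, inner_add_left, real_inner_smul_left]
  have hloss (x y : ℝ) : max (-(a * x + b * y)) 0 ≤ a * max (-x) 0 + b * max (-y) 0 := by
    refine max_le ?_ (by positivity)
    nlinarith [mul_le_mul_of_nonneg_left (le_max_left (-x) 0) ha,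
      mul_le_mul_of_nonneg_left (le_max_left (-y) 0) hb]
  refine ⟨(hv.const_smul a).add (hw.const_smul b), fun ω => ?_, ?_, ?_⟩
  · simpa using convex_closedBall (0 : E) 1 (by simpa using hv_norm ω)
      (by simpa using hw_norm ω) ha hb hab
  · simp only [hinner]
    have hv_part : Integrable (fun ω => a * max (-inner ℝ (v ω) (s ω)) 0) μ :=
      hv_int.neg.pos_part.const_mul a
    have hw_part : Integrable (fun ω => b * max (-inner ℝ (w ω) (s ω)) 0) μ :=
      hw_int.neg.pos_part.const_mul b
    calc ∫ ω, max (-(a * inner ℝ (v ω) (s ω) + b * inner ℝ (w ω) (s ω))) 0 ∂μ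
        ≤ ∫ ω, (a * max (-inner ℝ (v ω) (s ω)) 0 + b * max (-inner ℝ (w ω) (s ω)) 0) ∂μ :=
          integral_mono (((hv_int.const_mul a).add (hw_int.const_mul b)).neg.pos_part)
            (hv_part.add hw_part) fun ω => hloss _ _
      _ = a * ∫ ω, max (-inner ℝ (v ω) (s ω)) 0 ∂μ +
            b * ∫ ω, max (-inner ℝ (w ω) (s ω)) 0 ∂μ := by
          rw [integral_add hv_part hw_part, integral_const_mul, integral_const_mul]
      _ ≤ ε := convex_Iic ε hv_loss hw_loss ha hb hab
  · simp only [hinner]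
    rw [integral_add (hv_int.const_mul a) (hw_int.const_mul b), integral_const_mul,
      integral_const_mul]
    exact convex_Ici δ hv_mean hw_mean ha hb hab

lemma exists_unitPortfolios_inner_tendsto (hm : m ≤ mΩ) (hs : Measurable s)
    (hM : ∀ᵐ ω ∂μ, ‖s ω‖ ≤ M) {δ : ℝ} (hne : ∀ ε > 0, (unitPortfolios m μ s ε δ).Nonempty) :
    ∃ y : ℕ → Ω → E, (∀ n : ℕ, y n ∈ unitPortfolios m μ s (1 / ((n : ℝ) + 1)) δ) ∧
      ∃ ζ : Ω → E, Measurable[m] ζ ∧ ∀ᵐ ω ∂μ,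
        Tendsto (fun n => (inner ℝ (y n ω) (s ω) : ℝ)) atTop (nhds (inner ℝ (ζ ω) (s ω))) := by
  choose η hη using fun n : ℕ => hne (1 / ((n : ℝ) + 1)) (by positivity)
  let L : (Ω → E) →ₗ[ℝ] (Unit → Ω → ℝ) :=
    { toFun ξ _ ω := inner ℝ (ξ ω) (s ω)
      map_add' _ _ := by ext; exact inner_add_left _ _ _
      map_smul' _ _ := by ext; exact real_inner_smul_left _ _ _ }
  have hgain (ξ) (hξ : ξ ∈ unitPortfolios m μ s (1 / ((0 : ℕ) + 1)) δ) :
      Integrable (fun ω => (inner ℝ (ξ ω) (s ω) : ℝ)) μ := integrable_inner hm hs hM hξ.1 hξ.2.1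
  obtain ⟨y, hy, hylim⟩ := exists_convexHull_tendsto_ae L
    (convex_unitPortfolios hm hs hM (1 / ((0 : ℕ) + 1)) δ)
    (fun n => unitPortfolios_mono (Nat.one_div_le_one_div n.zero_le) (hη n))
    (fun ξ hξ _ => hgain ξ hξ)
    (fun ξ hξ _ => integral_mono_ae (hgain ξ hξ).abs (integrable_const (1 * M))
      (ae_abs_inner_le_of_mem_unitPortfolios hM hξ))
  have hyC (n : ℕ) : y n ∈ unitPortfolios m μ s (1 / ((n : ℝ) + 1)) δ := by
    refine convexHull_min ?_ (convex_unitPortfolios hm hs hM _ δ) (hy n)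
    rintro _ ⟨k, hk, rfl⟩
    exact unitPortfolios_mono (Nat.one_div_le_one_div hk) (hη k)
  obtain ⟨σ, hσ, ζ, hζ, hlim⟩ := exists_subseq_inner_tendsto hm hs hM (fun n => (hyC n).1)
    (hylim.mono fun ω hω => hω ())
  exact ⟨y ∘ σ, fun n => unitPortfolios_mono (Nat.one_div_le_one_div (hσ.le_apply)) (hyC (σ n)),
    ζ, hζ, hlim⟩

lemma OnePeriodNoArbitrage.exists_pos_unitPortfolios_eq_empty (hNA : OnePeriodNoArbitrage μ m s)
    (hm : m ≤ mΩ) (hs : Measurable s) (hM : ∀ᵐ ω ∂μ, ‖s ω‖ ≤ M) {δ : ℝ} (hδ : 0 < δ) :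
    ∃ ε > 0, unitPortfolios m μ s ε δ = ∅ := by
  by_contra! hne
  obtain ⟨y, hy, ζ, hζ, hlim⟩ := exists_unitPortfolios_inner_tendsto hm hs hM hne
  have hgain (n : ℕ) : Integrable (fun ω => (inner ℝ (y n ω) (s ω) : ℝ)) μ :=
    integrable_inner hm hs hM (hy n).1 (hy n).2.1
  have hbound (n : ℕ) := ae_abs_inner_le_of_mem_unitPortfolios hM (hy n)
  have hζ_int : Integrable (fun ω => (inner ℝ (ζ ω) (s ω) : ℝ)) μ := by
    refine Integrable.of_bound ((hζ.mono hm le_rfl).inner hs).aestronglyMeasurable (1 * M) ?_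
    filter_upwards [ae_all_iff.2 hbound, hlim] with ω hω hlimω
    exact le_of_tendsto' hlimω.norm hω
  have hmean : Tendsto (fun n => ∫ ω, inner ℝ (y n ω) (s ω) ∂μ) atTop
      (nhds (∫ ω, inner ℝ (ζ ω) (s ω) ∂μ)) :=
    tendsto_integral_of_dominated_convergence (fun _ => 1 * M) (fun n => (hgain n).1)
      (integrable_const _) hbound hlim
  have hloss : Tendsto (fun n => ∫ ω, max (-inner ℝ (y n ω) (s ω)) 0 ∂μ) atTop
      (nhds (∫ ω, max (-inner ℝ (ζ ω) (s ω)) 0 ∂μ)) := by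
    refine tendsto_integral_of_dominated_convergence (fun _ => 1 * M)
      (fun n => (hgain n).neg.pos_part.1) (integrable_const _) (fun n => ?_)
      (hlim.mono fun ω hω => hω.neg.max tendsto_const_nhds)
    filter_upwards [hbound n] with ω hω
    rw [Real.norm_of_nonneg (le_max_right _ _)]
    exact (max_le (neg_le_abs _) (abs_nonneg _)).trans hω
  have hζ_loss : ∫ ω, max (-inner ℝ (ζ ω) (s ω)) 0 ∂μ = 0 :=
    le_antisymm (le_of_tendsto_of_tendsto' hloss tendsto_one_div_add_atTop_nhds_zero_nat
      fun n => (hy n).2.2.1) (integral_nonneg fun ω => le_max_right _ _)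
  have hζ_nonneg : ∀ᵐ ω ∂μ, 0 ≤ (inner ℝ (ζ ω) (s ω) : ℝ) := by
    filter_upwards [(integral_eq_zero_iff_of_nonneg (fun ω => le_max_right _ _)
      hζ_int.neg.pos_part).1 hζ_loss] with ω hω
    exact neg_nonpos.1 (max_eq_right_iff.1 hω)
  have hδ_le : δ ≤ ∫ ω, inner ℝ (ζ ω) (s ω) ∂μ := ge_of_tendsto' hmean fun n => (hy n).2.2.2
  rw [integral_eq_zero_of_ae (hNA ζ hζ hζ_nonneg)] at hδ_le
  exact hδ.not_ge hδ_le

lemma OnePeriodNoArbitrage.tendsto_integral_abs_inner (hNA : OnePeriodNoArbitrage μ m s)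
    (hm : m ≤ mΩ) (hs : Measurable s) (hM : ∀ᵐ ω ∂μ, ‖s ω‖ ≤ M) {η : ℕ → Ω → E}
    (hη : ∀ n, Measurable[m] (η n)) (hη_norm : ∀ n ω, ‖η n ω‖ ≤ 1)
    (hlim : Tendsto (fun n => ∫ ω, max (-inner ℝ (η n ω) (s ω)) 0 ∂μ) atTop (nhds 0)) :
    Tendsto (fun n => ∫ ω, |inner ℝ (η n ω) (s ω)| ∂μ) atTop (nhds 0) := by
  have hgain (n : ℕ) : Integrable (fun ω => (inner ℝ (η n ω) (s ω) : ℝ)) μ :=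
    integrable_inner hm hs hM (hη n) (hη_norm n)
  have hloss (n : ℕ) : Integrable (fun ω => 2 * max (-inner ℝ (η n ω) (s ω)) 0) μ :=
    (hgain n).neg.pos_part.const_mul 2
  have habs (n : ℕ) : ∫ ω, |inner ℝ (η n ω) (s ω)| ∂μ = ∫ ω, inner ℝ (η n ω) (s ω) ∂μ +
      2 * ∫ ω, max (-inner ℝ (η n ω) (s ω)) 0 ∂μ := by
    rw [← integral_const_mul, ← integral_add (hgain n) (hloss n)]
    refine integral_congr_ae (.of_forall fun ω => ?_)
    grind [abs_eq_max_neg]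
  refine tendsto_order.2 ⟨fun δ hδ => .of_forall fun n =>
    hδ.trans_le (integral_nonneg fun ω => abs_nonneg _), fun δ hδ => ?_⟩
  obtain ⟨ε, hε, hempty⟩ := hNA.exists_pos_unitPortfolios_eq_empty hm hs hM (half_pos hδ)
  filter_upwards [hlim.eventually_lt_const hε,
    hlim.eventually_lt_const (by positivity : 0 < δ / 4)] with n hnε hnδ
  have hmean : ∫ ω, inner ℝ (η n ω) (s ω) ∂μ < δ / 2 := by
    by_contra! hcon
    exact hempty.subset (⟨hη n, hη_norm n, hnε.le, hcon⟩ : η n ∈ unitPortfolios m μ s ε (δ / 2))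
  linarith [habs n]

lemma tendsto_integral_max_neg_inner_unitRescale (hm : m ≤ mΩ) (hs : Measurable s)
    (hM : ∀ᵐ ω ∂μ, ‖s ω‖ ≤ M) {ξ : ℕ → Ω → E} (hξ : ∀ n, Measurable[m] (ξ n)) {K : ℝ}
    (hint : ∀ n, Integrable (fun ω => max (-inner ℝ (ξ n ω) (s ω)) 0) μ)
    (hK : ∀ n, ∫ ω, max (-inner ℝ (ξ n ω) (s ω)) 0 ∂μ ≤ K) :
    Tendsto (fun n : ℕ => ∫ ω, max (-inner ℝ (unitRescale (n + 1) (ξ n ω)) (s ω)) 0 ∂μ) atTop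
      (nhds 0) := by
  have hr (n : ℕ) : (0 : ℝ) < n + 1 := by positivity
  refine squeeze_zero (g := fun n : ℕ => 1 / ((n : ℝ) + 1) * K)
    (fun n => integral_nonneg fun ω => le_max_right _ _) (fun n => ?_)
    (by simpa using tendsto_one_div_add_atTop_nhds_zero_nat.mul_const K)
  have hscaled : Integrable (fun ω => (inner ℝ (unitRescale (n + 1) (ξ n ω)) (s ω) : ℝ)) μ :=
    integrable_inner hm hs hM ((measurable_unitRescale _).comp (hξ n))
      fun ω => norm_unitRescale_le (hr n) _
  calc ∫ ω, max (-inner ℝ (unitRescale (n + 1) (ξ n ω)) (s ω)) 0 ∂μ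
    _ ≤ ∫ ω, 1 / ((n : ℝ) + 1) * max (-inner ℝ (ξ n ω) (s ω)) 0 ∂μ :=
      integral_mono hscaled.neg.pos_part ((hint n).const_mul _) fun ω =>
        max_neg_inner_unitRescale_le (hr n) _ _
    _ ≤ 1 / ((n : ℝ) + 1) * K := by
      rw [integral_const_mul]
      gcongr
      exact hK n

lemma OnePeriodNoArbitrage.boundedInMeasure_canonicalRep {ι : Type*}
    (hNA : OnePeriodNoArbitrage μ m s) (hm : m ≤ mΩ) (hs : Measurable s)
    (hM : ∀ᵐ ω ∂μ, ‖s ω‖ ≤ M) {ξ : ι → Ω → E} (hξ : ∀ i, Measurable[m] (ξ i)) {K : ℝ}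
    (hint : ∀ i, Integrable (fun ω => max (-inner ℝ (ξ i ω) (s ω)) 0) μ)
    (hK : ∀ i, ∫ ω, max (-inner ℝ (ξ i ω) (s ω)) 0 ∂μ ≤ K) :
    BoundedInMeasure μ fun i ω => canonicalRep m μ s ω (ξ i ω) := by
  intro ε hε
  by_contra! hcon
  choose i hi using fun n : ℕ => hcon ((n : ℝ) + 1)
  have hr (n : ℕ) : (0 : ℝ) < n + 1 := by positivity
  have hrep (n : ℕ) : (fun ω => max (-inner ℝ (ξ (i n) ω) (s ω)) 0) =ᵐ[μ]
      fun ω => max (-inner ℝ (canonicalRep m μ s ω (ξ (i n) ω)) (s ω)) 0 := by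
    filter_upwards [inner_canonicalRep hm hs hM] with ω hω
    rw [hω]
  have hmeas (n : ℕ) : Measurable[m] fun ω => canonicalRep m μ s ω (ξ (i n) ω) :=
    measurable_canonicalRep s (hξ (i n))
  -- Rescaling the portfolios to the unit ball makes their expected losses vanish.
  let η (n : ℕ) (ω : Ω) : E := unitRescale (n + 1) (canonicalRep m μ s ω (ξ (i n) ω))
  have hη (n : ℕ) : Measurable[m] (η n) := (measurable_unitRescale _).comp (hmeas n)
  have hη_norm (n : ℕ) (ω : Ω) : ‖η n ω‖ ≤ 1 := norm_unitRescale_le (hr n) _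
  have hη_rep (n : ℕ) (ω : Ω) : canonicalRep m μ s ω (η n ω) = η n ω := by
    simp only [η, unitRescale, map_smul, canonicalRep_canonicalRep]
  have hη_lim := tendsto_integral_max_neg_inner_unitRescale hm hs hM hmeas
    (fun n => (hint (i n)).congr (hrep n))
    fun n => (integral_congr_ae (hrep n)).symm.trans_le (hK (i n))
  obtain ⟨σ, -, hσ⟩ := exists_subseq_canonicalRep_tendsto_zero_of_bounded hm hs hM hη hη_norm
    (hNA.tendsto_integral_abs_inner hm hs hM hη hη_norm hη_lim)
  simp only [hη_rep] at hσ
  have hmeasure := tendstoInMeasure_of_tendsto_ae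
    (fun n => ((hη (σ n)).mono hm le_rfl).aestronglyMeasurable) hσ
  rw [tendstoInMeasure_iff_norm] at hmeasure
  obtain ⟨n, hn⟩ := ((hmeasure 1 one_pos).eventually_lt_const hε).exists
  refine hn.not_ge ((hi (σ n)).le.trans (measure_mono fun ω hω => ?_))
  rw [mem_ofPred_eq, sub_zero]
  by_contra! hlt
  exact (norm_lt_of_norm_unitRescale_lt_one (hr _) hlt).not_gt hω

/-- The portfolios whose gain has a finite expected loss. -/
def lossPortfolios (m : MeasurableSpace Ω) {_ : MeasurableSpace Ω} (μ : Measure Ω) (s : Ω → E) :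
    Set (Ω → E) :=
  {ξ | Measurable[m] ξ ∧ Integrable (fun ω => smoothLoss (inner ℝ (ξ ω) (s ω))) μ}

/-- The expected loss `E(√(1 + g²) - g)` of the gain `g = ⟨ξ, s⟩`. -/
def expectedLoss {_ : MeasurableSpace Ω} (μ : Measure Ω) (s : Ω → E) (ξ : Ω → E) : ℝ :=
  ∫ ω, smoothLoss (inner ℝ (ξ ω) (s ω)) ∂μ

lemma OnePeriodNoArbitrage.boundedInMeasure_inner {ι : Type*} (hNA : OnePeriodNoArbitrage μ m s)
    (hm : m ≤ mΩ) (hs : Measurable s) (hM : ∀ᵐ ω ∂μ, ‖s ω‖ ≤ M) {ξ : ι → Ω → E} {K : ℝ}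
    (hξ : ∀ i, ξ i ∈ lossPortfolios m μ s) (hK : ∀ i, expectedLoss μ s (ξ i) ≤ K) :
    BoundedInMeasure μ fun i ω => (inner ℝ (ξ i ω) (s ω) : ℝ) := by
  have hloss (i : ι) : Integrable (fun ω => max (-inner ℝ (ξ i ω) (s ω)) 0) μ := by
    refine (hξ i).2.mono' ((((hξ i).1.mono hm le_rfl).inner hs).neg.max
      measurable_const).aestronglyMeasurable (.of_forall fun ω => ?_)
    rw [Real.norm_of_nonneg (le_max_right _ _)]
    exact max_neg_le_smoothLoss _
  intro ε hε
  obtain ⟨a, ha⟩ := hNA.boundedInMeasure_canonicalRep hm hs hM (fun i => (hξ i).1) hloss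
    (fun i => (integral_mono (hloss i) (hξ i).2 fun ω => max_neg_le_smoothLoss _).trans (hK i))
    ε hε
  refine ⟨max a 0 * M, fun i => le_trans (measure_mono_ae ?_) (ha i)⟩
  filter_upwards [hM, inner_canonicalRep hm hs hM] with ω hω hrep
  intro (hlt : max a 0 * M < ‖(inner ℝ (ξ i ω) (s ω) : ℝ)‖)
  change a < ‖canonicalRep m μ s ω (ξ i ω)‖
  by_contra! hle
  rw [← hrep] at hlt
  exact hlt.not_ge <| (norm_inner_le_norm _ _).trans <|
    mul_le_mul (hle.trans (le_max_left _ _)) hω (norm_nonneg _) (le_max_right _ _)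

/-- Gains of a sequence of portfolios minimising a strictly convex loss are Cauchy, because the loss
of the midpoints cannot fall below the infimum. -/
lemma OnePeriodNoArbitrage.cauchyInMeasure_inner (hNA : OnePeriodNoArbitrage μ m s) (hm : m ≤ mΩ)
    (hs : Measurable s) (hM : ∀ᵐ ω ∂μ, ‖s ω‖ ≤ M) {ξ : ℕ → Ω → E} {I : ℝ}
    (hξ : ∀ n, ξ n ∈ lossPortfolios m μ s)
    (hlim : Tendsto (fun n => expectedLoss μ s (ξ n)) atTop (nhds I))
    (hI : ∀ η ∈ lossPortfolios m μ s, I ≤ expectedLoss μ s η) :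
    CauchyInMeasure μ fun n ω => (inner ℝ (ξ n ω) (s ω) : ℝ) := by
  obtain ⟨K, hK⟩ := hlim.bddAbove_range
  have hmeas (n : ℕ) : Measurable fun ω => (inner ℝ (ξ n ω) (s ω) : ℝ) :=
    ((hξ n).1.mono hm le_rfl).inner hs
  refine cauchyInMeasure_of_midpointDefect strictConvexOn_smoothLoss
    (hNA.boundedInMeasure_inner hm hs hM hξ fun n => hK (mem_range_self n))
    (fun n k => integrable_midpointDefect (hξ n).2 (hξ k).2
      (integrable_smoothLoss_midpoint (hmeas n) (hmeas k) (hξ n).2 (hξ k).2)) ?_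
  have hsum : Tendsto (fun q : ℕ × ℕ => expectedLoss μ s (ξ q.1) + expectedLoss μ s (ξ q.2) -
      2 * I) atTop (nhds 0) := by
    rw [← prod_atTop_atTop_eq]
    have := ((hlim.comp tendsto_fst).add (hlim.comp tendsto_snd)).sub_const (2 * I)
    rwa [← two_mul, sub_self] at this
  refine squeeze_zero (fun q => integral_nonneg fun ω =>
    midpointDefect_nonneg strictConvexOn_smoothLoss.convexOn _ _) (fun q => ?_) hsum
  have hmid := integrable_smoothLoss_midpoint (hmeas q.1) (hmeas q.2) (hξ q.1).2 (hξ q.2).2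
  have hinner (ω : Ω) : (inner ℝ (((2⁻¹ : ℝ) • (ξ q.1 + ξ q.2)) ω) (s ω) : ℝ) =
      (2⁻¹ : ℝ) • (inner ℝ (ξ q.1 ω) (s ω) + inner ℝ (ξ q.2 ω) (s ω)) := by
    simp only [Pi.smul_apply, Pi.add_apply, real_inner_smul_left, inner_add_left, smul_eq_mul]
  have hle := hI ((2⁻¹ : ℝ) • (ξ q.1 + ξ q.2))
    ⟨((hξ q.1).1.add (hξ q.2).1).const_smul 2⁻¹, by simpa only [hinner] using hmid⟩
  simp only [expectedLoss, hinner] at hle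
  rw [integral_midpointDefect (hξ q.1).2 (hξ q.2).2 hmid]
  exact sub_le_sub_left (mul_le_mul_of_nonneg_left hle zero_le_two) _

theorem OnePeriodNoArbitrage.exists_minimizer (hNA : OnePeriodNoArbitrage μ m s) (hm : m ≤ mΩ)
    (hs : Measurable s) (hM : ∀ᵐ ω ∂μ, ‖s ω‖ ≤ M) :
    ∃ ζ ∈ lossPortfolios m μ s, ∀ ξ ∈ lossPortfolios m μ s,
      expectedLoss μ s ζ ≤ expectedLoss μ s ξ := by
  have hne : (expectedLoss μ s '' lossPortfolios m μ s).Nonempty :=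
    ⟨_, fun _ => 0, ⟨measurable_const, by simp⟩, rfl⟩
  have hbdd : BddBelow (expectedLoss μ s '' lossPortfolios m μ s) :=
    ⟨0, by rintro _ ⟨ξ, -, rfl⟩; exact integral_nonneg fun ω => (smoothLoss_pos _).le⟩
  obtain ⟨u, -, hu, hmem⟩ := exists_seq_tendsto_sInf hne hbdd
  choose ξ hξ hξu using hmem
  obtain rfl : (fun n => expectedLoss μ s (ξ n)) = u := funext hξu
  have hI (η) (hη : η ∈ lossPortfolios m μ s) := csInf_le hbdd ⟨η, hη, rfl⟩
  obtain ⟨σ, hσ, hlim⟩ := exists_subseq_tendsto_of_cauchyInMeasure fun _ : Unit =>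
    hNA.cauchyInMeasure_inner hm hs hM hξ hu hI
  obtain ⟨τ, hτ, ζ, hζ, hζlim⟩ := exists_subseq_inner_tendsto hm hs hM (fun n => (hξ (σ n)).1)
    (hlim.mono fun ω hω => hω ())
  obtain ⟨hζint, hζle⟩ := integrable_of_tendsto_of_nonneg (fun n => (hξ (σ (τ n))).2)
    (fun n ω => (smoothLoss_pos _).le)
    (hζlim.mono fun ω hω => (continuous_smoothLoss.tendsto _).comp hω)
    (fun n => le_rfl) (hu.comp (hσ.comp hτ).tendsto_atTop)
  exact ⟨ζ, ⟨hζ, hζint⟩, fun η hη => hζle.trans (hI η hη)⟩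

end OnePeriod

/-! ### Centering measures -/

section CenteringDensity

lemma integral_withDensity_ofReal {Ω : Type*} {_ : MeasurableSpace Ω} {μ : Measure Ω} {z : Ω → ℝ}
    (hz : Measurable z) (hpos : ∀ ω, 0 ≤ z ω) (g : Ω → ℝ) :
    ∫ ω, g ω ∂μ.withDensity (fun ω => ENNReal.ofReal (z ω)) = ∫ ω, z ω * g ω ∂μ := by
  rw [integral_withDensity_eq_integral_toReal_smul hz.ennreal_ofReal
    (.of_forall fun ω => ENNReal.ofReal_lt_top)]
  simp only [ENNReal.toReal_ofReal (hpos _), smul_eq_mul]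

section Loss

variable {Ω : Type*} {mΩ : MeasurableSpace Ω} {μ : Measure Ω} [IsFiniteMeasure μ] {X W : Ω → ℝ}
  {B : ℝ}

lemma integrable_smoothLoss_add_mul (hX : Measurable X) (hW : Measurable W)
    (hXi : Integrable (fun ω => smoothLoss (X ω)) μ) (hWB : ∀ᵐ ω ∂μ, |W ω| ≤ B) (t : ℝ) :
    Integrable (fun ω => smoothLoss (X ω + t * W ω)) μ := by
  refine (hXi.add (integrable_const (2 * (|t| * B)))).mono' (by fun_prop) ?_
  filter_upwards [hWB] with ω hω
  rw [Real.norm_of_nonneg (smoothLoss_pos _).le]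
  refine (smoothLoss_add_le _ _).trans ?_
  rw [abs_mul, Pi.add_apply]
  gcongr

lemma hasDerivAt_integral_smoothLoss (hX : Measurable X) (hW : Measurable W)
    (hXi : Integrable (fun ω => smoothLoss (X ω)) μ) (hWB : ∀ᵐ ω ∂μ, |W ω| ≤ B) :
    HasDerivAt (fun t : ℝ => ∫ ω, smoothLoss (X ω + t * W ω) ∂μ)
      (∫ ω, (X ω / √(1 + X ω ^ 2) - 1) * W ω ∂μ) 0 := by
  have hslope (x : ℝ) : |x / √(1 + x ^ 2) - 1| ≤ 2 := by
    have := abs_lt.1 (abs_div_sqrt_one_add_sq_lt_one x)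
    exact abs_le.2 ⟨by linarith, by linarith⟩
  have hline (ω : Ω) (t : ℝ) : HasDerivAt (fun t : ℝ => X ω + t * W ω) (W ω) t := by
    simpa using ((hasDerivAt_id t).mul_const (W ω)).const_add (X ω)
  have hderiv := (hasDerivAt_integral_of_dominated_loc_of_deriv_le (μ := μ)
    (F := fun t ω => smoothLoss (X ω + t * W ω)) (x₀ := (0 : ℝ)) (s := univ)
    (F' := fun t ω => ((X ω + t * W ω) / √(1 + (X ω + t * W ω) ^ 2) - 1) * W ω)
    (bound := fun _ => 2 * B) univ_mem
    (.of_forall fun t => (integrable_smoothLoss_add_mul hX hW hXi hWB t).1)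
    (integrable_smoothLoss_add_mul hX hW hXi hWB 0) (by fun_prop)
    (hWB.mono fun ω hω t _ => by
      rw [Real.norm_eq_abs, abs_mul]
      exact mul_le_mul (hslope _) hω (abs_nonneg _) zero_le_two) (integrable_const _)
    (.of_forall fun ω t _ => (hasDerivAt_smoothLoss _).comp t (hline ω t))).2
  simpa only [zero_mul, add_zero] using hderiv

end Loss

variable {E : Type*} [NormedAddCommGroup E] [InnerProductSpace ℝ E] [FiniteDimensional ℝ E]
  [MeasurableSpace E] [BorelSpace E] {Ω : Type*} {m m' mΩ : MeasurableSpace Ω} {μ : Measure Ω}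
  {s : Ω → E} {M : ℝ}

lemma CentersGains.withDensity {z : Ω → ℝ} {K : ℝ} (hμ : CentersGains μ m s) (hm : m ≤ mΩ)
    (hz : Measurable[m] z) (hpos : ∀ ω, 0 ≤ z ω) (hzK : ∀ ω, z ω ≤ K) :
    CentersGains (μ.withDensity fun ω => ENNReal.ofReal (z ω)) m s := by
  rintro ξ hξ ⟨B, hB⟩
  rw [integral_withDensity_ofReal (hz.mono hm le_rfl) hpos]
  simp only [← real_inner_smul_left]
  refine hμ (fun ω => z ω • ξ ω) (hz.smul hξ) ⟨K * B, fun ω => ?_⟩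
  rw [norm_smul, Real.norm_of_nonneg (hpos ω)]
  exact mul_le_mul (hzK ω) (hB ω) (norm_nonneg _) ((hpos ω).trans (hzK ω))

variable [IsFiniteMeasure μ]

/-- The density is `-f'(⟨ζ, s⟩)` for the loss function `f(x) = √(1 + x²) - x` and the minimiser `ζ`
of the expected loss: it is positive because `f' < 0`, and centers all gains by the first-order
condition. -/
theorem OnePeriodNoArbitrage.exists_centering_density (hNA : OnePeriodNoArbitrage μ m s)
    (hm : m ≤ m') (hm' : m' ≤ mΩ) (hs : Measurable[m'] s) (hM : ∀ᵐ ω ∂μ, ‖s ω‖ ≤ M) :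
    ∃ z : Ω → ℝ, Measurable[m'] z ∧ (∀ ω, 0 < z ω) ∧ (∀ ω, z ω ≤ 2) ∧
      CentersGains (μ.withDensity fun ω => ENNReal.ofReal (z ω)) m s := by
  have hs' : Measurable s := hs.mono hm' le_rfl
  have hmΩ : m ≤ mΩ := hm.trans hm'
  obtain ⟨ζ, hζ, hmin⟩ := hNA.exists_minimizer hmΩ hs' hM
  set X : Ω → ℝ := fun ω => inner ℝ (ζ ω) (s ω)
  have hX : Measurable[m'] X := Measurable.inner (hζ.1.mono hm le_rfl) hs
  have hslope : Measurable fun x : ℝ => x / √(1 + x ^ 2) := by fun_prop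
  have habs (ω : Ω) := abs_lt.1 (abs_div_sqrt_one_add_sq_lt_one (X ω))
  have hz : Measurable[m'] fun ω => 1 - X ω / √(1 + X ω ^ 2) :=
    measurable_const.sub (hslope.comp hX)
  have hpos (ω : Ω) : 0 < 1 - X ω / √(1 + X ω ^ 2) := sub_pos.2 (habs ω).2
  refine ⟨_, hz, hpos, fun ω => by linarith [(habs ω).1], ?_⟩
  rintro ξ hξ ⟨B, hB⟩
  rw [integral_withDensity_ofReal (hz.mono hm' le_rfl) fun ω => (hpos ω).le]
  have hW : Measurable fun ω => (inner ℝ (ξ ω) (s ω) : ℝ) := (hξ.mono hmΩ le_rfl).inner hs'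
  have hWB : ∀ᵐ ω ∂μ, |(inner ℝ (ξ ω) (s ω) : ℝ)| ≤ B * M := by
    filter_upwards [hM] with ω hω
    exact (abs_real_inner_le_norm _ _).trans
      (mul_le_mul (hB ω) hω (norm_nonneg _) ((norm_nonneg _).trans (hB ω)))
  have hX' : Measurable X := hX.mono hm' le_rfl
  have hgain (t : ℝ) (ω : Ω) :
      (inner ℝ ((ζ + t • ξ) ω) (s ω) : ℝ) = X ω + t * inner ℝ (ξ ω) (s ω) := by
    simp only [X, Pi.add_apply, Pi.smul_apply, inner_add_left, real_inner_smul_left]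
  have hlocal : IsLocalMin (fun t : ℝ => ∫ ω, smoothLoss (X ω + t * inner ℝ (ξ ω) (s ω)) ∂μ) 0 := by
    refine .of_forall fun t => ?_
    have hle := hmin (ζ + t • ξ) ⟨hζ.1.add (hξ.const_smul t), by
      simpa only [hgain] using integrable_smoothLoss_add_mul hX' hW hζ.2 hWB t⟩
    simpa only [expectedLoss, hgain, zero_mul, add_zero] using hle
  have hzero := hlocal.hasDerivAt_eq_zero (hasDerivAt_integral_smoothLoss hX' hW hζ.2 hWB)
  rw [← neg_eq_zero, ← integral_neg, ← hzero]
  exact integral_congr_ae (.of_forall fun ω => by ring)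

end CenteringDensity

section CenteringMeasure

variable {Ω : Type*} {mΩ : MeasurableSpace Ω} {P : Measure Ω} {T d : ℕ}
  {ℱ : Filtration (Fin (T + 1)) mΩ} {S : Fin (T + 1) → Ω → EuclideanSpace ℝ (Fin d)} {M : ℝ}

lemma NoArbitrage.onePeriodNoArbitrage (hNA : NoArbitrage P ℱ S) (i : Fin T) :
    OnePeriodNoArbitrage P (ℱ i.castSucc) (increment S i) := fun ξ hξ => by
  simpa only [terminalWealth_single, zero_add] using
    hNA (Pi.single i ξ) (isStrategy_single hξ)

/-- Backward induction: changing the measure by a density known at the end of a period keeps the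
later periods centered. -/
lemma NoArbitrage.exists_centersGains_of_le [IsFiniteMeasure P] (hNA : NoArbitrage P ℱ S)
    (hS : ∀ t, Measurable[ℱ t] (S t)) (hM : ∀ i, ∀ᵐ ω ∂P, ‖increment S i ω‖ ≤ M)
    (t : Fin (T + 1)) :
    ∃ (Q : Measure Ω) (K : NNReal), P ≪ Q ∧ Q ≤ K • P ∧
      ∀ i : Fin T, t ≤ i.castSucc → CentersGains Q (ℱ i.castSucc) (increment S i) := by
  induction t using Fin.reverseInduction with
  | last => exact ⟨P, 1, .rfl, by simp, fun i hi => absurd i.castSucc_lt_last hi.not_gt⟩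
  | cast k ih =>
    obtain ⟨Q, K, hPQ, hQK, hQ⟩ := ih
    have hQP : Q ≪ P := Measure.absolutelyContinuous_of_le_smul hQK
    have : IsFiniteMeasure Q := isFiniteMeasure_of_le _ hQK
    obtain ⟨z, hz, hpos, hz2, hk⟩ :=
      ((hNA.onePeriodNoArbitrage k).of_equivalent hQP hPQ).exists_centering_density
        (ℱ.mono k.castSucc_le_succ) (ℱ.le _) (measurable_increment hS k) (hQP.ae_le (hM k))
    have hz' : Measurable z := hz.mono (ℱ.le _) le_rfl
    refine ⟨Q.withDensity fun ω => ENNReal.ofReal (z ω), 2 * K, hPQ.trans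
      (withDensity_absolutelyContinuous' hz'.ennreal_ofReal.aemeasurable
        (.of_forall fun ω => (ENNReal.ofReal_pos.2 (hpos ω)).ne')), ?_, fun i hi => ?_⟩
    · calc Q.withDensity (fun ω => ENNReal.ofReal (z ω)) ≤ Q.withDensity fun _ => 2 :=
            withDensity_mono (.of_forall fun ω => ENNReal.ofReal_le_of_le_toReal (hz2 ω))
        _ = (2 : NNReal) • Q := withDensity_const 2
        _ ≤ (2 : NNReal) • (K • P) := by gcongr
        _ = (2 * K) • P := smul_smul _ _ _
    · rcases hi.eq_or_lt with hik | hik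
      · obtain rfl := Fin.castSucc_injective _ hik
        exact hk
      · have hki : k.succ ≤ i.castSucc := Fin.castSucc_lt_iff_succ_le.1 hik
        exact (hQ i hki).withDensity (ℱ.le _) (hz.mono (ℱ.mono hki) le_rfl)
          (fun ω => (hpos ω).le) hz2

theorem NoArbitrage.exists_centersIncrements [IsFiniteMeasure P] (hNA : NoArbitrage P ℱ S)
    (hS : ∀ t, Measurable[ℱ t] (S t)) (hM : ∀ i, ∀ᵐ ω ∂P, ‖increment S i ω‖ ≤ M) :
    ∃ (Q : Measure Ω) (K : NNReal), P ≪ Q ∧ Q ≤ K • P ∧ CentersIncrements Q ℱ S := by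
  obtain ⟨Q, K, hPQ, hQK, hQ⟩ := hNA.exists_centersGains_of_le hS hM 0
  exact ⟨Q, K, hPQ, hQK, fun i => hQ i (Fin.zero_le _)⟩

end CenteringMeasure

section Gains

variable {Ω : Type*} {m mΩ : MeasurableSpace Ω} {μ : Measure Ω}

lemma lintegral_ofReal_add_neg_of_integral_eq {X Y : Ω → ℝ} (hX : Integrable X μ)
    (hY : Integrable Y μ) (h : ∫ ω, X ω ∂μ = ∫ ω, Y ω ∂μ) :
    ∫⁻ ω, ENNReal.ofReal (X ω) ∂μ + ∫⁻ ω, ENNReal.ofReal (-Y ω) ∂μ =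
      ∫⁻ ω, ENNReal.ofReal (-X ω) ∂μ + ∫⁻ ω, ENNReal.ofReal (Y ω) ∂μ := by
  have hXpos : ∫⁻ ω, ENNReal.ofReal (X ω) ∂μ ≠ ⊤ := hX.lintegral_lt_top.ne
  have hXneg : ∫⁻ ω, ENNReal.ofReal (-X ω) ∂μ ≠ ⊤ := hX.neg.lintegral_lt_top.ne
  have hYpos : ∫⁻ ω, ENNReal.ofReal (Y ω) ∂μ ≠ ⊤ := hY.lintegral_lt_top.ne
  have hYneg : ∫⁻ ω, ENNReal.ofReal (-Y ω) ∂μ ≠ ⊤ := hY.neg.lintegral_lt_top.ne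
  rw [integral_eq_lintegral_pos_part_sub_lintegral_neg_part hX,
    integral_eq_lintegral_pos_part_sub_lintegral_neg_part hY] at h
  rw [← ENNReal.toReal_eq_toReal_iff' (ENNReal.add_ne_top.2 ⟨hXpos, hYneg⟩)
    (ENNReal.add_ne_top.2 ⟨hXneg, hYpos⟩), ENNReal.toReal_add hXpos hYneg,
    ENNReal.toReal_add hXneg hYpos]
  linarith

variable {E : Type*} [NormedAddCommGroup E] [InnerProductSpace ℝ E] [FiniteDimensional ℝ E]
  [MeasurableSpace E] [BorelSpace E] [IsFiniteMeasure μ] {s ξ : Ω → E} {X : Ω → ℝ} {A : Set Ω}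
  {M B : ℝ}

lemma CentersGains.setLIntegral_add_eq_of_bounded (hμ : CentersGains μ m s) (hm : m ≤ mΩ)
    (hs : Measurable s) (hM : ∀ᵐ ω ∂μ, ‖s ω‖ ≤ M) (hX : Measurable[m] X) (hξ : Measurable[m] ξ)
    (hA : MeasurableSet[m] A) (hXB : ∀ ω ∈ A, |X ω| ≤ B) (hξB : ∀ ω ∈ A, ‖ξ ω‖ ≤ B) :
    ∫⁻ ω in A, ENNReal.ofReal (X ω) ∂μ +
        ∫⁻ ω in A, ENNReal.ofReal (-(X ω + inner ℝ (ξ ω) (s ω))) ∂μ =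
      ∫⁻ ω in A, ENNReal.ofReal (-X ω) ∂μ +
        ∫⁻ ω in A, ENNReal.ofReal (X ω + inner ℝ (ξ ω) (s ω)) ∂μ := by
  have hind : (fun ω => (inner ℝ (A.indicator ξ ω) (s ω) : ℝ)) =
      A.indicator fun ω => inner ℝ (ξ ω) (s ω) := by
    ext ω
    by_cases hω : ω ∈ A <;> simp [hω]
  have hηB (ω : Ω) : ‖A.indicator ξ ω‖ ≤ |B| := by
    by_cases hω : ω ∈ A
    · simpa [hω] using (hξB ω hω).trans (le_abs_self B)
    · simp [hω]
  have hη : Measurable[m] (A.indicator ξ) := hξ.indicator hA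
  have hgain : IntegrableOn (fun ω => (inner ℝ (ξ ω) (s ω) : ℝ)) A μ := by
    rw [← integrable_indicator_iff (hm A hA), ← hind]
    exact integrable_inner hm hs hM hη hηB
  have hcenter : ∫ ω in A, (inner ℝ (ξ ω) (s ω) : ℝ) ∂μ = 0 := by
    rw [← integral_indicator (hm A hA), ← hind]
    exact hμ _ hη ⟨_, hηB⟩
  have hXi : IntegrableOn X A μ :=
    .of_bound (measure_lt_top _ _) (hX.mono hm le_rfl).aestronglyMeasurable B
      ((ae_restrict_iff' (hm A hA)).2 (.of_forall hXB))
  refine lintegral_ofReal_add_neg_of_integral_eq hXi (hXi.add hgain) ?_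
  rw [integral_add hXi hgain, hcenter, add_zero]

lemma CentersGains.setLIntegral_add_eq (hμ : CentersGains μ m s) (hm : m ≤ mΩ)
    (hs : Measurable s) (hM : ∀ᵐ ω ∂μ, ‖s ω‖ ≤ M) (hX : Measurable[m] X) (hξ : Measurable[m] ξ)
    (hA : MeasurableSet[m] A) :
    ∫⁻ ω in A, ENNReal.ofReal (X ω) ∂μ +
        ∫⁻ ω in A, ENNReal.ofReal (-(X ω + inner ℝ (ξ ω) (s ω))) ∂μ =
      ∫⁻ ω in A, ENNReal.ofReal (-X ω) ∂μ +
        ∫⁻ ω in A, ENNReal.ofReal (X ω + inner ℝ (ξ ω) (s ω)) ∂μ := by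
  set K : ℕ → Set Ω := fun k => {ω | |X ω| ≤ k ∧ ‖ξ ω‖ ≤ k}
  have hKm (k : ℕ) : MeasurableSet[m] (K k) :=
    (measurableSet_le (continuous_abs.measurable.comp hX) measurable_const).inter
      (measurableSet_le (measurable_norm.comp hξ) measurable_const)
  have hcover : AECover (μ.restrict A) atTop K :=
    ⟨.of_forall fun ω => (eventually_ge_atTop ⌈max |X ω| ‖ξ ω‖⌉₊).mono fun k hk =>
      max_le_iff.1 (Nat.ceil_le.1 hk), fun k => hm _ (hKm k)⟩
  have hXΩ : Measurable X := hX.mono hm le_rfl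
  have hYΩ : Measurable fun ω => X ω + inner ℝ (ξ ω) (s ω) :=
    hXΩ.add ((hξ.mono hm le_rfl).inner hs)
  have hlim {Y : Ω → ℝ} (hY : Measurable Y) := hcover.lintegral_tendsto_of_nat
    (hY.ennreal_ofReal).aemeasurable
  refine tendsto_nhds_unique ((hlim hXΩ).add (hlim hYΩ.neg)) ?_
  refine ((hlim hXΩ.neg).add (hlim hYΩ)).congr fun k => ?_
  rw [Measure.restrict_restrict (hm _ (hKm k))]
  exact (hμ.setLIntegral_add_eq_of_bounded hm hs hM hX hξ ((hKm k).inter hA)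
    (fun ω hω => hω.1.1) fun ω hω => hω.1.2).symm

lemma CentersGains.lintegral_neg_le (hμ : CentersGains μ m s) (hm : m ≤ mΩ) (hs : Measurable s)
    (hM : ∀ᵐ ω ∂μ, ‖s ω‖ ≤ M) (hX : Measurable[m] X) (hξ : Measurable[m] ξ) :
    ∫⁻ ω, ENNReal.ofReal (-X ω) ∂μ ≤
      ∫⁻ ω, ENNReal.ofReal (-(X ω + inner ℝ (ξ ω) (s ω))) ∂μ := by
  have hloss : MeasurableSet[m] {ω | X ω < 0} := measurableSet_lt hX measurable_const
  have heq := hμ.setLIntegral_add_eq hm hs hM hX hξ hloss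
  have hpos : ∫⁻ ω in {ω | X ω < 0}, ENNReal.ofReal (X ω) ∂μ = 0 :=
    setLIntegral_eq_zero (hm _ hloss) fun ω hω => ENNReal.ofReal_of_nonpos (le_of_lt hω)
  have hneg : ∫⁻ ω in {ω | X ω < 0}, ENNReal.ofReal (-X ω) ∂μ =
      ∫⁻ ω, ENNReal.ofReal (-X ω) ∂μ :=
    setLIntegral_eq_of_support_subset fun ω hω => by simpa using hω
  rw [hpos, zero_add, hneg] at heq
  exact (le_self_add.trans_eq heq.symm).trans (setLIntegral_le_lintegral _ _)

lemma CentersGains.lintegral_le (hμ : CentersGains μ m s) (hm : m ≤ mΩ) (hs : Measurable s)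
    (hM : ∀ᵐ ω ∂μ, ‖s ω‖ ≤ M) (hX : Measurable[m] X) (hξ : Measurable[m] ξ) :
    ∫⁻ ω, ENNReal.ofReal (X ω + inner ℝ (ξ ω) (s ω)) ∂μ ≤ ∫⁻ ω, ENNReal.ofReal (X ω) ∂μ +
      ∫⁻ ω, ENNReal.ofReal (-(X ω + inner ℝ (ξ ω) (s ω))) ∂μ := by
  have heq := hμ.setLIntegral_add_eq hm hs hM hX hξ .univ
  simp only [Measure.restrict_univ] at heq
  exact le_add_self.trans_eq heq.symm

end Gains

section Wealth

variable {Ω : Type*} {mΩ : MeasurableSpace Ω} {Q : Measure Ω} [IsFiniteMeasure Q] {T d : ℕ}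
  {ℱ : Filtration (Fin (T + 1)) mΩ} {S : Fin (T + 1) → Ω → EuclideanSpace ℝ (Fin d)}
  {φ : Fin T → Ω → EuclideanSpace ℝ (Fin d)} {M : ℝ}

lemma CentersIncrements.lintegral_neg_wealthAt_le (hQ : CentersIncrements Q ℱ S)
    (hS : ∀ t, Measurable[ℱ t] (S t)) (hM : ∀ i, ∀ᵐ ω ∂Q, ‖increment S i ω‖ ≤ M)
    (hφ : IsStrategy ℱ φ) (c : ℝ) (t : Fin (T + 1)) :
    ∫⁻ ω, ENNReal.ofReal (-wealthAt S c φ t ω) ∂Q ≤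
      ∫⁻ ω, ENNReal.ofReal (-terminalWealth S c φ ω) ∂Q := by
  induction t using Fin.reverseInduction with
  | last => rw [wealthAt_last]
  | cast i ih =>
    refine le_trans ?_ ih
    simp only [wealthAt_succ]
    exact (hQ i).lintegral_neg_le (ℱ.le _) ((measurable_increment hS i).mono (ℱ.le _) le_rfl)
      (hM i) (measurable_wealthAt hS hφ _) (hφ i)

lemma CentersIncrements.lintegral_wealthAt_le (hQ : CentersIncrements Q ℱ S)
    (hS : ∀ t, Measurable[ℱ t] (S t)) (hM : ∀ i, ∀ᵐ ω ∂Q, ‖increment S i ω‖ ≤ M)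
    (hφ : IsStrategy ℱ φ) (c : ℝ) (t : Fin (T + 1)) :
    ∫⁻ ω, ENNReal.ofReal (wealthAt S c φ t ω) ∂Q ≤ ENNReal.ofReal c * Q univ +
      (t : ℕ) * ∫⁻ ω, ENNReal.ofReal (-terminalWealth S c φ ω) ∂Q := by
  induction t using Fin.induction with
  | zero => simp [wealthAt_zero]
  | succ i ih =>
    have hstep := (hQ i).lintegral_le (ℱ.le _)
      ((measurable_increment hS i).mono (ℱ.le _) le_rfl) (hM i)
      (measurable_wealthAt hS hφ i.castSucc (c := c)) (hφ i)
    simp only [← wealthAt_succ] at hstep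
    refine (hstep.trans (add_le_add ih (hQ.lintegral_neg_wealthAt_le hS hM hφ c i.succ))).trans_eq
      ?_
    rw [Fin.val_castSucc, Fin.val_succ]
    push_cast
    ring

lemma CentersIncrements.lintegral_enorm_wealthAt_le (hQ : CentersIncrements Q ℱ S)
    (hS : ∀ t, Measurable[ℱ t] (S t)) (hM : ∀ i, ∀ᵐ ω ∂Q, ‖increment S i ω‖ ≤ M)
    (hφ : IsStrategy ℱ φ) (c : ℝ) (t : Fin (T + 1)) :
    ∫⁻ ω, ‖wealthAt S c φ t ω‖ₑ ∂Q ≤ ENNReal.ofReal c * Q univ +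
      (T + 1) * ∫⁻ ω, ENNReal.ofReal (-terminalWealth S c φ ω) ∂Q := by
  have hmeas : Measurable (wealthAt S c φ t) := (measurable_wealthAt hS hφ t).mono (ℱ.le _) le_rfl
  have hparts (x : ℝ) : ‖x‖ₑ = ENNReal.ofReal x + ENNReal.ofReal (-x) := by
    rw [Real.enorm_eq_ofReal_abs]
    rcases le_total 0 x with hx | hx
    · rw [abs_of_nonneg hx, ENNReal.ofReal_of_nonpos (neg_nonpos.2 hx), add_zero]
    · rw [abs_of_nonpos hx, ENNReal.ofReal_of_nonpos hx, zero_add]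
  have ht : ((t : ℕ) : ENNReal) ≤ T := Nat.cast_le.2 (Nat.le_of_lt_succ t.2)
  calc ∫⁻ ω, ‖wealthAt S c φ t ω‖ₑ ∂Q
    _ = ∫⁻ ω, ENNReal.ofReal (wealthAt S c φ t ω) ∂Q +
        ∫⁻ ω, ENNReal.ofReal (-wealthAt S c φ t ω) ∂Q := by
      simp only [hparts]
      exact lintegral_add_left hmeas.ennreal_ofReal _
    _ ≤ (ENNReal.ofReal c * Q univ +
          (t : ℕ) * ∫⁻ ω, ENNReal.ofReal (-terminalWealth S c φ ω) ∂Q) +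
        ∫⁻ ω, ENNReal.ofReal (-terminalWealth S c φ ω) ∂Q :=
      add_le_add (hQ.lintegral_wealthAt_le hS hM hφ c t)
        (hQ.lintegral_neg_wealthAt_le hS hM hφ c t)
    _ ≤ _ := by
      rw [add_assoc, add_mul, one_mul]
      gcongr

lemma CentersIncrements.lintegral_enorm_gain_le (hQ : CentersIncrements Q ℱ S)
    (hS : ∀ t, Measurable[ℱ t] (S t)) (hM : ∀ i, ∀ᵐ ω ∂Q, ‖increment S i ω‖ ≤ M)
    (hφ : IsStrategy ℱ φ) (c : ℝ) (i : Fin T) :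
    ∫⁻ ω, ‖(inner ℝ (φ i ω) (increment S i ω) : ℝ)‖ₑ ∂Q ≤ 2 * (ENNReal.ofReal c * Q univ +
      (T + 1) * ∫⁻ ω, ENNReal.ofReal (-terminalWealth S c φ ω) ∂Q) := by
  have hmeas : Measurable (wealthAt S c φ i.succ) :=
    (measurable_wealthAt hS hφ _).mono (ℱ.le _) le_rfl
  calc ∫⁻ ω, ‖(inner ℝ (φ i ω) (increment S i ω) : ℝ)‖ₑ ∂Q
    _ ≤ ∫⁻ ω, (‖wealthAt S c φ i.succ ω‖ₑ + ‖wealthAt S c φ i.castSucc ω‖ₑ) ∂Q := by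
      refine lintegral_mono fun ω => ?_
      rw [← add_sub_cancel_left (wealthAt S c φ i.castSucc ω) (inner ℝ (φ i ω) (increment S i ω)),
        ← wealthAt_succ]
      exact enorm_sub_le
    _ = ∫⁻ ω, ‖wealthAt S c φ i.succ ω‖ₑ ∂Q + ∫⁻ ω, ‖wealthAt S c φ i.castSucc ω‖ₑ ∂Q :=
      lintegral_add_left hmeas.enorm _
    _ ≤ _ := by
      rw [two_mul]
      exact add_le_add (hQ.lintegral_enorm_wealthAt_le hS hM hφ c _)
        (hQ.lintegral_enorm_wealthAt_le hS hM hφ c _)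

end Wealth

/-! ### Upper semicontinuity of expected utility -/

section Semicontinuity

variable {Ω : Type*} {mΩ : MeasurableSpace Ω} {P : Measure Ω}

lemma eventually_setLIntegral_compl_le [IsFiniteMeasure P] {G : ℕ → Set Ω}
    (hG : ∀ k, MeasurableSet (G k)) (hmono : Monotone G) (hcover : ∀ᵐ ω ∂P, ∃ k, ω ∈ G k)
    {h : Ω → ENNReal} (hh : ∫⁻ ω, h ω ∂P ≠ ⊤) {ε : ENNReal} (hε : 0 < ε) :
    ∀ᶠ k in atTop, ∫⁻ ω in (G k)ᶜ, h ω ∂P ≤ ε := by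
  have hlim : Tendsto (fun k => P (G k)ᶜ) atTop (nhds (P (⋂ k, (G k)ᶜ))) :=
    tendsto_measure_iInter_atTop (fun k => (hG k).compl.nullMeasurableSet)
      (fun k l hkl => compl_subset_compl.2 (hmono hkl)) ⟨0, measure_ne_top _ _⟩
  have hnull : P (⋂ k, (G k)ᶜ) = 0 := by
    refine measure_mono_null (fun ω hω => ?_) hcover
    rintro ⟨k, hk⟩
    exact mem_iInter.1 hω k hk
  rw [hnull] at hlim
  exact (tendsto_setLIntegral_zero hh hlim).eventually (ge_mem_nhds hε)

lemma setIntegral_compl_inter {f : Ω → ℝ} (hf : Integrable f P) {A G : Set Ω}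
    (hA : MeasurableSet A) (hG : MeasurableSet G) :
    ∫ ω in (A ∩ G)ᶜ, f ω ∂P = ∫ ω in Aᶜ, f ω ∂P + ∫ ω in A ∩ Gᶜ, f ω ∂P := by
  have hunion : (A ∩ G)ᶜ = Aᶜ ∪ A ∩ Gᶜ := by
    ext ω
    simp only [mem_compl_iff, mem_inter_iff, mem_union]
    tauto
  rw [hunion, setIntegral_union (disjoint_compl_left.mono_right inter_subset_left)
    (hA.inter hG.compl) hf.integrableOn hf.integrableOn]

lemma exists_measurableSet_norm_le_of_bounded [IsFiniteMeasure P] {m : MeasurableSpace Ω}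
    (hm : m ≤ mΩ) {E : Type*} [NormedAddCommGroup E] [MeasurableSpace E] [BorelSpace E]
    {ξ : ℕ → Ω → E} (hξ : ∀ n, Measurable[m] (ξ n))
    (hbdd : ∀ᵐ ω ∂P, ∃ k : ℕ, ∀ n, ‖ξ n ω‖ ≤ k) {g h : Ω → ENNReal}
    (hg : ∫⁻ ω, g ω ∂P ≠ ⊤) (hh : ∫⁻ ω, h ω ∂P ≠ ⊤) {ε : ENNReal} (hε : 0 < ε) :
    ∃ (G : Set Ω) (k : ℕ), MeasurableSet[m] G ∧ (∀ ω ∈ G, ∀ n, ‖ξ n ω‖ ≤ k) ∧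
      ∫⁻ ω in Gᶜ, g ω ∂P ≤ ε ∧ ∫⁻ ω in Gᶜ, h ω ∂P ≤ ε := by
  let G : ℕ → Set Ω := fun k => {ω | ∀ n, ‖ξ n ω‖ ≤ k}
  have hGm (k : ℕ) : MeasurableSet[m] (G k) := by
    simp only [G, Set.ofPred_forall]
    exact MeasurableSet.iInter fun n =>
      measurableSet_le (measurable_norm.comp (hξ n)) measurable_const
  have hGmono : Monotone G := fun k l hkl ω hω n => (hω n).trans (Nat.cast_le.2 hkl)
  obtain ⟨k, hkg, hkh⟩ :=
    ((eventually_setLIntegral_compl_le (fun k => hm _ (hGm k)) hGmono hbdd hg hε).and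
      (eventually_setLIntegral_compl_le (fun k => hm _ (hGm k)) hGmono hbdd hh hε)).exists
  exact ⟨G k, k, hGm k, fun ω hω => hω, hkg, hkh⟩

variable {T d : ℕ} {ℱ : Filtration (Fin (T + 1)) mΩ}
  {S : Fin (T + 1) → Ω → EuclideanSpace ℝ (Fin d)} {U : ℝ → ℝ} {c M : ℝ}
  {φ : ℕ → Fin T → Ω → EuclideanSpace ℝ (Fin d)}

/-- An event `A` at time `t` that localises a sequence of strategies: on `A` their wealth up to
time `t` is bounded, while off `A` each gains at most `ε` of utility and `g` has mass at
most `ε`. -/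
structure IsLocalizing (P : Measure Ω) (ℱ : Filtration (Fin (T + 1)) mΩ)
    (S : Fin (T + 1) → Ω → EuclideanSpace ℝ (Fin d)) (U : ℝ → ℝ) (c : ℝ)
    (φ : ℕ → Fin T → Ω → EuclideanSpace ℝ (Fin d)) (g : Ω → ℝ) (ε : ℝ) (t : Fin (T + 1))
    (A : Set Ω) : Prop where
  measurableSet : MeasurableSet[ℱ t] A
  exists_wealthAt_le : ∃ q : ℝ, ∀ᵐ ω ∂P, ω ∈ A → ∀ n, |wealthAt S c (φ n) t ω| ≤ q
  utility_le : ∀ n, ∫ ω in Aᶜ, U (terminalWealth S c (φ n) ω) ∂P ≤ ε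
  mass_le : ∫ ω in Aᶜ, |g ω| ∂P ≤ ε

lemma UtilityDominated.exists_isLocalizing_succ [IsFiniteMeasure P]
    (hdom : UtilityDominated P ℱ S U) (hS : ∀ t, Measurable[ℱ t] (S t))
    (hM : ∀ i, ∀ᵐ ω ∂P, ‖increment S i ω‖ ≤ M) (hφ : ∀ n, IsAdmissible P ℱ S U c (φ n))
    {i : Fin T} (hbdd : ∀ᵐ ω ∂P, ∃ k : ℕ, ∀ n, ‖φ n i ω‖ ≤ k) {g : Ω → ℝ}
    (hg : Integrable g P) {ε δ : ℝ} (hδ : 0 < δ) {A : Set Ω}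
    (hA : IsLocalizing P ℱ S U c φ g ε i.castSucc A) :
    ∃ B, IsLocalizing P ℱ S U c φ g (ε + δ) i.succ B := by
  obtain ⟨q, hq⟩ := hA.exists_wealthAt_le
  obtain ⟨h, hh, hle⟩ := hdom.exists_setIntegral_le i.castSucc q
  obtain ⟨G, k, hG, hGk, hGh, hGg⟩ := exists_measurableSet_norm_le_of_bounded (ℱ.le i.castSucc)
    (fun n => (hφ n).isStrategy i) hbdd hh.ne hg.abs.lintegral_lt_top.ne (ENNReal.ofReal_pos.2 hδ)
  have hAΩ : MeasurableSet A := ℱ.le _ _ hA.measurableSet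
  have hGΩ : MeasurableSet G := ℱ.le _ _ hG
  refine ⟨A ∩ G, ℱ.mono (Fin.castSucc_lt_succ (i := i)).le _ (hA.measurableSet.inter hG),
    ⟨q + k * M, ?_⟩, fun n => ?_, ?_⟩
  · filter_upwards [hq, hM i] with ω hωq hωM hω n
    rw [wealthAt_succ]
    refine (abs_add_le _ _).trans (add_le_add (hωq hω.1 n) ((abs_real_inner_le_norm _ _).trans ?_))
    exact mul_le_mul (hGk ω hω.2 n) hωM (norm_nonneg _) (Nat.cast_nonneg _)
  · rw [setIntegral_compl_inter (hφ n).integrable hAΩ hGΩ]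
    refine add_le_add (hA.utility_le n) ?_
    let B : Set Ω := (A ∩ Gᶜ) ∩ {ω | wealthAt S c (φ n) i.castSucc ω ≤ q}
    have hB : MeasurableSet[ℱ i.castSucc] B := (hA.measurableSet.inter hG.compl).inter
      (measurableSet_le (measurable_wealthAt hS (hφ n).isStrategy _) measurable_const)
    have hBA : B =ᵐ[P] (A ∩ Gᶜ : Set Ω) := by
      filter_upwards [hq] with ω hω
      exact propext ⟨fun hωB => hωB.1, fun hωA => ⟨hωA, (le_abs_self _).trans (hω hωA.1 n)⟩⟩
    rw [← setIntegral_congr_set hBA]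
    refine (hle c (φ n) (hφ n) B hB fun ω hω => hω.2).trans ?_
    exact ENNReal.toReal_le_of_le_ofReal hδ.le
      ((lintegral_mono_set fun ω hω => hω.1.2).trans hGh)
  · rw [setIntegral_compl_inter hg.abs hAΩ hGΩ]
    refine add_le_add hA.mass_le ?_
    rw [integral_eq_lintegral_of_nonneg_ae (.of_forall fun ω => abs_nonneg _) hg.abs.1.restrict]
    exact ENNReal.toReal_le_of_le_ofReal hδ.le
      ((lintegral_mono_set inter_subset_right).trans hGg)

lemma UtilityDominated.exists_isLocalizing [IsFiniteMeasure P]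
    (hdom : UtilityDominated P ℱ S U) (hS : ∀ t, Measurable[ℱ t] (S t))
    (hM : ∀ i, ∀ᵐ ω ∂P, ‖increment S i ω‖ ≤ M) (hφ : ∀ n, IsAdmissible P ℱ S U c (φ n))
    (hbdd : ∀ᵐ ω ∂P, ∀ i, ∃ k : ℕ, ∀ n, ‖φ n i ω‖ ≤ k) {g : Ω → ℝ} (hg : Integrable g P)
    (t : Fin (T + 1)) {ε : ℝ} (hε : 0 < ε) : ∃ A, IsLocalizing P ℱ S U c φ g ε t A := by
  induction t using Fin.induction generalizing ε with
  | zero =>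
    refine ⟨univ, .univ, ⟨|c|, .of_forall fun ω _ n => ?_⟩, fun n => ?_, ?_⟩
    · rw [wealthAt_zero]
    · simpa using hε.le
    · simpa using hε.le
  | succ i ih =>
    obtain ⟨A, hA⟩ := ih (half_pos hε)
    obtain ⟨B, hB⟩ := hdom.exists_isLocalizing_succ hS hM hφ (hbdd.mono fun ω hω => hω i) hg
      (half_pos hε) hA
    exact ⟨B, add_halves ε ▸ hB⟩

variable {ψ : Fin T → Ω → EuclideanSpace ℝ (Fin d)}

lemma IsLocalizing.tendsto_setIntegral [IsFiniteMeasure P] {g : Ω → ℝ} {ε : ℝ} {A : Set Ω}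
    (hA : IsLocalizing P ℱ S U c φ g ε (Fin.last T) A) (hmono : Monotone U) (hcont : Continuous U)
    (hφ : ∀ n, IsAdmissible P ℱ S U c (φ n))
    (hlim : ∀ᵐ ω ∂P, ∀ i, Tendsto (fun n => φ n i ω) atTop (nhds (ψ i ω))) :
    Tendsto (fun n => ∫ ω in A, U (terminalWealth S c (φ n) ω) ∂P) atTop
      (nhds (∫ ω in A, U (terminalWealth S c ψ ω) ∂P)) := by
  obtain ⟨q, hq⟩ := hA.exists_wealthAt_le
  refine tendsto_integral_of_dominated_convergence (fun _ => max |U q| |U (-q)|)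
    (fun n => (hφ n).integrable.1.restrict) (integrable_const _) (fun n => ?_)
    (ae_restrict_of_ae (hlim.mono fun ω hω => (hcont.tendsto _).comp (tendsto_terminalWealth hω)))
  rw [ae_restrict_iff' (hA.measurableSet |> ℱ.le _ _)]
  filter_upwards [hq] with ω hω hωA
  rw [← wealthAt_last]
  obtain ⟨hlow, hupp⟩ := abs_le.1 (hω hωA n)
  rw [Real.norm_eq_abs, abs_le']
  exact ⟨((hmono hupp).trans (le_abs_self _)).trans (le_max_left _ _),
    ((neg_le_neg (hmono hlow)).trans (neg_le_abs _)).trans (le_max_right _ _)⟩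

theorem UtilityDominated.le_expectedUtility_of_tendsto [IsFiniteMeasure P]
    (hdom : UtilityDominated P ℱ S U) (hmono : Monotone U) (hcont : Continuous U)
    (hS : ∀ t, Measurable[ℱ t] (S t)) (hM : ∀ i, ∀ᵐ ω ∂P, ‖increment S i ω‖ ≤ M)
    (hφ : ∀ n, IsAdmissible P ℱ S U c (φ n)) (hψ : IsAdmissible P ℱ S U c ψ)
    (hlim : ∀ᵐ ω ∂P, ∀ i, Tendsto (fun n => φ n i ω) atTop (nhds (ψ i ω))) {b : ℝ}
    (hb : ∀ᶠ n in atTop, b ≤ expectedUtility P S U c (φ n)) :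
    b ≤ expectedUtility P S U c ψ := by
  have hbdd : ∀ᵐ ω ∂P, ∀ i, ∃ k : ℕ, ∀ n, ‖φ n i ω‖ ≤ k := by
    filter_upwards [hlim] with ω hω i
    obtain ⟨B, hB⟩ := (hω i).norm.bddAbove_range
    obtain ⟨k, hk⟩ := exists_nat_ge B
    exact ⟨k, fun n => (hB (mem_range_self n)).trans hk⟩
  refine le_of_forall_pos_le_add fun ε hε => ?_
  obtain ⟨A, hA⟩ := hdom.exists_isLocalizing hS hM hφ hbdd hψ.integrable (Fin.last T)
    (half_pos hε)
  have hAΩ : MeasurableSet A := ℱ.le _ _ hA.measurableSet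
  have hinside : b ≤ ε / 2 + ∫ ω in A, U (terminalWealth S c ψ ω) ∂P := by
    refine ge_of_tendsto ((hA.tendsto_setIntegral hmono hcont hφ hlim).const_add (ε / 2)) ?_
    filter_upwards [hb] with n hn
    rw [expectedUtility, ← integral_add_compl hAΩ (hφ n).integrable] at hn
    linarith [hA.utility_le n]
  have houtside : -∫ ω in Aᶜ, U (terminalWealth S c ψ ω) ∂P ≤ ε / 2 :=
    (neg_le_abs _).trans (abs_integral_le_integral_abs.trans hA.mass_le)
  rw [expectedUtility, ← integral_add_compl hAΩ hψ.integrable]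
  linarith

end Semicontinuity

/-! ### Bounds from elasticity -/

section Elasticity

variable {U : ℝ → ℝ}

lemma half_le_of_concaveOn (hconc : ConcaveOn ℝ univ U) (h0 : U 0 = 0) (x : ℝ) :
    U x / 2 ≤ U (x / 2) := by
  have hhalf : (0 : ℝ) ≤ 1 / 2 := by norm_num
  have hmid := hconc.2 (mem_univ x) (mem_univ 0) hhalf hhalf (by norm_num)
  simp only [smul_eq_mul, mul_zero, add_zero, h0] at hmid
  rw [div_eq_inv_mul, div_eq_inv_mul]
  simpa using hmid

lemma ElasticityAtTop.exists_mul_max_neg_le (hU : ElasticityAtTop U) :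
    ∃ p δ C : ℝ, 0 ≤ p ∧ 0 < δ ∧ ∀ x, δ * max (-U x) 0 ≤ p * U (x / 2) - U x + C := by
  obtain ⟨hconc, hmono, h0, x₀, γ, hx₀, -, hγ, helast⟩ := hU
  have hp : (0 : ℝ) ≤ 2 ^ γ := by positivity
  have hp2 : (2 : ℝ) ^ γ < 2 := by simpa using Real.rpow_lt_rpow_of_exponent_lt one_lt_two hγ
  have hC : 0 ≤ U (2 * x₀) := h0.symm.trans_le (hmono (by linarith))
  refine ⟨2 ^ γ, 1 - 2 ^ γ / 2, U (2 * x₀), hp, by linarith, fun x => ?_⟩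
  rcases le_total x 0 with hx | hx
  · have hUx : U x ≤ 0 := (hmono hx).trans_eq h0
    have hhalf := mul_le_mul_of_nonneg_left (half_le_of_concaveOn hconc h0 x) hp
    rw [max_eq_left (neg_nonneg.2 hUx)]
    linarith
  · have hUx : 0 ≤ U x := h0.symm.trans_le (hmono hx)
    rw [max_eq_right (neg_nonpos.2 hUx), mul_zero]
    rcases le_total x (2 * x₀) with hsmall | hlarge
    · have hhalf : 0 ≤ U (x / 2) := h0.symm.trans_le (hmono (by linarith))
      linarith [mul_nonneg hp hhalf, hmono hsmall]
    · have hdouble := helast (x / 2) 2 (by linarith) one_le_two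
      rw [mul_div_cancel₀ x two_ne_zero] at hdouble
      linarith

lemma ElasticityAtBot.exists_mul_max_neg_le (hU : ElasticityAtBot U) :
    ∃ p δ C : ℝ, 0 ≤ p ∧ 0 < δ ∧ ∀ x, δ * max (-U x) 0 ≤ p * U (x / 2) - U x + C := by
  obtain ⟨hconc, hmono, h0, x₀, α, hx₀, hα, helast⟩ := hU
  have hκ : (0 : ℝ) ≤ 2 ^ (-α) := by positivity
  have hκ1 : (2 : ℝ) ^ (-α) < 1 :=
    Real.rpow_lt_one_of_one_lt_of_neg one_lt_two (neg_neg_of_pos hα)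
  have hUx₀ : U x₀ ≤ 0 := (hmono hx₀).trans_eq h0
  refine ⟨2, 1 - 2 ^ (-α), -2 * U x₀, zero_le_two, by linarith, fun x => ?_⟩
  rcases le_total x 0 with hx | hx
  · have hUx : U x ≤ 0 := (hmono hx).trans_eq h0
    rw [max_eq_left (neg_nonneg.2 hUx)]
    rcases le_total (2 * x₀) x with hsmall | hlarge
    · have hhalf : U x₀ ≤ U (x / 2) := hmono (by linarith)
      linarith [mul_nonneg hκ (neg_nonneg.2 hUx)]
    · have hdouble := helast (x / 2) 2 (by linarith) one_le_two
      rw [mul_div_cancel₀ x two_ne_zero] at hdouble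
      have hscaled := mul_le_mul_of_nonneg_left hdouble hκ
      rw [← mul_assoc, ← Real.rpow_add two_pos, neg_add_cancel_comm_assoc, Real.rpow_one]
        at hscaled
      linarith
  · have hUx : 0 ≤ U x := h0.symm.trans_le (hmono hx)
    rw [max_eq_right (neg_nonpos.2 hUx), mul_zero]
    linarith [half_le_of_concaveOn hconc h0 x]

lemma neg_le_one_add_div (hconc : ConcaveOn ℝ univ U) (hmono : StrictMono U) (h0 : U 0 = 0)
    (x : ℝ) : -x ≤ 1 + max (-U x) 0 / -U (-1) := by
  have hU1 : U (-1) < 0 := (hmono (by norm_num)).trans_eq h0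
  rcases le_total (-1) x with hx | hx
  · linarith [div_nonneg (le_max_right (-U x) 0) (neg_nonneg.2 hU1.le)]
  · have hx0 : 0 < -x := by linarith
    have hinv : 0 ≤ 1 - (-x)⁻¹ := sub_nonneg.2 (inv_le_one_of_one_le₀ (by linarith))
    have hchord := hconc.2 (mem_univ x) (mem_univ 0) (inv_nonneg.2 hx0.le) hinv (by ring)
    have hpoint : (-x)⁻¹ * x = -1 := by rw [inv_neg, neg_mul, inv_mul_cancel₀ (by linarith)]
    simp only [smul_eq_mul, mul_zero, add_zero, h0, hpoint] at hchord
    rw [inv_mul_le_iff₀ hx0] at hchord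
    have hdiv : -x ≤ max (-U x) 0 / -U (-1) := by
      rw [le_div_iff₀ (neg_pos.2 hU1)]
      exact le_max_of_le_left (by linarith)
    linarith

end Elasticity

section UniformBounds

variable {Ω : Type*} {mΩ : MeasurableSpace Ω} {P : Measure Ω} {T d : ℕ}
  {ℱ : Filtration (Fin (T + 1)) mΩ} {S : Fin (T + 1) → Ω → EuclideanSpace ℝ (Fin d)} {U : ℝ → ℝ}

-- Averaging `φ` with the zero strategy from capital `0` halves terminal wealth, so the finite value
-- at capital `c / 2` bounds the term `E U(V / 2)` of the elasticity inequality.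
lemma UtilityDominated.exists_integral_neg_le [IsProbabilityMeasure P]
    (hdom : UtilityDominated P ℱ S U) (hU : ElasticityAtTop U ∨ ElasticityAtBot U)
    (hS : ∀ t, Measurable[ℱ t] (S t)) (c b : ℝ) :
    ∃ K : ℝ, ∀ φ, IsAdmissible P ℱ S U c φ → b ≤ expectedUtility P S U c φ →
      ∫ ω, max (-U (terminalWealth S c φ ω)) 0 ∂P ≤ K := by
  have hconc : ConcaveOn ℝ univ U := hU.elim (fun h => h.1) fun h => h.1
  obtain ⟨p, δ, C, hp, hδ, hle⟩ := hU.elim ElasticityAtTop.exists_mul_max_neg_le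
    ElasticityAtBot.exists_mul_max_neg_le
  obtain ⟨C', hC'⟩ := hdom.exists_expectedUtility_le (1 / 2 * c + 1 / 2 * 0)
  refine ⟨(p * C' - b + C) / δ, fun φ hφ hb => ?_⟩
  have hhalf : (0 : ℝ) ≤ 1 / 2 := by norm_num
  have hmix := hφ.combo (isAdmissible_zero (c := 0)) hdom hconc hS hhalf hhalf (by norm_num)
  have hwealth (ω : Ω) : terminalWealth S (1 / 2 * c + 1 / 2 * 0)
      ((1 / 2 : ℝ) • φ + (1 / 2 : ℝ) • (0 : Fin T → Ω → EuclideanSpace ℝ (Fin d))) ω =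
        terminalWealth S c φ ω / 2 := by
    rw [terminalWealth_combo, terminalWealth_zero]
    ring
  have hhalfint : Integrable (fun ω => U (terminalWealth S c φ ω / 2)) P := by
    simpa only [hwealth] using hmix.integrable
  have hhalfle : ∫ ω, U (terminalWealth S c φ ω / 2) ∂P ≤ C' := by
    simpa only [expectedUtility, hwealth] using hC' _ hmix
  have hdiff : Integrable (fun ω => p * U (terminalWealth S c φ ω / 2) -
      U (terminalWealth S c φ ω)) P := (hhalfint.const_mul p).sub hφ.integrable
  have hint := integral_mono (hφ.integrable.neg_part.const_mul δ) (hdiff.add (integrable_const C))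
    fun ω => hle (terminalWealth S c φ ω)
  simp only [Pi.add_apply] at hint
  rw [integral_const_mul, integral_add hdiff (integrable_const C),
    integral_sub (hhalfint.const_mul p) hφ.integrable, integral_const_mul, integral_const,
    probReal_univ, one_smul] at hint
  rw [expectedUtility] at hb
  rw [le_div_iff₀' hδ]
  linarith [mul_le_mul_of_nonneg_left hhalfle hp]

lemma UtilityDominated.exists_lintegral_neg_terminalWealth_le [IsProbabilityMeasure P]
    (hdom : UtilityDominated P ℱ S U) (hU : ElasticityAtTop U ∨ ElasticityAtBot U)
    (hmono : StrictMono U) (hS : ∀ t, Measurable[ℱ t] (S t)) (c b : ℝ) :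
    ∃ K : ℝ, ∀ φ, IsAdmissible P ℱ S U c φ → b ≤ expectedUtility P S U c φ →
      ∫⁻ ω, ENNReal.ofReal (-terminalWealth S c φ ω) ∂P ≤ ENNReal.ofReal K := by
  have hconc : ConcaveOn ℝ univ U := hU.elim (fun h => h.1) fun h => h.1
  have h0 : U 0 = 0 := hU.elim (fun h => h.2.2.1) fun h => h.2.2.1
  have hU1 : 0 < -U (-1) := neg_pos.2 ((hmono (by norm_num)).trans_eq h0)
  obtain ⟨K, hK⟩ := hdom.exists_integral_neg_le hU hS c b
  refine ⟨1 + K / -U (-1), fun φ hφ hb => ?_⟩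
  have hdiv : Integrable (fun ω => max (-U (terminalWealth S c φ ω)) 0 / -U (-1)) P :=
    hφ.integrable.neg_part.div_const _
  calc ∫⁻ ω, ENNReal.ofReal (-terminalWealth S c φ ω) ∂P
    _ ≤ ∫⁻ ω, ENNReal.ofReal (1 + max (-U (terminalWealth S c φ ω)) 0 / -U (-1)) ∂P :=
      lintegral_mono fun ω => ENNReal.ofReal_le_ofReal (neg_le_one_add_div hconc hmono h0 _)
    _ = ENNReal.ofReal (∫ ω, (1 + max (-U (terminalWealth S c φ ω)) 0 / -U (-1)) ∂P) :=
      (ofReal_integral_eq_lintegral_ofReal ((integrable_const 1).add hdiv) (.of_forall fun ω =>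
        add_nonneg zero_le_one (div_nonneg (le_max_right _ _) hU1.le))).symm
    _ ≤ ENNReal.ofReal (1 + K / -U (-1)) := by
      refine ENNReal.ofReal_le_ofReal ?_
      rw [integral_add (integrable_const 1) hdiv, integral_div, integral_const, probReal_univ,
        one_smul]
      gcongr
      exact hK φ hφ hb

lemma UtilityDominated.exists_integral_abs_gain_le [IsProbabilityMeasure P]
    (hdom : UtilityDominated P ℱ S U) (hU : ElasticityAtTop U ∨ ElasticityAtBot U)
    (hmono : StrictMono U) (hS : ∀ t, Measurable[ℱ t] (S t)) {M : ℝ}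
    (hM : ∀ i, ∀ᵐ ω ∂P, ‖increment S i ω‖ ≤ M) {Q : Measure Ω} {κ : NNReal} (hQP : Q ≤ κ • P)
    (hQ : CentersIncrements Q ℱ S) (c b : ℝ) :
    ∃ K : ℝ, ∀ φ, IsAdmissible P ℱ S U c φ → b ≤ expectedUtility P S U c φ → ∀ i,
      Integrable (fun ω => (inner ℝ (φ i ω) (increment S i ω) : ℝ)) Q ∧
        ∫ ω, |(inner ℝ (φ i ω) (increment S i ω) : ℝ)| ∂Q ≤ K := by
  have : IsFiniteMeasure Q := isFiniteMeasure_of_le _ hQP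
  have hMQ (i : Fin T) : ∀ᵐ ω ∂Q, ‖increment S i ω‖ ≤ M :=
    (Measure.absolutelyContinuous_of_le_smul hQP).ae_le (hM i)
  obtain ⟨N, hN⟩ := hdom.exists_lintegral_neg_terminalWealth_le hU hmono hS c b
  set K := 2 * (ENNReal.ofReal c * Q univ + (T + 1) * (κ * ENNReal.ofReal N))
  have hK : K ≠ ⊤ := by finiteness
  refine ⟨K.toReal, fun φ hφ hb i => ?_⟩
  have hlossQ : ∫⁻ ω, ENNReal.ofReal (-terminalWealth S c φ ω) ∂Q ≤ κ * ENNReal.ofReal N :=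
    calc ∫⁻ ω, ENNReal.ofReal (-terminalWealth S c φ ω) ∂Q
      _ ≤ ∫⁻ ω, ENNReal.ofReal (-terminalWealth S c φ ω) ∂(κ • P) := lintegral_mono' hQP le_rfl
      _ = κ * ∫⁻ ω, ENNReal.ofReal (-terminalWealth S c φ ω) ∂P := lintegral_smul_measure _ _
      _ ≤ κ * ENNReal.ofReal N := by gcongr; exact hN φ hφ hb
  have hgain : ∫⁻ ω, ‖(inner ℝ (φ i ω) (increment S i ω) : ℝ)‖ₑ ∂Q ≤ K :=
    (hQ.lintegral_enorm_gain_le hS hMQ hφ.isStrategy c i).trans (by simp only [K]; gcongr)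
  have hmeas : Measurable fun ω => (inner ℝ (φ i ω) (increment S i ω) : ℝ) :=
    (measurable_gain hS i (hφ.isStrategy i)).mono (ℱ.le _) le_rfl
  have hint : Integrable (fun ω => (inner ℝ (φ i ω) (increment S i ω) : ℝ)) Q :=
    ⟨hmeas.aestronglyMeasurable, hgain.trans_lt (lt_top_iff_ne_top.2 hK)⟩
  refine ⟨hint, ?_⟩
  simp only [← Real.norm_eq_abs]
  rw [integral_norm_eq_lintegral_enorm hint.1]
  exact ENNReal.toReal_mono hK hgain

end UniformBounds

/-! ### Existence of an optimal strategy -/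

section Existence

variable {Ω : Type*} {mΩ : MeasurableSpace Ω} {P : Measure Ω} {T d : ℕ}
  {ℱ : Filtration (Fin (T + 1)) mΩ} {S : Fin (T + 1) → Ω → EuclideanSpace ℝ (Fin d)} {U : ℝ → ℝ}
  {c b M : ℝ}

lemma UtilityDominated.convex_setOf_le_expectedUtility (hdom : UtilityDominated P ℱ S U)
    (hconc : ConcaveOn ℝ univ U) (hS : ∀ t, Measurable[ℱ t] (S t)) (c b : ℝ) :
    Convex ℝ {φ | IsAdmissible P ℱ S U c φ ∧ b ≤ expectedUtility P S U c φ} := by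
  rintro φ ⟨hφ, hφb⟩ ψ ⟨hψ, hψb⟩ α β hα hβ hαβ
  have hcombo := hφ.combo hψ hdom hconc hS hα hβ hαβ
  have hle := hφ.expectedUtility_combo_le hψ hdom hconc hS hα hβ hαβ
  have hb : b ≤ α * expectedUtility P S U c φ + β * expectedUtility P S U c ψ :=
    calc b = α * b + β * b := by rw [← add_mul, hαβ, one_mul]
      _ ≤ _ := by gcongr
  rw [← add_mul, hαβ, one_mul] at hcombo hle
  exact ⟨hcombo, hb.trans hle⟩

/-- The gains of a strategy over the single periods, as a linear function of the strategy. -/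
def gains (S : Fin (T + 1) → Ω → EuclideanSpace ℝ (Fin d)) :
    (Fin T → Ω → EuclideanSpace ℝ (Fin d)) →ₗ[ℝ] (Fin T → Ω → ℝ) where
  toFun φ i ω := inner ℝ (φ i ω) (increment S i ω)
  map_add' _ _ := by ext; exact inner_add_left _ _ _
  map_smul' _ _ := by ext; exact real_inner_smul_left _ _ _

lemma UtilityDominated.exists_convexHull_gains_tendsto [IsProbabilityMeasure P]
    (hdom : UtilityDominated P ℱ S U) (hU : ElasticityAtTop U ∨ ElasticityAtBot U)
    (hmono : StrictMono U) (hS : ∀ t, Measurable[ℱ t] (S t))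
    (hM : ∀ i, ∀ᵐ ω ∂P, ‖increment S i ω‖ ≤ M) (hNA : NoArbitrage P ℱ S)
    {x : ℕ → Fin T → Ω → EuclideanSpace ℝ (Fin d)} (hx : ∀ n, IsAdmissible P ℱ S U c (x n))
    (hxb : ∀ n, b ≤ expectedUtility P S U c (x n)) :
    ∃ y : ℕ → Fin T → Ω → EuclideanSpace ℝ (Fin d), (∀ n, y n ∈ convexHull ℝ (x '' Ici n)) ∧
      ∀ᵐ ω ∂P, ∀ i, ∃ l : ℝ, Tendsto (fun n => gains S (y n) i ω) atTop (nhds l) := by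
  have hconc : ConcaveOn ℝ univ U := hU.elim (fun h => h.1) fun h => h.1
  obtain ⟨Q, κ, hPQ, hQP, hQ⟩ := hNA.exists_centersIncrements hS hM
  have : IsFiniteMeasure Q := isFiniteMeasure_of_le _ hQP
  obtain ⟨K, hK⟩ := hdom.exists_integral_abs_gain_le hU hmono hS hM hQP hQ c b
  obtain ⟨y, hy, hlim⟩ := exists_convexHull_tendsto_ae (μ := Q) (gains S)
    (hdom.convex_setOf_le_expectedUtility hconc hS c b) (fun n => ⟨hx n, hxb n⟩)
    (fun φ hφ i => (hK φ hφ.1 hφ.2 i).1) fun φ hφ i => (hK φ hφ.1 hφ.2 i).2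
  exact ⟨y, hy, hPQ.ae_le hlim⟩

/-- The strategy with the same gains as `φ` whose portfolios are the canonical representatives of
those of `φ`. -/
def canonicalStrategy (P : Measure Ω) (ℱ : Filtration (Fin (T + 1)) mΩ)
    (S : Fin (T + 1) → Ω → EuclideanSpace ℝ (Fin d)) (φ : Fin T → Ω → EuclideanSpace ℝ (Fin d)) :
    Fin T → Ω → EuclideanSpace ℝ (Fin d) :=
  fun i ω => canonicalRep (ℱ i.castSucc) P (increment S i) ω (φ i ω)

variable {φ : Fin T → Ω → EuclideanSpace ℝ (Fin d)}

lemma terminalWealth_canonicalStrategy [IsFiniteMeasure P] (hS : ∀ t, Measurable[ℱ t] (S t))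
    (hM : ∀ i, ∀ᵐ ω ∂P, ‖increment S i ω‖ ≤ M) :
    terminalWealth S c (canonicalStrategy P ℱ S φ) =ᵐ[P] terminalWealth S c φ := by
  have hinner := ae_all_iff.2 fun i => inner_canonicalRep (ℱ.le i.castSucc)
    ((measurable_increment hS i).mono (ℱ.le _) le_rfl) (hM i)
  filter_upwards [hinner] with ω hω
  simp only [terminalWealth, canonicalStrategy, hω]

lemma expectedUtility_canonicalStrategy [IsFiniteMeasure P] (hS : ∀ t, Measurable[ℱ t] (S t))
    (hM : ∀ i, ∀ᵐ ω ∂P, ‖increment S i ω‖ ≤ M) :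
    expectedUtility P S U c (canonicalStrategy P ℱ S φ) = expectedUtility P S U c φ :=
  integral_congr_ae ((terminalWealth_canonicalStrategy hS hM).fun_comp U)

lemma IsAdmissible.canonicalStrategy [IsFiniteMeasure P] (hφ : IsAdmissible P ℱ S U c φ)
    (hS : ∀ t, Measurable[ℱ t] (S t)) (hM : ∀ i, ∀ᵐ ω ∂P, ‖increment S i ω‖ ≤ M) :
    IsAdmissible P ℱ S U c (canonicalStrategy P ℱ S φ) where
  isStrategy i := measurable_canonicalRep _ (hφ.isStrategy i)
  integrable := hφ.integrable.congr ((terminalWealth_canonicalStrategy hS hM).symm.fun_comp U)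

lemma exists_subseq_canonicalStrategy_tendsto [IsFiniteMeasure P]
    (hS : ∀ t, Measurable[ℱ t] (S t)) (hM : ∀ i, ∀ᵐ ω ∂P, ‖increment S i ω‖ ≤ M)
    {y : ℕ → Fin T → Ω → EuclideanSpace ℝ (Fin d)} (hy : ∀ n, IsStrategy ℱ (y n))
    (hgain : ∀ᵐ ω ∂P, ∀ i, ∃ l : ℝ, Tendsto (fun n => gains S (y n) i ω) atTop (nhds l)) :
    ∃ σ : ℕ → ℕ, StrictMono σ ∧ ∃ ψ, IsStrategy ℱ ψ ∧ ∀ᵐ ω ∂P, ∀ i,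
      Tendsto (fun n => canonicalStrategy P ℱ S (y (σ n)) i ω) atTop (nhds (ψ i ω)) := by
  have hconv (i : Fin T) : ∀ᵐ ω ∂P, ∃ l : ℝ,
      Tendsto (fun n => (inner ℝ (y n i ω) (increment S i ω) : ℝ)) atTop (nhds l) :=
    hgain.mono fun ω hω => hω i
  have hcauchy (i : Fin T) : CauchyInMeasure P
      fun n ω => canonicalRep (ℱ i.castSucc) P (increment S i) ω (y n i ω) :=
    cauchyInMeasure_canonicalRep (ℱ.le i.castSucc)
      ((measurable_increment hS i).mono (ℱ.le _) le_rfl) (hM i) (fun n => hy n i) (hconv i)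
  obtain ⟨σ, hσ, hlim⟩ := exists_subseq_tendsto_of_cauchyInMeasure hcauchy
  have hψ (i : Fin T) := exists_measurable_limit
    (fun n => measurable_canonicalRep (increment S i) (hy (σ n) i)) (hlim.mono fun ω hω => hω i)
  choose ψ hψ hψlim using hψ
  exact ⟨σ, hσ, ψ, hψ, ae_all_iff.2 hψlim⟩

variable [IsProbabilityMeasure P]

lemma UtilityDominated.isAdmissible_of_tendsto (hdom : UtilityDominated P ℱ S U)
    (hU : ElasticityAtTop U ∨ ElasticityAtBot U) (hcont : Continuous U)
    (hS : ∀ t, Measurable[ℱ t] (S t)) {φ : ℕ → Fin T → Ω → EuclideanSpace ℝ (Fin d)}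
    (hφ : ∀ n, IsAdmissible P ℱ S U c (φ n)) (hb : ∀ n, b ≤ expectedUtility P S U c (φ n))
    {ψ : Fin T → Ω → EuclideanSpace ℝ (Fin d)} (hψ : IsStrategy ℱ ψ)
    (hlim : ∀ᵐ ω ∂P, ∀ i, Tendsto (fun n => φ n i ω) atTop (nhds (ψ i ω))) :
    IsAdmissible P ℱ S U c ψ := by
  obtain ⟨K, hK⟩ := hdom.exists_integral_neg_le hU hS c b
  have hlimU : ∀ᵐ ω ∂P, Tendsto (fun n => max (-U (terminalWealth S c (φ n) ω)) 0) atTop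
      (nhds (max (-U (terminalWealth S c ψ ω)) 0)) := by
    filter_upwards [hlim] with ω hω
    exact ((hcont.tendsto _).comp (tendsto_terminalWealth hω)).neg.max tendsto_const_nhds
  have hint := (integrable_of_tendsto_of_nonneg (fun n => (hφ n).integrable.neg_part)
    (fun n ω => le_max_right _ _) hlimU (fun n => hK _ (hφ n) (hb n)) tendsto_const_nhds).1
  refine hdom.isAdmissible hcont.measurable hS hψ ?_
  exact (lintegral_mono fun ω => ENNReal.ofReal_le_ofReal (le_max_left _ _)).trans_lt
    hint.lintegral_lt_top

lemma UtilityDominated.exists_isAdmissible_limit (hdom : UtilityDominated P ℱ S U)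
    (hU : ElasticityAtTop U ∨ ElasticityAtBot U) (hmono : StrictMono U)
    (hS : ∀ t, Measurable[ℱ t] (S t)) (hM : ∀ i, ∀ᵐ ω ∂P, ‖increment S i ω‖ ≤ M)
    (hNA : NoArbitrage P ℱ S) {x : ℕ → Fin T → Ω → EuclideanSpace ℝ (Fin d)}
    (hx : ∀ n, IsAdmissible P ℱ S U c (x n)) (hxb : ∀ n, b ≤ expectedUtility P S U c (x n)) :
    ∃ ψ, IsAdmissible P ℱ S U c ψ ∧ ∀ a, (∀ᶠ n in atTop, a ≤ expectedUtility P S U c (x n)) →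
      a ≤ expectedUtility P S U c ψ := by
  have hconc : ConcaveOn ℝ univ U := hU.elim (fun h => h.1) fun h => h.1
  have hcont : Continuous U := continuousOn_univ.1 (hconc.continuousOn isOpen_univ)
  obtain ⟨y, hy, hgain⟩ := hdom.exists_convexHull_gains_tendsto hU hmono hS hM hNA hx hxb
  have hy_mem {a : ℝ} {N n : ℕ} (ha : ∀ k ≥ N, a ≤ expectedUtility P S U c (x k)) (hn : N ≤ n) :
      IsAdmissible P ℱ S U c (y n) ∧ a ≤ expectedUtility P S U c (y n) := by
    refine convexHull_min ?_ (hdom.convex_setOf_le_expectedUtility hconc hS c a) (hy n)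
    rintro _ ⟨k, hk, rfl⟩
    exact ⟨hx k, ha k (hn.trans hk)⟩
  have hyb (n : ℕ) := hy_mem (fun k _ => hxb k) n.zero_le
  obtain ⟨σ, hσ, ψ, hψ, hlim⟩ :=
    exists_subseq_canonicalStrategy_tendsto hS hM (fun n => (hyb n).1.isStrategy) hgain
  have hz (n : ℕ) : IsAdmissible P ℱ S U c (canonicalStrategy P ℱ S (y (σ n))) :=
    (hyb (σ n)).1.canonicalStrategy hS hM
  have hψadm : IsAdmissible P ℱ S U c ψ := hdom.isAdmissible_of_tendsto hU hcont hS hz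
    (fun n => (hyb (σ n)).2.trans_eq (expectedUtility_canonicalStrategy hS hM).symm) hψ hlim
  refine ⟨ψ, hψadm, fun a ha => ?_⟩
  obtain ⟨N, hN⟩ := eventually_atTop.1 ha
  refine hdom.le_expectedUtility_of_tendsto hmono.monotone hcont hS hM hz hψadm hlim ?_
  filter_upwards [hσ.tendsto_atTop.eventually_ge_atTop N] with n hn
  rw [expectedUtility_canonicalStrategy hS hM]
  exact (hy_mem hN hn).2

theorem UtilityDominated.exists_isMaximizer (hdom : UtilityDominated P ℱ S U)
    (hU : ElasticityAtTop U ∨ ElasticityAtBot U) (hmono : StrictMono U)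
    (hS : ∀ t, Measurable[ℱ t] (S t)) (hM : ∀ i, ∀ᵐ ω ∂P, ‖increment S i ω‖ ≤ M)
    (hNA : NoArbitrage P ℱ S) (c : ℝ) : ∃ φ, IsMaximizer P ℱ S U c φ := by
  let V : Set ℝ := expectedUtility P S U c '' {φ | IsAdmissible P ℱ S U c φ}
  have hVne : V.Nonempty := ⟨_, 0, isAdmissible_zero, rfl⟩
  have hVbdd : BddAbove V := by
    obtain ⟨C, hC⟩ := hdom.exists_expectedUtility_le c
    exact ⟨C, forall_mem_image.2 hC⟩
  obtain ⟨u, humono, hulim, huV⟩ := exists_seq_tendsto_sSup hVne hVbdd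
  choose x hx hxu using huV
  obtain ⟨ψ, hψ, hle⟩ := hdom.exists_isAdmissible_limit hU hmono hS hM hNA hx (b := u 0)
    fun n => (humono n.zero_le).trans_eq (hxu n).symm
  refine ⟨ψ, hψ, fun χ hχ => (le_csSup hVbdd ⟨χ, hχ, rfl⟩).trans ?_⟩
  refine le_of_forall_lt fun a ha => ?_
  obtain ⟨a', haa', ha'⟩ := exists_between ha
  refine haa'.trans_le (hle a' ?_)
  filter_upwards [hulim.eventually_const_le ha'] with n hn
  exact hn.trans_eq (hxu n).symm

end Existence

end UtilityMax

end

theorem theorem6p2_general {Ω : Type*} {mΩ : MeasurableSpace Ω} (P : Measure Ω)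
    [IsProbabilityMeasure P] (T d : ℕ) (ℱ : Filtration (Fin (T + 1)) mΩ)
    (S : Fin (T + 1) → Ω → EuclideanSpace ℝ (Fin d))
    (hadapted : ∀ t, Measurable[ℱ t] (S t))
    (hbdd : ∃ M : ℝ, ∀ t, ∀ᵐ ω ∂P, ‖S t ω‖ ≤ M)
    (U : ℝ → ℝ)
    (hU : UtilityMax.ElasticityAtTop U ∨ UtilityMax.ElasticityAtBot U)
    (hmono : StrictMono U) (hd : Differentiable ℝ U)
    (hNA : UtilityMax.NoArbitrage P ℱ S)
    (hfin : UtilityMax.FiniteValue P ℱ S U)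
    (c : ℝ) :
    (∃ φ, UtilityMax.IsOptimal P ℱ S U c φ) ∧
    ∀ φ, UtilityMax.IsOptimal P ℱ S U c φ →
      Integrable (fun ω => deriv U (UtilityMax.terminalWealth S c φ ω)) P ∧
      0 < ∫ ω, deriv U (UtilityMax.terminalWealth S c φ ω) ∂P ∧
      UtilityMax.IsEquivMartingaleMeasure P (UtilityMax.marginalUtilityMeasure P S U c φ) ℱ S := by
  obtain ⟨M, hM⟩ := hbdd
  have hconc : ConcaveOn ℝ univ U := hU.elim (fun h => h.1) fun h => h.1
  have hdom := hfin.utilityDominated hmono.monotone hd.continuous hadapted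
  have hoptimal (φ) : UtilityMax.IsOptimal P ℱ S U c φ ↔ UtilityMax.IsMaximizer P ℱ S U c φ :=
    hdom.isOptimal_iff_isMaximizer hd.continuous.measurable hadapted
  simp only [hoptimal]
  exact ⟨hdom.exists_isMaximizer hU hmono hadapted (UtilityMax.ae_norm_increment_le hM) hNA c,
    fun φ hφ => hφ.isEquivMartingaleMeasure hdom hconc hmono hd hadapted hM⟩

theorem theorem6p2 {Ω : Type*} {mΩ : MeasurableSpace Ω} (P : Measure Ω) [IsProbabilityMeasure P]
    (T d : ℕ) (ℱ : Filtration (Fin (T + 1)) mΩ)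
    (hnull : ∀ A : Set Ω, MeasurableSet A → P A = 0 → MeasurableSet[ℱ 0] A)
    (S : Fin (T + 1) → Ω → EuclideanSpace ℝ (Fin d))
    (hadapted : ∀ t, Measurable[ℱ t] (S t))
    (hbdd : ∃ M : ℝ, ∀ t, ∀ᵐ ω ∂P, ‖S t ω‖ ≤ M)
    (U : ℝ → ℝ)
    (hU : UtilityMax.ElasticityAtTop U ∨ UtilityMax.ElasticityAtBot U)
    (hmono : StrictMono U) (hC1 : ContDiff ℝ 1 U)
    (hNA : UtilityMax.NoArbitrage P ℱ S)
    (hfin : UtilityMax.FiniteValue P ℱ S U)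
    (c : ℝ) :
    (∃ φ, UtilityMax.IsOptimal P ℱ S U c φ) ∧
    ∀ φ, UtilityMax.IsOptimal P ℱ S U c φ →
      Integrable (fun ω => deriv U (UtilityMax.terminalWealth S c φ ω)) P ∧
      0 < ∫ ω, deriv U (UtilityMax.terminalWealth S c φ ω) ∂P ∧
      UtilityMax.IsEquivMartingaleMeasure P (UtilityMax.marginalUtilityMeasure P S U c φ) ℱ S := by
  exact theorem6p2_general P T d ℱ S hadapted hbdd U hU hmono
    (hC1.differentiable one_ne_zero) hNA hfin c
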